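/- Let $k\in(0,1)$, $k'=\sqrt{1-k^2}$, $\alpha\in\mathbb R\setminus\{0\}$, let $K=K(k)$, $E=E(k)$ be the complete elliptic integrals, $K'=K(k')$, and let $\vartheta_1,\dots,\vartheta_4$ be the Jacobi theta functions with $\tau=\mathrm iK'/K$, $q=\mathrm e^{\mathrm i\pi\tau}$, $$\vartheta_1(z)=\mathrm i\sum_{n\in\mathbb Z}(-1)^nq^{(n-\frac12)^2}\mathrm e^{(2n-1)\mathrm i\pi z},\quad \vartheta_2(z)=\sum_{n\in\mathbb Z}q^{(n-\frac12)^2}\mathrm e^{(2n-1)\mathrm i\pi z},\quad \vartheta_3(z)=\sum_{n\in\mathbb Z}q^{n^2}\mathrm e^{2n\mathrm i\pi z},\quad \vartheta_4(z)=\sum_{n\in\mathbb Z}(-1)^nq^{n^2}\mathrm e^{2n\mathrm i\pi z},$$ $\vartheta_j=\vartheta_j(0)$; $\mathrm{sn},\mathrm{cn},\mathrm{dn}$ are the Jacobi elliptic functions of modulus $k$ and $Z(u)=\int_0^u(\mathrm{dn}^2(v)-E/K)\,\mathrm dv$. Consider one of the two backgrounds of the mKdV equation $u_t+6u^2u_x+u_{xxx}=0$: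 either $u=k\alpha\,\mathrm{cn}(\alpha\xi)$, with $l=0$, $s=\alpha^2(2k^2-1)$, or $u=\alpha\,\mathrm{dn}(\alpha\xi)$, with $l=\frac{K'}2$, $s=\alpha^2(2-k^2)$; here $\xi=x-st$. Put $\lambda(z)=\frac{\mathrm i\alpha}2\frac{\mathrm{dn}\,\mathrm{sn}}{\mathrm{cn}}(\mathrm i(z-l))$ if $l=0$, $\lambda(z)=\frac{\mathrm i\alpha k^2}2\frac{\mathrm{sn}\,\mathrm{cn}}{\mathrm{dn}}(\mathrm i(z-l))$ if $l=\frac{K'}2$, $$\Omega(z)=\alpha^3\Big(k^2(\mathrm{dn}\,\mathrm{sn}\,\mathrm{cn})(\mathrm i(z-l))+k'^2\,\frac{\mathrm{dn}\,\mathrm{sn}}{\mathrm{cn}^3}(\mathrm i(z+l))\Big),$$ $$E_1(z)=\exp\big((\alpha Z(\mathrm i(z-l))+\mathrm i\lambda(z))\xi+\tfrac12\Omega(z)t\big),$$ $$E_2(z)=\exp\big((-\tfrac{\mathrm i\alpha\pi}{2K}-\alpha Z(\mathrm i(z+l)+K+\mathrm iK')+\mathrm i\lambda(z))\xi-\tfrac12\Omega(z)t\big).$$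 Choose $n_1,n_2\ge0$ and parameters in the rectangle $S=\{|\Re z-l|\le K',\ |\Im z|\le K/2\}$: $n_1$ numbers $z$ with $\lambda(z)\in\mathrm i\mathbb R$, each with a constant $c$, and $n_2$ numbers $z$ with $\lambda(z)\notin\mathrm i\mathbb R$, each with a constant $c$ and each accompanied by the further parameter $2l-z^*$ with constant $c^*$. Let $z_1,\dots,z_m$ and $c_1,\dots,c_m$, $m=n_1+2n_2$, be all these parameters and constants, put $\lambda_i=\lambda(z_i)$, and assume $\lambda_j\ne\lambda_i^*$ for all $i,j$ (so that no denominator $\lambda_j-\lambda_i^*$ vanishes). With $N=n_1+n_2$, the multi elliptic-breather solution is $$u^{[N]}(x,t)=\frac{\alpha\vartheta_2\vartheta_4}{\vartheta_3\,\vartheta_3(\frac{2\mathrm il}{2K})}\left(\frac{\vartheta_4(\frac{\alpha\xi}{2K})}{\vartheta_2(\frac{\alpha\xi+2\mathrm il}{2K})}\right)^{m-1}\frac{\det\mathcal M}{\det\mathcal D}\,\mathrm e^{-\alpha\xi Z(2\mathrm il+K)},$$ where $\mathcal M,\mathcal D$ are the $m\times m$ matrices with entries $$\mathcal M_{ij}=\begin{bmatrix}\frac{E_1(z_i)^*}{r(z_i^*)}&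 r(z_i^*)c_i^*E_2(z_i)^*\end{bmatrix}\begin{bmatrix}\frac{\vartheta_2(\frac{\mathrm i(z_j-z_i^*-2l)-\alpha\xi}{2K})}{\vartheta_1(\frac{\mathrm i(z_j-z_i^*)}{2K})}&-\frac{\vartheta_4(\frac{\mathrm i(z_i^*+z_j+2l)+\alpha\xi}{2K})}{\vartheta_3(\frac{\mathrm i(z_i^*+z_j)}{2K})}\\ \frac{\vartheta_4(\frac{\mathrm i(z_i^*+z_j-2l)-\alpha\xi}{2K})}{\vartheta_3(\frac{\mathrm i(z_i^*+z_j)}{2K})}&\frac{\vartheta_2(\frac{\mathrm i(z_j-z_i^*+2l)+\alpha\xi}{2K})}{\vartheta_1(\frac{\mathrm i(z_j-z_i^*)}{2K})}\end{bmatrix}\begin{bmatrix}r(z_j)E_1(z_j)\\ \frac{c_jE_2(z_j)}{r(z_j)}\end{bmatrix},\quad r(z)=\frac{\vartheta_2(\frac{\mathrm i(z+l)}{2K})}{\vartheta_4(\frac{\mathrm i(z-l)}{2K})},$$ $$\mathcal D_{ij}=\begin{bmatrix}E_1(z_i)^*& c_i^*E_2(z_i)^*\end{bmatrix}\begin{bmatrix}\frac{\vartheta_4(\frac{\mathrm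 i(z_i^*-z_j)+\alpha\xi}{2K})}{\vartheta_1(\frac{\mathrm i(z_j-z_i^*)}{2K})}&\frac{\vartheta_2(\frac{\mathrm i(z_i^*+z_j)+\alpha\xi}{2K})}{\vartheta_3(\frac{\mathrm i(z_i^*+z_j)}{2K})}\\ \frac{\vartheta_2(\frac{\mathrm i(z_i^*+z_j)-\alpha\xi}{2K})}{\vartheta_3(\frac{\mathrm i(z_i^*+z_j)}{2K})}&\frac{\vartheta_4(\frac{\mathrm i(z_i^*-z_j)-\alpha\xi}{2K})}{\vartheta_1(\frac{\mathrm i(z_j-z_i^*)}{2K})}\end{bmatrix}\begin{bmatrix}E_1(z_j)\\ c_jE_2(z_j)\end{bmatrix}.$$ **Theorem.** If $c_i=1$ for $i=1,\dots,m$, then $u^{[N]}(x,t)=u^{[N]}(-x,-t)$ for all $(x,t)\in\mathbb R^2$ at which the expression is defined. The same symmetry holds for all $(x,t)\in\mathbb R^2$ at which $\mathbf M$ below is invertible, for the Darboux-Bäcklund form of the solution $$u^{[N]}=u-2\mathrm i\,\mathbf X_1\mathbf M^{-1}\mathbf X_2^\dagger,\qquad \mathbf M=\Big(\frac{\Phi_i^\dagger\Phi_j}{\lambda_j-\lambda_i^*}\Big)_{i,j},\qquad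 \begin{bmatrix}\mathbf X_1\\ \mathbf X_2\end{bmatrix}=[\Phi_1,\dots,\Phi_m],\qquad \Phi_i=\Phi(x,t;z_i)\begin{bmatrix}1\\ c_i\end{bmatrix},$$ $$\Phi(x,t;z)=\frac{\alpha\vartheta_2\vartheta_4}{\vartheta_3\vartheta_4(\frac{\alpha\xi}{2K})}\begin{bmatrix}\frac{\vartheta_1(\frac{\mathrm i(z-l)-\alpha\xi}{2K})}{\vartheta_4(\frac{\mathrm i(z-l)}{2K})}E_1(z)&\frac{\vartheta_3(\frac{\mathrm i(z+l)+\alpha\xi}{2K})}{\vartheta_2(\frac{\mathrm i(z+l)}{2K})}E_2(z)\\ -\frac{\vartheta_3(\frac{\mathrm i(z+l)-\alpha\xi}{2K})}{\vartheta_2(\frac{\mathrm i(z+l)}{2K})}\mathrm e^{\alpha\xi Z(2\mathrm il+K)}E_1(z)&-\frac{\vartheta_1(\frac{\mathrm i(z-l)+\alpha\xi}{2K})}{\vartheta_4(\frac{\mathrm i(z-l)}{2K})}\mathrm e^{\alpha\xi Z(2\mathrm il+K)}E_2(z)\end{bmatrix}.$$ -/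

import Mathlib

open scoped ComplexConjugate

noncomputable section

namespace MKdV

/-! ### Elliptic integrals, theta functions and elliptic functions of modulus `k` -/

/-- The complete elliptic integral of the first kind `K(k)`. -/
def ellipticK (k : ℝ) : ℝ :=
  ∫ θ in (0 : ℝ)..(Real.pi / 2), 1 / Real.sqrt (1 - k ^ 2 * Real.sin θ ^ 2)

/-- The complete elliptic integral of the second kind `E(k)`. -/
def ellipticE (k : ℝ) : ℝ :=
  ∫ θ in (0 : ℝ)..(Real.pi / 2), Real.sqrt (1 - k ^ 2 * Real.sin θ ^ 2)

/-- The complementary modulus `k' = √(1 - k²)`. -/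
def compl (k : ℝ) : ℝ := Real.sqrt (1 - k ^ 2)

/-- The associated complete integral `K' = K(k')`. -/
def ellipticK' (k : ℝ) : ℝ := ellipticK (compl k)

/-- The period ratio `τ = i K' / K`; the nome is `q = exp (i π τ)`. -/
def tau (k : ℝ) : ℂ := Complex.I * (ellipticK' k : ℂ) / (ellipticK k : ℂ)

/-- `nomePow k r = q ^ r = exp (i π τ r)`. -/
def nomePow (k : ℝ) (r : ℂ) : ℂ := Complex.exp (Complex.I * Real.pi * tau k * r)

/-- `ϑ₁(z) = i ∑ (-1)ⁿ q^((n - 1/2)²) e^((2n - 1) i π z)`. -/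
def theta1 (k : ℝ) (z : ℂ) : ℂ :=
  Complex.I * ∑' n : ℤ, (-1 : ℂ) ^ n * nomePow k (((n : ℂ) - 1 / 2) ^ 2) *
    Complex.exp ((2 * (n : ℂ) - 1) * Complex.I * Real.pi * z)

/-- `ϑ₂(z) = ∑ q^((n - 1/2)²) e^((2n - 1) i π z)`. -/
def theta2 (k : ℝ) (z : ℂ) : ℂ :=
  ∑' n : ℤ, nomePow k (((n : ℂ) - 1 / 2) ^ 2) *
    Complex.exp ((2 * (n : ℂ) - 1) * Complex.I * Real.pi * z)

/-- `ϑ₃(z) = ∑ q^(n²) e^(2 n i π z)`. -/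
def theta3 (k : ℝ) (z : ℂ) : ℂ :=
  ∑' n : ℤ, nomePow k ((n : ℂ) ^ 2) * Complex.exp (2 * (n : ℂ) * Complex.I * Real.pi * z)

/-- `ϑ₄(z) = ∑ (-1)ⁿ q^(n²) e^(2 n i π z)`. -/
def theta4 (k : ℝ) (z : ℂ) : ℂ :=
  ∑' n : ℤ, (-1 : ℂ) ^ n * nomePow k ((n : ℂ) ^ 2) *
    Complex.exp (2 * (n : ℂ) * Complex.I * Real.pi * z)

/-- The scaling `u ↦ u / (2K)` from arguments of elliptic functions to arguments of thetas. -/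
def sc (k : ℝ) (u : ℂ) : ℂ := u / (2 * (ellipticK k : ℂ))

/-- Jacobi's `sn(u, k)`. -/
def sn (k : ℝ) (u : ℂ) : ℂ :=
  theta3 k 0 * theta1 k (sc k u) / (theta2 k 0 * theta4 k (sc k u))

/-- Jacobi's `cn(u, k)`. -/
def cn (k : ℝ) (u : ℂ) : ℂ :=
  theta4 k 0 * theta2 k (sc k u) / (theta2 k 0 * theta4 k (sc k u))

/-- Jacobi's `dn(u, k)`. -/
def dn (k : ℝ) (u : ℂ) : ℂ :=
  theta4 k 0 * theta3 k (sc k u) / (theta3 k 0 * theta4 k (sc k u))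

/-- The Jacobi zeta function `Z(u) = ∫₀ᵘ (dn²(v) - E/K) dv`, integrated along the segment from
`0` to `u` (`dn²` has no residues, so the integral does not depend on the path). -/
def jacobiZeta (k : ℝ) (u : ℂ) : ℂ :=
  ∫ r in (0 : ℝ)..1,
    u * (dn k ((r : ℂ) * u) ^ 2 - (ellipticE k : ℂ) / (ellipticK k : ℂ))

/-! ### Elliptic backgrounds and the associated solutions of the Lax pair -/

/-- The two elliptic backgrounds. -/
inductive Background
  | cnType
  | dnType

/-- The shift `l`: `0` on the `cn` background and `K'/2` on the `dn` background. -/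
def shift (k : ℝ) : Background → ℝ
  | .cnType => 0
  | .dnType => ellipticK' k / 2

/-- The velocity `s` of the background. -/
def velocity (k α : ℝ) : Background → ℝ
  | .cnType => α ^ 2 * (2 * k ^ 2 - 1)
  | .dnType => α ^ 2 * (2 - k ^ 2)

/-- The travelling coordinate `ξ = x - s t`. -/
def xi (k α : ℝ) (b : Background) (x t : ℝ) : ℝ := x - velocity k α b * t

/-- The background solution: `k α cn(α ξ, k)` or `α dn(α ξ, k)`. -/
def background (k α : ℝ) (b : Background) (x t : ℝ) : ℂ :=
  match b with
  | .cnType => (k : ℂ) * (α : ℂ) * cn k ((α : ℂ) * (xi k α b x t : ℂ))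
  | .dnType => (α : ℂ) * dn k ((α : ℂ) * (xi k α b x t : ℂ))

/-- The argument `i (z - l)`. -/
def argMinus (k : ℝ) (b : Background) (z : ℂ) : ℂ := Complex.I * (z - (shift k b : ℂ))

/-- The argument `i (z + l)`. -/
def argPlus (k : ℝ) (b : Background) (z : ℂ) : ℂ := Complex.I * (z + (shift k b : ℂ))

/-- The spectral parameter `λ(z)` as a function of the uniformizing parameter `z`. -/
def spec (k α : ℝ) (b : Background) (z : ℂ) : ℂ :=
  match b with
  | .cnType => Complex.I * (α : ℂ) / 2 *
      (dn k (argMinus k b z) * sn k (argMinus k b z) / cn k (argMinus k b z))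
  | .dnType => Complex.I * (α : ℂ) * (k : ℂ) ^ 2 / 2 *
      (sn k (argMinus k b z) * cn k (argMinus k b z) / dn k (argMinus k b z))

/-- The rectangle `S` of uniformizing parameters. -/
def rectS (k : ℝ) (b : Background) : Set ℂ :=
  {z | -ellipticK' k + shift k b ≤ z.re ∧ z.re ≤ ellipticK' k + shift k b ∧
    -(ellipticK k / 2) ≤ z.im ∧ z.im ≤ ellipticK k / 2}

/-- The frequency `Ω(z) = 8 i λ y`, with the sign for which `Phi` below solves the time part
`Φ_t = V Φ` of the Lax pair of `u_t + 6 u² u_x + u_xxx = 0`. -/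
def Omega (k α : ℝ) (b : Background) (z : ℂ) : ℂ :=
  (α : ℂ) ^ 3 *
    ((k : ℂ) ^ 2 * dn k (argMinus k b z) * sn k (argMinus k b z) * cn k (argMinus k b z) +
      (compl k : ℂ) ^ 2 *
        (dn k (argPlus k b z) * sn k (argPlus k b z) / cn k (argPlus k b z) ^ 3))

/-- `E₁(x,t;z) = exp((α Z(i(z-l)) + iλ) ξ + 4 i y λ t)`, where `4 i y λ = Ω/2`. -/
def E1 (k α : ℝ) (b : Background) (x t : ℝ) (z : ℂ) : ℂ :=
  Complex.exp (((α : ℂ) * jacobiZeta k (argMinus k b z) + Complex.I * spec k α b z) *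
      (xi k α b x t : ℂ) + Omega k α b z / 2 * (t : ℂ))

/-- `E₂(x,t;z) = exp((-iαπ/(2K) - α Z(i(z+l)+K+iK') + iλ) ξ - 4 i y λ t)`. -/
def E2 (k α : ℝ) (b : Background) (x t : ℝ) (z : ℂ) : ℂ :=
  Complex.exp ((-(Complex.I * ((α : ℂ) * Real.pi / (2 * (ellipticK k : ℂ)))) -
        (α : ℂ) * jacobiZeta k
          (argPlus k b z + (ellipticK k : ℂ) + Complex.I * (ellipticK' k : ℂ)) +
        Complex.I * spec k α b z) *
      (xi k α b x t : ℂ) - Omega k α b z / 2 * (t : ℂ))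

/-- The constant `Z(2 i l + K)`. -/
def zetaShift (k : ℝ) (b : Background) : ℂ :=
  jacobiZeta k (2 * Complex.I * (shift k b : ℂ) + (ellipticK k : ℂ))

/-- The fundamental solution `Φ(x,t;λ(z))` of the Lax pair. -/
def Phi (k α : ℝ) (b : Background) (x t : ℝ) (z : ℂ) : Matrix (Fin 2) (Fin 2) ℂ :=
  let X : ℂ := (α : ℂ) * (xi k α b x t : ℂ)
  let e : ℂ := Complex.exp (X * zetaShift k b)
  let d4 : ℂ := theta4 k (sc k (argMinus k b z))
  let d2 : ℂ := theta2 k (sc k (argPlus k b z))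
  ((α : ℂ) * theta2 k 0 * theta4 k 0 / (theta3 k 0 * theta4 k (sc k X))) •
    !![theta1 k (sc k (argMinus k b z - X)) / d4 * E1 k α b x t z,
       theta3 k (sc k (argPlus k b z + X)) / d2 * E2 k α b x t z;
       -(theta3 k (sc k (argPlus k b z - X)) / d2 * e * E1 k α b x t z),
       -(theta1 k (sc k (argMinus k b z + X)) / d4 * e * E2 k α b x t z)]

/-- The Darboux seed `Φ(x,t;λ(z)) (1, c)ᵀ`. -/
def seed (k α : ℝ) (b : Background) (x t : ℝ) (z c : ℂ) : Fin 2 → ℂ :=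
  (Phi k α b x t z).mulVec ![1, c]

/-! ### Parameters of the multifold Darboux transformation

There are `n₁` elementary factors of the first kind (`λ(z) ∈ iℝ`), each with one parameter `z`, and
`n₂` factors of the second kind (`λ(z) ∉ iℝ`), each contributing the two parameters `z` and
`2l - z*` with constants `c` and `c*`. Thus `N = n₁ + n₂` and `m = n₁ + 2 n₂`. -/

/-- The index set of the `m = n₁ + 2 n₂` parameters. -/
abbrev Idx (n₁ n₂ : ℕ) : Type := Fin n₁ ⊕ (Fin n₂ ⊕ Fin n₂)

/-- The list `z₁, …, z_m` of uniformizing parameters. -/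
def fullZ (k : ℝ) (b : Background) {n₁ n₂ : ℕ} (zP : Fin n₁ → ℂ) (zC : Fin n₂ → ℂ) :
    Idx n₁ n₂ → ℂ
  | .inl i => zP i
  | .inr (.inl i) => zC i
  | .inr (.inr i) => 2 * (shift k b : ℂ) - conj (zC i)

/-- The list `c₁, …, c_m` of Darboux constants. -/
def fullC {n₁ n₂ : ℕ} (cP : Fin n₁ → ℂ) (cC : Fin n₂ → ℂ) : Idx n₁ n₂ → ℂ
  | .inl i => cP i
  | .inr (.inl i) => cC i
  | .inr (.inr i) => conj (cC i)

/-! ### The multi elliptic-breather solution -/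

section Breather

variable {ι : Type} [Fintype ι] [DecidableEq ι]

/-- `r(z) = ϑ₂(i(z+l)/(2K)) / ϑ₄(i(z-l)/(2K))`. -/
def rFun (k : ℝ) (b : Background) (z : ℂ) : ℂ :=
  theta2 k (sc k (argPlus k b z)) / theta4 k (sc k (argMinus k b z))

/-- The matrix in the numerator of the theta function expression. -/
def matM (k α : ℝ) (b : Background) (z c : ι → ℂ) (x t : ℝ) : Matrix ι ι ℂ :=
  Matrix.of fun i j =>
    let X : ℂ := (α : ℂ) * (xi k α b x t : ℂ)
    let l : ℂ := (shift k b : ℂ)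
    let zi : ℂ := conj (z i)
    let zj : ℂ := z j
    let den1 : ℂ := theta1 k (sc k (Complex.I * (zj - zi)))
    let den3 : ℂ := theta3 k (sc k (Complex.I * (zi + zj)))
    let left : Fin 2 → ℂ :=
      ![(rFun k b zi)⁻¹ * conj (E1 k α b x t (z i)),
        rFun k b zi * conj (c i) * conj (E2 k α b x t (z i))]
    let right : Fin 2 → ℂ :=
      ![rFun k b zj * E1 k α b x t zj, (rFun k b zj)⁻¹ * c j * E2 k α b x t zj]
    let core : Matrix (Fin 2) (Fin 2) ℂ :=
      !![theta2 k (sc k (Complex.I * (zj - zi - 2 * l) - X)) / den1,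
         -(theta4 k (sc k (Complex.I * (zi + zj + 2 * l) + X)) / den3);
         theta4 k (sc k (Complex.I * (zi + zj - 2 * l) - X)) / den3,
         theta2 k (sc k (Complex.I * (zj - zi + 2 * l) + X)) / den1]
    dotProduct left (core.mulVec right)

/-- The matrix in the denominator of the theta function expression. -/
def matD (k α : ℝ) (b : Background) (z c : ι → ℂ) (x t : ℝ) : Matrix ι ι ℂ :=
  Matrix.of fun i j =>
    let X : ℂ := (α : ℂ) * (xi k α b x t : ℂ)
    let zi : ℂ := conj (z i)
    let zj : ℂ := z j
    let den1 : ℂ := theta1 k (sc k (Complex.I * (zj - zi)))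
    let den3 : ℂ := theta3 k (sc k (Complex.I * (zi + zj)))
    let left : Fin 2 → ℂ :=
      ![conj (E1 k α b x t (z i)), conj (c i) * conj (E2 k α b x t (z i))]
    let right : Fin 2 → ℂ := ![E1 k α b x t zj, c j * E2 k α b x t zj]
    let core : Matrix (Fin 2) (Fin 2) ℂ :=
      !![theta4 k (sc k (Complex.I * (zi - zj) + X)) / den1,
         theta2 k (sc k (Complex.I * (zi + zj) + X)) / den3;
         theta2 k (sc k (Complex.I * (zi + zj) - X)) / den3,
         theta4 k (sc k (Complex.I * (zi - zj) - X)) / den1]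
    dotProduct left (core.mulVec right)

/-- The multi elliptic-breather solution `u^[N](x,t)` in theta function form. -/
def breatherTheta (k α : ℝ) (b : Background) (z c : ι → ℂ) (x t : ℝ) : ℂ :=
  let X : ℂ := (α : ℂ) * (xi k α b x t : ℂ)
  let l : ℂ := (shift k b : ℂ)
  (α : ℂ) * theta2 k 0 * theta4 k 0 / (theta3 k 0 * theta3 k (sc k (2 * Complex.I * l))) *
    (theta4 k (sc k X) / theta2 k (sc k (X + 2 * Complex.I * l))) ^ ((Fintype.card ι : ℤ) - 1) *
    ((matM k α b z c x t).det / (matD k α b z c x t).det) *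
    Complex.exp (-(X * zetaShift k b))

/-- The matrix `(Φ_i† Φ_j / (λ_j - λ_i*))_{i,j}` of the multifold Darboux transformation. -/
def darbouxM (k α : ℝ) (b : Background) (z c : ι → ℂ) (x t : ℝ) : Matrix ι ι ℂ :=
  Matrix.of fun i j =>
    dotProduct (star (seed k α b x t (z i) (c i))) (seed k α b x t (z j) (c j)) /
      (spec k α b (z j) - conj (spec k α b (z i)))

/-- The multi elliptic-breather solution `u^[N](x,t)` as the Bäcklund transform
`u - 2 i X₁ M⁻¹ X₂†` of the background `u`, where `X₁`, `X₂` are the rows of the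
matrix `X = [Φ_1, …, Φ_m]`. It has no removable singularities at the zeros of the background. -/
def breatherDarboux (k α : ℝ) (b : Background) (z c : ι → ℂ) (x t : ℝ) : ℂ :=
  background k α b x t - 2 * Complex.I *
    dotProduct (fun i => seed k α b x t (z i) (c i) 0)
      ((darbouxM k α b z c x t)⁻¹.mulVec (fun j => conj (seed k α b x t (z j) (c j) 1)))

end Breather

end MKdV

end

/-!
The reflection `(x, t) ↦ (-x, -t)` inverts the exponentials `E₁`, `E₂` and changes the sign of the
position `y = αξ / (2K)`. When all constants are `1`, this multiplies the entry `(i, j)` of the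
denominator matrix `𝒟` by `(E₁E₂)(zᵢ)*⁻¹ (E₁E₂)(zⱼ)⁻¹`, and it turns the numerator matrix `ℳ` into
its adjoint `ℳ†` multiplied by the same factors (`denForm_inv`, `numForm_inv`), once an exponential
common to all entries is combined with the prefactor (`breatherTheta_eq`). The factors cancel in
`det ℳ / det 𝒟`, so the claim for the theta function form is that `det ℳ` is real. In the Darboux
form the reflection exchanges the rows `X₁` and `X₂` up to such factors (`seedVec_inv`), and the
claim is that `X₁ M⁻¹ X₂†` is imaginary (`darboux_term_swap`).

Both hold because the list of parameters is closed under complex conjugation. In the scaled argument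
`v = i(z - l) / (2K)` the passage from `z` to `2l - z*` is `v ↦ v*`, so the pairs with `λ ∉ iℝ` are
exchanged. A parameter with `λ(z) ∈ iℝ` satisfies `λ(v) = λ(v*)`. By the addition theorems for theta
functions this places `v` on a symmetry line of the period rectangle, where `v* = v`, `v* = v ± τ`
or, on the `dn` background, `v* = ±1/2 - v` (`conj_cases_of_specV`). In each case the seed and the
entries of `ℳ` are the same for `v` and `v*`, up to a sign that occurs twice in `det ℳ` and in the
Darboux term (`laxDatum_cconj_equivalent`).

These computations are made with theta functions only. Their period ratio is `i K'/K` with `K`,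
`K'` given by integrals, so that Jacobi's inversion theorem is needed (`thetaModulus_periodRatio`):
the theta quotient `ϑ₂² / ϑ₃²` at this period ratio is the modulus `k`. It follows from the
differential equation of `sn`, the transformation `τ ↦ -1/τ` and the monotonicity of `K'/K`.
Differentiating the addition theorem of `ϑ₄` twice identifies the Jacobi zeta function with `Θ'/Θ`
(`jacobiZeta_eq`), and the zeros of the theta functions, located by the doubling `τ ↦ 2τ`
(`jt4_ne_zero`), show that its paths of integration avoid the poles.
-/

open scoped ComplexConjugate

namespace MKdV

open Complex (I exp exp_add exp_neg)
open scoped Real Matrix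

/-! ### Theta functions of a general period ratio -/

section Theta

/-- The theta function `ϑ₃(z | τ)`. -/
noncomputable def jt3 (τ z : ℂ) : ℂ := jacobiTheta₂ z τ

/-- The theta function `ϑ₄(z | τ)`. -/
noncomputable def jt4 (τ z : ℂ) : ℂ := jt3 τ (z + 1 / 2)

/-- The theta function `ϑ₂(z | τ)`. -/
noncomputable def jt2 (τ z : ℂ) : ℂ := exp (π * I * (τ / 4 + z)) * jt3 τ (z + τ / 2)

/-- The theta function `ϑ₁(z | τ)`. -/
noncomputable def jt1 (τ z : ℂ) : ℂ := jt2 τ (z - 1 / 2)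

variable (τ z : ℂ)

lemma exp_pi_I_half : exp (π * I * (1 / 2)) = I := by
  rw [show (π : ℂ) * I * (1 / 2) = π / 2 * I by ring, Complex.exp_pi_div_two_mul_I]

lemma exp_pi_I_neg_half : exp (π * I * (-1 / 2)) = -I := by
  rw [show (π : ℂ) * I * (-1 / 2) = -(π * I * (1 / 2)) by ring, exp_neg, exp_pi_I_half,
    Complex.inv_I]

lemma jt3_add_one : jt3 τ (z + 1) = jt3 τ z := jacobiTheta₂_add_left z τ

lemma jt3_add_tau : jt3 τ (z + τ) = exp (-π * I * (τ + 2 * z)) * jt3 τ z :=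
  jacobiTheta₂_add_left' z τ

lemma jt3_neg : jt3 τ (-z) = jt3 τ z := jacobiTheta₂_neg_left z τ

lemma jt3_add_half : jt3 τ (z + 1 / 2) = jt4 τ z := rfl

lemma jt3_sub_half : jt3 τ (z - 1 / 2) = jt4 τ z := by
  rw [jt4, ← jt3_add_one τ (z - 1 / 2)]; congr 1; ring

lemma jt3_half_sub : jt3 τ (1 / 2 - z) = jt4 τ z := by
  rw [← jt3_neg, neg_sub, jt3_sub_half]

lemma jt4_neg : jt4 τ (-z) = jt4 τ z := by
  rw [jt4, ← jt3_neg, ← jt3_sub_half]; congr 1; ring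

lemma jt4_add_half : jt4 τ (z + 1 / 2) = jt3 τ z := by
  rw [jt4, ← jt3_add_one τ z]; congr 1; ring

lemma jt4_half_sub : jt4 τ (1 / 2 - z) = jt3 τ z := by
  rw [← jt4_neg, neg_sub, ← jt4_add_half, jt4, jt4]
  rw [← jt3_add_one]; congr 1; ring

lemma jt4_add_one : jt4 τ (z + 1) = jt4 τ z := by
  rw [jt4, jt4, ← jt3_add_one τ (z + 1 / 2)]; congr 1; ring

lemma jt2_neg : jt2 τ (-z) = jt2 τ z := by
  have h : jt3 τ (z + τ / 2) = exp (-π * I * (2 * z)) * jt3 τ (-z + τ / 2) := by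
    rw [← jt3_neg τ (-z + τ / 2), show z + τ / 2 = -(-z + τ / 2) + τ by ring, jt3_add_tau]
    congr 2; ring
  rw [jt2, jt2, h, ← mul_assoc, ← exp_add]
  congr 2; ring

lemma jt2_add_one : jt2 τ (z + 1) = -jt2 τ z := by
  rw [jt2, jt2, show z + 1 + τ / 2 = z + τ / 2 + 1 by ring, jt3_add_one,
    show (π : ℂ) * I * (τ / 4 + (z + 1)) = π * I * (τ / 4 + z) + π * I by ring, exp_add,
    Complex.exp_pi_mul_I]
  ring

lemma jt1_add_half : jt1 τ (z + 1 / 2) = jt2 τ z := by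
  rw [jt1, add_sub_cancel_right]

lemma jt2_add_half : jt2 τ (z + 1 / 2) = -jt1 τ z := by
  rw [jt1, ← jt2_add_one]; congr 1; ring

lemma jt2_half_sub : jt2 τ (1 / 2 - z) = jt1 τ z := by
  rw [← jt2_neg, neg_sub, jt1]

lemma jt1_half_sub : jt1 τ (1 / 2 - z) = jt2 τ z := by
  rw [jt1, ← jt2_neg]; congr 1; ring

lemma jt1_neg : jt1 τ (-z) = -jt1 τ z := by
  rw [← jt2_add_half, jt1, ← jt2_neg]; congr 1; ring

lemma jt1_zero : jt1 τ 0 = 0 := by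
  have := jt1_neg τ 0
  rw [neg_zero] at this
  exact self_eq_neg.mp this

lemma jt3_add_half_tau : jt3 τ (z + τ / 2) = exp (-(π * I * (τ / 4 + z))) * jt2 τ z := by
  rw [jt2, ← mul_assoc, ← exp_add, neg_add_cancel, Complex.exp_zero, one_mul]

lemma jt2_add_half_tau : jt2 τ (z + τ / 2) = exp (-(π * I * (τ / 4 + z))) * jt3 τ z := by
  rw [jt2, show z + τ / 2 + τ / 2 = z + τ by ring, jt3_add_tau, ← mul_assoc, ← exp_add]
  congr 2; ring

lemma jt4_add_half_tau : jt4 τ (z + τ / 2) = I * exp (-(π * I * (τ / 4 + z))) * jt1 τ z := by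
  rw [jt4, show z + τ / 2 + 1 / 2 = z + 1 / 2 + τ / 2 by ring, jt3_add_half_tau, jt2_add_half,
    show -(π * I * (τ / 4 + (z + 1 / 2))) = -(π * I * (τ / 4 + z)) + π * I * (-1 / 2) by ring,
    exp_add, exp_pi_I_neg_half]
  ring

lemma jt1_add_half_tau : jt1 τ (z + τ / 2) = I * exp (-(π * I * (τ / 4 + z))) * jt4 τ z := by
  rw [jt1, show z + τ / 2 - 1 / 2 = z - 1 / 2 + τ / 2 by ring, jt2_add_half_tau, jt3_sub_half,
    show -(π * I * (τ / 4 + (z - 1 / 2))) = -(π * I * (τ / 4 + z)) + π * I * (1 / 2) by ring,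
    exp_add, exp_pi_I_half]
  ring

lemma exp_half_tau_sq :
    exp (-(π * I * (τ / 4 + (z + τ / 2)))) * exp (-(π * I * (τ / 4 + z))) =
      exp (-π * I * (τ + 2 * z)) := by
  rw [← exp_add]; congr 1; ring

lemma jt2_add_tau : jt2 τ (z + τ) = exp (-π * I * (τ + 2 * z)) * jt2 τ z := by
  rw [show z + τ = z + τ / 2 + τ / 2 by ring, jt2_add_half_tau, jt3_add_half_tau, ← mul_assoc,
    exp_half_tau_sq]

lemma jt4_add_tau : jt4 τ (z + τ) = -exp (-π * I * (τ + 2 * z)) * jt4 τ z := by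
  rw [show z + τ = z + τ / 2 + τ / 2 by ring, jt4_add_half_tau, jt1_add_half_tau,
    ← exp_half_tau_sq]
  linear_combination (exp (-(π * I * (τ / 4 + (z + τ / 2)))) * exp (-(π * I * (τ / 4 + z))) *
    jt4 τ z) * Complex.I_mul_I

lemma jt1_add_tau : jt1 τ (z + τ) = -exp (-π * I * (τ + 2 * z)) * jt1 τ z := by
  rw [show z + τ = z + τ / 2 + τ / 2 by ring, jt1_add_half_tau, jt4_add_half_tau,
    ← exp_half_tau_sq]
  linear_combination (exp (-(π * I * (τ / 4 + (z + τ / 2)))) * exp (-(π * I * (τ / 4 + z))) *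
    jt1 τ z) * Complex.I_mul_I

variable {τ}

lemma jt3_conj (hτ : conj τ = -τ) : conj (jt3 τ z) = jt3 τ (conj z) := by
  rw [jt3, jacobiTheta₂_conj, hτ, neg_neg, jt3]

lemma jt4_conj (hτ : conj τ = -τ) : conj (jt4 τ z) = jt4 τ (conj z) := by
  rw [jt4, jt3_conj _ hτ, jt4]; congr 1; simp [map_ofNat]

lemma jt2_conj (hτ : conj τ = -τ) : conj (jt2 τ z) = jt2 τ (conj z) := by
  have h := jt3_add_half_tau τ (-conj z)
  rw [jt2_neg] at h
  rw [jt2, map_mul, jt3_conj _ hτ, map_add, map_div₀, hτ, Complex.conj_ofNat,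
    ← jt3_neg, show -(conj z + -τ / 2) = -conj z + τ / 2 by ring, h, ← mul_assoc,
    ← Complex.exp_conj, ← exp_add]
  simp only [map_mul, map_add, map_div₀, hτ, Complex.conj_ofReal, Complex.conj_I,
    Complex.conj_ofNat]
  rw [show π * -I * (-τ / 4 + conj z) + -(π * I * (τ / 4 + -conj z)) = 0 by ring,
    Complex.exp_zero, one_mul]

lemma jt1_conj (hτ : conj τ = -τ) : conj (jt1 τ z) = jt1 τ (conj z) := by
  rw [jt1, jt2_conj _ hτ, jt1]; congr 1; simp [map_ofNat]

end Theta

/-! ### Addition theorems -/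

/-- Pairs of integers `(m, n)` split by the parity of `m + n`: they are `(a + b, a - b)` or
`(a + b + 1, a - b)`. -/
def parityEquiv : (ℤ × ℤ) ⊕ (ℤ × ℤ) ≃ ℤ × ℤ where
  toFun := Sum.elim (fun p => (p.1 + p.2, p.1 - p.2)) (fun p => (p.1 + p.2 + 1, p.1 - p.2))
  invFun q := if (q.1 + q.2) % 2 = 0 then .inl ((q.1 + q.2) / 2, (q.1 - q.2) / 2)
    else .inr ((q.1 + q.2 - 1) / 2, (q.1 - q.2 - 1) / 2)
  left_inv := by
    rintro (⟨a, b⟩ | ⟨a, b⟩)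
    · have h : (a + b + (a - b)) % 2 = 0 := by omega
      simp only [Sum.elim_inl, h, if_true, Sum.inl.injEq, Prod.mk.injEq]
      omega
    · have h : ¬ (a + b + 1 + (a - b)) % 2 = 0 := by omega
      simp only [Sum.elim_inr, h, if_false, Sum.inr.injEq, Prod.mk.injEq]
      omega
  right_inv := by
    rintro ⟨m, n⟩
    by_cases h : (m + n) % 2 = 0
    · simp only [h, if_true, Sum.elim_inl, Prod.mk.injEq]
      omega
    · simp only [h, if_false, Sum.elim_inr, Prod.mk.injEq]
      omega

lemma hasSum_jt3 {τ : ℂ} (hτ : 0 < τ.im) (z : ℂ) :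
    HasSum (fun n => jacobiTheta₂_term n z τ) (jt3 τ z) :=
  hasSum_jacobiTheta₂_term z hτ

lemma hasSum_int_mul {f g : ℤ → ℂ} {a b : ℂ} (hf : HasSum f a) (hg : HasSum g b) :
    HasSum (fun p : ℤ × ℤ => f p.1 * g p.2) (a * b) :=
  hf.mul hg (summable_mul_of_summable_norm hf.summable.norm hg.summable.norm)

lemma hasSum_jt3_mul {τ : ℂ} (hτ : 0 < τ.im) (u v : ℂ) :
    HasSum (fun p : ℤ × ℤ => jacobiTheta₂_term p.1 u τ * jacobiTheta₂_term p.2 v τ)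
      (jt3 τ u * jt3 τ v) :=
  hasSum_int_mul (f := fun n => jacobiTheta₂_term n u τ) (g := fun n => jacobiTheta₂_term n v τ)
    (hasSum_jt3 hτ u) (hasSum_jt3 hτ v)

/-- The product `ϑ₃(x+y|τ) ϑ₃(x-y|τ)` in terms of theta functions of period ratio `2τ`, from
which the addition theorems follow. -/
lemma jt3_mul_jt3 {τ : ℂ} (hτ : 0 < τ.im) (x y : ℂ) : jt3 τ (x + y) * jt3 τ (x - y) =
    jt3 (2 * τ) (2 * x) * jt3 (2 * τ) (2 * y) + jt2 (2 * τ) (2 * x) * jt2 (2 * τ) (2 * y) := by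
  have hτ2 : 0 < (2 * τ).im := by simpa using hτ
  have h := (parityEquiv.hasSum_iff).mpr (hasSum_jt3_mul hτ (x + y) (x - y))
  refine h.unique (HasSum.sum ?_ ?_)
  · refine Eq.mpr (congrArg (HasSum · _) (funext ?_)) (hasSum_jt3_mul hτ2 (2 * x) (2 * y))
    rintro ⟨a, b⟩
    simp only [parityEquiv, Equiv.coe_fn_mk, Function.comp, Sum.elim_inl, jacobiTheta₂_term,
      ← exp_add]
    congr 1; push_cast; ring
  · have h2 := (hasSum_jt3_mul hτ2 (2 * x + 2 * τ / 2) (2 * y + 2 * τ / 2)).mul_left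
      (exp (π * I * (2 * τ / 4 + 2 * x)) * exp (π * I * (2 * τ / 4 + 2 * y)))
    rw [show jt2 (2 * τ) (2 * x) * jt2 (2 * τ) (2 * y) =
      exp (π * I * (2 * τ / 4 + 2 * x)) * exp (π * I * (2 * τ / 4 + 2 * y)) *
        (jt3 (2 * τ) (2 * x + 2 * τ / 2) * jt3 (2 * τ) (2 * y + 2 * τ / 2)) by
      simp only [jt2]; ring]
    refine Eq.mpr (congrArg (HasSum · _) (funext ?_)) h2
    rintro ⟨a, b⟩
    simp only [parityEquiv, Equiv.coe_fn_mk, Function.comp, Sum.elim_inr, jacobiTheta₂_term,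
      ← exp_add]
    congr 1; push_cast; ring

section Addition

variable {τ : ℂ}

lemma jt4_mul_jt4 (hτ : 0 < τ.im) (x y : ℂ) : jt4 τ (x + y) * jt4 τ (x - y) =
    jt3 (2 * τ) (2 * x) * jt3 (2 * τ) (2 * y) - jt2 (2 * τ) (2 * x) * jt2 (2 * τ) (2 * y) := by
  have h := jt3_mul_jt3 hτ (x + 1 / 2) y
  rw [show x + 1 / 2 + y = x + y + 1 / 2 by ring, show x + 1 / 2 - y = x - y + 1 / 2 by ring,
    show 2 * (x + 1 / 2) = 2 * x + 1 by ring, jt3_add_one, jt2_add_one] at h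
  simp only [jt4]
  linear_combination h

lemma jt2_mul_jt2 (hτ : 0 < τ.im) (x y : ℂ) : jt2 τ (x + y) * jt2 τ (x - y) =
    jt2 (2 * τ) (2 * x) * jt3 (2 * τ) (2 * y) + jt3 (2 * τ) (2 * x) * jt2 (2 * τ) (2 * y) := by
  have h := jt3_mul_jt3 hτ (x + τ / 2) y
  rw [show x + τ / 2 + y = x + y + τ / 2 by ring, show x + τ / 2 - y = x - y + τ / 2 by ring,
    show 2 * (x + τ / 2) = 2 * x + 2 * τ / 2 by ring, jt3_add_half_tau, jt3_add_half_tau,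
    jt3_add_half_tau, jt2_add_half_tau] at h
  have e : exp (-(π * I * (τ / 4 + (x + y)))) * exp (-(π * I * (τ / 4 + (x - y)))) =
      exp (-(π * I * (2 * τ / 4 + 2 * x))) := by
    rw [← exp_add]; congr 1; ring
  refine mul_left_cancel₀ (Complex.exp_ne_zero (-(π * I * (2 * τ / 4 + 2 * x)))) ?_
  linear_combination h - jt2 τ (x + y) * jt2 τ (x - y) * e

lemma jt1_mul_jt1 (hτ : 0 < τ.im) (x y : ℂ) : jt1 τ (x + y) * jt1 τ (x - y) =
    jt3 (2 * τ) (2 * x) * jt2 (2 * τ) (2 * y) - jt2 (2 * τ) (2 * x) * jt3 (2 * τ) (2 * y) := by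
  have h := jt2_mul_jt2 hτ (x - 1 / 2) y
  have e2 := jt2_add_one (2 * τ) (2 * (x - 1 / 2))
  have e3 := jt3_add_one (2 * τ) (2 * (x - 1 / 2))
  rw [show 2 * (x - 1 / 2) + 1 = 2 * x by ring] at e2 e3
  rw [jt1, jt1, show x + y - 1 / 2 = x - 1 / 2 + y by ring,
    show x - y - 1 / 2 = x - 1 / 2 - y by ring, h, e2, e3]
  ring

lemma jt1_mul_jt2 (hτ : 0 < τ.im) (x y : ℂ) : jt1 τ (x + y) * jt2 τ (x - y) =
    jt2 (2 * τ) (2 * x - 1 / 2) * jt3 (2 * τ) (2 * y - 1 / 2) +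
      jt3 (2 * τ) (2 * x - 1 / 2) * jt2 (2 * τ) (2 * y - 1 / 2) := by
  have h := jt2_mul_jt2 hτ (x - 1 / 4) (y - 1 / 4)
  rw [jt1, show 2 * x - 1 / 2 = 2 * (x - 1 / 4) by ring,
    show 2 * y - 1 / 2 = 2 * (y - 1 / 4) by ring, ← h]
  congr 2 <;> ring

lemma jt3_mul_jt4 (hτ : 0 < τ.im) (x y : ℂ) : jt3 τ (x + y) * jt4 τ (x - y) =
    jt3 (2 * τ) (2 * x - 1 / 2) * jt3 (2 * τ) (2 * y - 1 / 2) -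
      jt2 (2 * τ) (2 * x - 1 / 2) * jt2 (2 * τ) (2 * y - 1 / 2) := by
  have h := jt3_mul_jt3 hτ (x + 1 / 4) (y - 1 / 4)
  rw [show x + 1 / 4 + (y - 1 / 4) = x + y by ring,
    show x + 1 / 4 - (y - 1 / 4) = x - y + 1 / 2 by ring,
    show 2 * (x + 1 / 4) = 2 * x - 1 / 2 + 1 by ring,
    show 2 * (y - 1 / 4) = 2 * y - 1 / 2 by ring, jt3_add_one, jt2_add_one] at h
  rw [jt4, h]
  ring

/-- `ϑ₁(x+y) ϑ₂(x-y) ϑ₃ ϑ₄ = ϑ₁(x) ϑ₂(x) ϑ₃(y) ϑ₄(y) + ϑ₃(x) ϑ₄(x) ϑ₁(y) ϑ₂(y)`. -/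
lemma jt1_jt2_addition (hτ : 0 < τ.im) (x y : ℂ) :
    jt1 τ (x + y) * jt2 τ (x - y) * (jt3 τ 0 * jt4 τ 0) =
      jt1 τ x * jt2 τ x * (jt3 τ y * jt4 τ y) + jt3 τ x * jt4 τ x * (jt1 τ y * jt2 τ y) := by
  have h12 := jt1_mul_jt2 hτ x y
  have h12x := jt1_mul_jt2 hτ x 0
  have h12y := jt1_mul_jt2 hτ y 0
  have h34 := jt3_mul_jt4 hτ 0 0
  have h34x := jt3_mul_jt4 hτ x 0
  have h34y := jt3_mul_jt4 hτ y 0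
  have h0 : jt2 (2 * τ) (2 * 0 - 1 / 2) = 0 := by
    rw [show (2 * 0 - 1 / 2 : ℂ) = 0 - 1 / 2 by ring, ← jt1, jt1_zero]
  simp only [add_zero, sub_zero, h0] at h12x h12y h34 h34x h34y
  rw [h12, h12x, h12y, h34, h34x, h34y]
  ring

/-- `ϑ₄(x+y) ϑ₄(x-y) ϑ₄² = ϑ₄(x)² ϑ₄(y)² - ϑ₁(x)² ϑ₁(y)²`. -/
lemma jt4_addition (hτ : 0 < τ.im) (x y : ℂ) :
    jt4 τ (x + y) * jt4 τ (x - y) * jt4 τ 0 ^ 2 =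
      jt4 τ x ^ 2 * jt4 τ y ^ 2 - jt1 τ x ^ 2 * jt1 τ y ^ 2 := by
  have h := jt4_mul_jt4 hτ x y
  have h0 := jt4_mul_jt4 hτ 0 0
  have hx := jt4_mul_jt4 hτ x 0
  have hy := jt4_mul_jt4 hτ y 0
  have kx := jt1_mul_jt1 hτ x 0
  have ky := jt1_mul_jt1 hτ y 0
  simp only [add_zero, sub_zero, mul_zero] at h h0 hx hy kx ky
  simp only [sq]
  rw [h, h0, hx, hy, kx, ky]
  ring

lemma jt2_sq_mul (hτ : 0 < τ.im) (x : ℂ) :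
    jt2 τ x ^ 2 * jt4 τ 0 ^ 2 + jt1 τ x ^ 2 * jt3 τ 0 ^ 2 = jt4 τ x ^ 2 * jt2 τ 0 ^ 2 := by
  have h1 := jt1_mul_jt1 hτ x 0
  have h2 := jt2_mul_jt2 hτ x 0
  have h4 := jt4_mul_jt4 hτ x 0
  have k2 := jt2_mul_jt2 hτ 0 0
  have k3 := jt3_mul_jt3 hτ 0 0
  have k4 := jt4_mul_jt4 hτ 0 0
  simp only [add_zero, sub_zero, mul_zero] at h1 h2 h4 k2 k3 k4
  simp only [sq]
  rw [h1, h2, h4, k2, k3, k4]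
  ring

lemma jt3_sq_mul (hτ : 0 < τ.im) (x : ℂ) :
    jt3 τ x ^ 2 * jt4 τ 0 ^ 2 + jt1 τ x ^ 2 * jt2 τ 0 ^ 2 = jt4 τ x ^ 2 * jt3 τ 0 ^ 2 := by
  have h1 := jt1_mul_jt1 hτ x 0
  have h2 := jt3_mul_jt3 hτ x 0
  have h4 := jt4_mul_jt4 hτ x 0
  have k2 := jt2_mul_jt2 hτ 0 0
  have k3 := jt3_mul_jt3 hτ 0 0
  have k4 := jt4_mul_jt4 hτ 0 0
  simp only [add_zero, sub_zero, mul_zero] at h1 h2 h4 k2 k3 k4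
  simp only [sq]
  rw [h1, h2, h4, k2, k3, k4]
  ring

/-- Jacobi's identity `ϑ₂⁴ + ϑ₄⁴ = ϑ₃⁴`. -/
lemma jt_zero_pow_four (hτ : 0 < τ.im) : jt2 τ 0 ^ 4 + jt4 τ 0 ^ 4 = jt3 τ 0 ^ 4 := by
  have k2 := jt2_mul_jt2 hτ 0 0
  have k3 := jt3_mul_jt3 hτ 0 0
  have k4 := jt4_mul_jt4 hτ 0 0
  simp only [add_zero, sub_zero, mul_zero] at k2 k3 k4
  rw [show jt2 τ 0 ^ 4 = (jt2 τ 0 * jt2 τ 0) ^ 2 by ring,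
    show jt3 τ 0 ^ 4 = (jt3 τ 0 * jt3 τ 0) ^ 2 by ring,
    show jt4 τ 0 ^ 4 = (jt4 τ 0 * jt4 τ 0) ^ 2 by ring, k2, k3, k4]
  ring

/-- The function `exp (π i (τ/8 + x)) ϑ₃(2x + τ/2 | 2τ)`. Together with its reflection it splits
the products `ϑ₂(x+y) ϑ₃(x-y)` and `ϑ₁(x+y) ϑ₄(x-y)`, for which `ϑ(2x | 2τ)` does not suffice. -/
noncomputable def jtQuarter (τ x : ℂ) : ℂ :=
  exp (π * I * (τ / 8 + x)) * jt3 (2 * τ) (2 * x + τ / 2)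

lemma jtQuarter_add_half (τ x : ℂ) : jtQuarter τ (x + 1 / 2) = I * jtQuarter τ x := by
  rw [jtQuarter, jtQuarter, show 2 * (x + 1 / 2) + τ / 2 = 2 * x + τ / 2 + 1 by ring, jt3_add_one,
    show (π : ℂ) * I * (τ / 8 + (x + 1 / 2)) = π * I * (1 / 2) + π * I * (τ / 8 + x) by ring,
    exp_add, exp_pi_I_half]
  ring

lemma jt2_mul_jt3 (hτ : 0 < τ.im) (x y : ℂ) : jt2 τ (x + y) * jt3 τ (x - y) =
    jtQuarter τ x * jtQuarter τ y + jtQuarter τ (-x) * jtQuarter τ (-y) := by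
  have h := jt3_mul_jt3 hτ (x + τ / 4) (y + τ / 4)
  have key (w : ℂ) : jt2 (2 * τ) (2 * (w + τ / 4)) =
      exp (-(2 * π * I * w)) * jt3 (2 * τ) (2 * (-w) + τ / 2) := by
    rw [← jt2_neg, show -(2 * (w + τ / 4)) = (2 * -w + τ / 2) - 2 * τ / 2 by ring]
    have := jt3_add_half_tau (2 * τ) (2 * -w + τ / 2 - 2 * τ / 2)
    rw [sub_add_cancel] at this
    rw [this, ← mul_assoc, ← exp_add]
    rw [show -(2 * π * I * w) + -(π * I * (2 * τ / 4 + (2 * -w + τ / 2 - 2 * τ / 2))) = 0 by ring,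
      Complex.exp_zero, one_mul]
  rw [key, key, show x + τ / 4 + (y + τ / 4) = x + y + τ / 2 by ring,
    show x + τ / 4 - (y + τ / 4) = x - y by ring, jt3_add_half_tau] at h
  simp only [jtQuarter]
  rw [show 2 * (x + τ / 4) = 2 * x + τ / 2 by ring,
    show 2 * (y + τ / 4) = 2 * y + τ / 2 by ring] at h
  have e1 : exp (π * I * (τ / 8 + x)) * exp (π * I * (τ / 8 + y)) =
      exp (π * I * (τ / 4 + (x + y))) := by
    rw [← exp_add]; congr 1; ring
  have e2 : exp (π * I * (τ / 8 + -x)) * exp (π * I * (τ / 8 + -y)) =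
      exp (π * I * (τ / 4 + (x + y))) * (exp (-(2 * π * I * x)) * exp (-(2 * π * I * y))) := by
    rw [← exp_add, ← exp_add, ← exp_add]; congr 1; ring
  have e3 : exp (π * I * (τ / 4 + (x + y))) * exp (-(π * I * (τ / 4 + (x + y)))) = 1 := by
    rw [← exp_add, add_neg_cancel, Complex.exp_zero]
  linear_combination exp (π * I * (τ / 4 + (x + y))) * h -
    jt3 (2 * τ) (2 * x + τ / 2) * jt3 (2 * τ) (2 * y + τ / 2) * e1 -
    jt3 (2 * τ) (2 * -x + τ / 2) * jt3 (2 * τ) (2 * -y + τ / 2) * e2 -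
    jt2 τ (x + y) * jt3 τ (x - y) * e3

lemma jt1_mul_jt4 (hτ : 0 < τ.im) (x y : ℂ) : jt1 τ (x + y) * jt4 τ (x - y) =
    -I * (jtQuarter τ x * jtQuarter τ y - jtQuarter τ (-x) * jtQuarter τ (-y)) := by
  have h := jt2_mul_jt3 hτ x (y - 1 / 2)
  have e1 := jtQuarter_add_half τ (y - 1 / 2)
  have e2 := jtQuarter_add_half τ (-y)
  rw [sub_add_cancel] at e1
  rw [show -(y - 1 / 2) = -y + 1 / 2 by ring, e2,
    show x + (y - 1 / 2) = x + y - 1 / 2 by ring,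
    show x - (y - 1 / 2) = x - y + 1 / 2 by ring] at h
  rw [jt1, jt4, h, e1]
  linear_combination (jtQuarter τ x * jtQuarter τ (y - 1 / 2)) * Complex.I_mul_I

lemma jt1_mul_jt3 (hτ : 0 < τ.im) (x y : ℂ) : jt1 τ (x + y) * jt3 τ (x - y) =
    jtQuarter τ (x - 1 / 4) * jtQuarter τ (y - 1 / 4) +
      jtQuarter τ (1 / 4 - x) * jtQuarter τ (1 / 4 - y) := by
  have h := jt2_mul_jt3 hτ (x - 1 / 4) (y - 1 / 4)
  rw [show x - 1 / 4 + (y - 1 / 4) = x + y - 1 / 2 by ring,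
    show x - 1 / 4 - (y - 1 / 4) = x - y by ring, neg_sub, neg_sub] at h
  exact h

lemma jt2_mul_jt4 (hτ : 0 < τ.im) (x y : ℂ) : jt2 τ (x + y) * jt4 τ (x - y) =
    I * (jtQuarter τ (x - 1 / 4) * jtQuarter τ (y - 1 / 4) -
      jtQuarter τ (1 / 4 - x) * jtQuarter τ (1 / 4 - y)) := by
  have h := jt2_mul_jt3 hτ (x + 1 / 4) (y - 1 / 4)
  have e1 := jtQuarter_add_half τ (x - 1 / 4)
  have e2 := jtQuarter_add_half τ (-(x + 1 / 4))
  rw [show x - 1 / 4 + 1 / 2 = x + 1 / 4 by ring] at e1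
  rw [show -(x + 1 / 4) + 1 / 2 = 1 / 4 - x by ring] at e2
  rw [show x + 1 / 4 + (y - 1 / 4) = x + y by ring,
    show x + 1 / 4 - (y - 1 / 4) = x - y + 1 / 2 by ring, neg_sub, e1] at h
  rw [jt4, h, e2]
  linear_combination (jtQuarter τ (-(x + 1 / 4)) * jtQuarter τ (1 / 4 - y)) * Complex.I_mul_I

/-- `ϑ₁(x+y) ϑ₃(x-y) ϑ₂ ϑ₄ = ϑ₁(x) ϑ₃(x) ϑ₂(y) ϑ₄(y) + ϑ₂(x) ϑ₄(x) ϑ₁(y) ϑ₃(y)`. -/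
lemma jt1_jt3_addition (hτ : 0 < τ.im) (x y : ℂ) :
    jt1 τ (x + y) * jt3 τ (x - y) * (jt2 τ 0 * jt4 τ 0) =
      jt1 τ x * jt3 τ x * (jt2 τ y * jt4 τ y) + jt2 τ x * jt4 τ x * (jt1 τ y * jt3 τ y) := by
  have h13 := jt1_mul_jt3 hτ x y
  have h13x := jt1_mul_jt3 hτ x 0
  have h13y := jt1_mul_jt3 hτ y 0
  have h24 := jt2_mul_jt4 hτ 0 0
  have h24x := jt2_mul_jt4 hτ x 0
  have h24y := jt2_mul_jt4 hτ y 0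
  have h0 := jtQuarter_add_half τ (0 - 1 / 4)
  rw [show (0 - 1 / 4 + 1 / 2 : ℂ) = 1 / 4 - 0 by norm_num] at h0
  simp only [add_zero, sub_zero] at h13x h13y h24 h24x h24y h0
  rw [h13, h13x, h13y, h24, h24x, h24y, h0]
  linear_combination (I * jtQuarter τ (0 - 1 / 4) ^ 2 * (jtQuarter τ (1 / 4 - x) *
    jtQuarter τ (1 / 4 - y) - jtQuarter τ (x - 1 / 4) * jtQuarter τ (y - 1 / 4))) *
    Complex.I_mul_I

/-- `ϑ₁(x+y) ϑ₄(x-y) ϑ₂ ϑ₃ = ϑ₁(x) ϑ₄(x) ϑ₂(y) ϑ₃(y) + ϑ₂(x) ϑ₃(x) ϑ₁(y) ϑ₄(y)`. -/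
lemma jt1_jt4_addition (hτ : 0 < τ.im) (x y : ℂ) :
    jt1 τ (x + y) * jt4 τ (x - y) * (jt2 τ 0 * jt3 τ 0) =
      jt1 τ x * jt4 τ x * (jt2 τ y * jt3 τ y) + jt2 τ x * jt3 τ x * (jt1 τ y * jt4 τ y) := by
  have h14 := jt1_mul_jt4 hτ x y
  have h14x := jt1_mul_jt4 hτ x 0
  have h14y := jt1_mul_jt4 hτ y 0
  have h23 := jt2_mul_jt3 hτ 0 0
  have h23x := jt2_mul_jt3 hτ x 0
  have h23y := jt2_mul_jt3 hτ y 0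
  simp only [add_zero, sub_zero, neg_zero] at h14x h14y h23 h23x h23y
  rw [h14, h14x, h14y, h23, h23x, h23y]
  ring

end Addition

/-! ### Zeros of the theta functions -/

/-- All terms of the series of `ϑ₃` but the one of index `0` are bounded by a geometric series. -/
lemma norm_jt3_sub_one_le {τ z : ℂ} {δ : ℝ} (hτ : 0 < τ.im) (hδ : δ < 1 / 2)
    (hz : |z.im| ≤ δ * τ.im) :
    ‖jt3 τ z - 1‖ ≤ 2 * (Real.exp (-(π * (1 - 2 * δ) * τ.im)) *
      (1 - Real.exp (-(π * (1 - 2 * δ) * τ.im)))⁻¹) := by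
  set x : ℝ := Real.exp (-(π * (1 - 2 * δ) * τ.im)) with hx
  have hx1 : x < 1 := by
    rw [hx, Real.exp_lt_one_iff, neg_lt_zero]
    have : 0 < 1 - 2 * δ := by linarith
    positivity
  have hx0 : 0 ≤ x := (Real.exp_pos _).le
  have h := (hasSum_jt3 hτ z).nat_add_neg
  rw [← hasSum_nat_add_iff' 1] at h
  have hterm : ∀ n : ℤ, 1 ≤ |n| → ‖jacobiTheta₂_term n z τ‖ ≤ Real.exp
      (-(π * (1 - 2 * δ) * τ.im) * |(n : ℝ)|) := by
    intro n hn
    have hn' : (1 : ℝ) ≤ |(n : ℝ)| := by exact_mod_cast hn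
    rw [norm_jacobiTheta₂_term, Real.exp_le_exp]
    have h1 : |(n : ℝ) * z.im| ≤ |(n : ℝ)| * (δ * τ.im) := by
      rw [abs_mul]; gcongr
    have h2 := neg_abs_le ((n : ℝ) * z.im)
    have h3 : |(n : ℝ)| * τ.im ≤ (n : ℝ) ^ 2 * τ.im := by
      rw [← sq_abs]
      exact mul_le_mul_of_nonneg_right (by nlinarith) hτ.le
    have := Real.pi_pos
    nlinarith
  have hg : HasSum (fun n : ℕ => 2 * (x * x ^ n)) (2 * (x * (1 - x)⁻¹)) :=
    ((hasSum_geometric_of_lt_one hx0 hx1).mul_left x).mul_left 2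
  have hb : ∀ n : ℕ, ‖jacobiTheta₂_term ((n + 1 : ℕ) : ℤ) z τ +
      jacobiTheta₂_term (-((n + 1 : ℕ) : ℤ)) z τ‖ ≤ 2 * (x * x ^ n) := by
    intro n
    have e : Real.exp (-(π * (1 - 2 * δ) * τ.im) * |(((n + 1 : ℕ) : ℤ) : ℝ)|) = x * x ^ n := by
      rw [← pow_succ', hx, ← Real.exp_nat_mul, Int.cast_natCast, Nat.abs_cast, mul_comm]
    have h1 := hterm ((n + 1 : ℕ) : ℤ) (by rw [abs_of_nonneg] <;> omega)
    have h2 := hterm (-((n + 1 : ℕ) : ℤ)) (by rw [abs_neg, abs_of_nonneg] <;> omega)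
    rw [Int.cast_neg, abs_neg] at h2
    rw [e] at h1 h2
    calc _ ≤ _ := norm_add_le _ _
      _ ≤ _ := by linarith
  have h0 : jacobiTheta₂_term 0 z τ = 1 := by simp [jacobiTheta₂_term]
  have hs := tsum_of_norm_bounded hg hb
  have hval : jt3 τ z + jacobiTheta₂_term 0 z τ - ∑ i ∈ Finset.range 1,
      (jacobiTheta₂_term (i : ℤ) z τ + jacobiTheta₂_term (-(i : ℤ)) z τ) = jt3 τ z - 1 := by
    simp [h0]
  rwa [h.tsum_eq, hval] at hs

/-- `ϑ₃(z|τ) ϑ₄(z|τ) = ϑ₄(2z|2τ) ϑ₄(0|2τ)` passes a zero of `ϑ₄` on from `τ` to `2τ`. -/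
lemma exists_jt4_zero_doubling {τ : ℂ} (hτ : 0 < τ.im) {δ : ℝ} (hδ : 0 ≤ δ)
    (h : ∃ z : ℂ, |z.im| ≤ δ * τ.im ∧ jt4 τ z = 0) :
    ∃ z : ℂ, |z.im| ≤ δ * (2 * τ).im ∧ jt4 (2 * τ) z = 0 := by
  obtain ⟨z, hz, h0⟩ := h
  have e := jt3_mul_jt4 hτ z 0
  have h20 : jt2 (2 * τ) (2 * 0 - 1 / 2) = 0 := by
    rw [show (2 * 0 - 1 / 2 : ℂ) = 0 - 1 / 2 by ring, ← jt1, jt1_zero]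
  have him : (2 * τ).im = 2 * τ.im := by simp
  rw [add_zero, sub_zero, h0, h20, mul_zero (jt3 _ _), mul_zero (jt2 _ _), sub_zero (_ * _),
    jt3_sub_half, jt3_sub_half] at e
  rcases mul_eq_zero.mp e.symm with h | h
  · refine ⟨2 * z, ?_, h⟩
    rw [him, show (2 * z).im = 2 * z.im by simp, abs_mul, abs_two]
    linarith
  · refine ⟨2 * 0, ?_, h⟩
    rw [him]; simp; positivity

/-- `ϑ₄` has no zero in the strip `|Im z| < Im τ / 2`: by `ϑ₃(z|τ) ϑ₄(z|τ) = ϑ₄(2z|2τ) ϑ₄(0|2τ)` a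
zero would propagate to `2ⁿ τ`, where `ϑ₄` tends to `1`. -/
lemma jt4_ne_zero {τ z : ℂ} (hτ : 0 < τ.im) (hz : |z.im| < τ.im / 2) : jt4 τ z ≠ 0 := by
  intro h0
  set δ : ℝ := |z.im| / τ.im with hδ
  have hδ0 : 0 ≤ δ := by positivity
  have hδ1 : δ < 1 / 2 := by rw [hδ, div_lt_iff₀ hτ]; linarith
  have hpow : ∀ n : ℕ, 0 < (2 ^ n * τ).im ∧
      ∃ z : ℂ, |z.im| ≤ δ * (2 ^ n * τ).im ∧ jt4 (2 ^ n * τ) z = 0 := by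
    intro n
    induction n with
    | zero =>
      simp only [pow_zero, one_mul]
      exact ⟨hτ, z, by rw [hδ, div_mul_cancel₀ _ hτ.ne'], h0⟩
    | succ n ih =>
      have := exists_jt4_zero_doubling ih.1 hδ0 ih.2
      rw [← mul_assoc, ← pow_succ'] at this
      refine ⟨?_, this⟩
      rw [pow_succ', mul_assoc]
      simpa using ih.1
  have him (n : ℕ) : (2 ^ n * τ).im = 2 ^ n * τ.im := by
    rw [show (2 ^ n * τ : ℂ) = ((2 ^ n : ℝ) : ℂ) * τ by push_cast; rfl, Complex.im_ofReal_mul]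
  have hlim : Filter.Tendsto (fun n : ℕ => Real.exp (-(π * (1 - 2 * δ) * (2 ^ n * τ.im))))
      Filter.atTop (nhds 0) := by
    refine Real.tendsto_exp_neg_atTop_nhds_zero.comp ?_
    have h1 : 0 < 1 - 2 * δ := by linarith
    exact ((tendsto_pow_atTop_atTop_of_one_lt one_lt_two).atTop_mul_const hτ).const_mul_atTop
      (by positivity)
  obtain ⟨n, hn⟩ := (hlim.eventually (gt_mem_nhds (show (0 : ℝ) < 1 / 4 by norm_num))).exists
  obtain ⟨hn0, w, hw, hw0⟩ := hpow n
  have hb := norm_jt3_sub_one_le (z := w + 1 / 2) hn0 hδ1 (by simpa using hw)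
  rw [jt3_add_half, hw0, zero_sub, norm_neg, norm_one, him n] at hb
  set x := Real.exp (-(π * (1 - 2 * δ) * (2 ^ n * τ.im)))
  have hx : 0 < 1 - x := by linarith
  rw [← div_eq_mul_inv, ← mul_div_assoc, le_div_iff₀ hx] at hb
  linarith

lemma jt3_ne_zero {τ z : ℂ} (hτ : 0 < τ.im) (hz : |z.im| < τ.im / 2) : jt3 τ z ≠ 0 := by
  rw [← jt4_add_half]
  exact jt4_ne_zero hτ (by simpa using hz)

lemma I_mul_im {s : ℝ} : (I * (s : ℂ)).im = s := by simp

/-- The square root factor in the modular transformation `τ ↦ -1/τ`. -/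
noncomputable def modFactor (s : ℝ) : ℂ := 1 / (s : ℂ) ^ (1 / 2 : ℂ)

lemma modFactor_ne_zero {s : ℝ} (hs : 0 < s) : modFactor s ≠ 0 := by
  have : (s : ℂ) ≠ 0 := by exact_mod_cast hs.ne'
  rw [modFactor, one_div]
  exact inv_ne_zero (by simp [Complex.cpow_eq_zero_iff, this])

lemma jt3_modular {s : ℝ} (hs : 0 < s) (z : ℂ) : jt3 (I * s) z =
    modFactor s * exp (-π * z ^ 2 / s) * jt3 (I * ((1 / s : ℝ) : ℂ)) (z / (I * s)) := by
  have : (s : ℂ) ≠ 0 := by exact_mod_cast hs.ne'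
  have h := jacobiTheta₂_functional_equation z (I * s)
  rw [show -I * (I * s) = (s : ℂ) by linear_combination (-(s : ℂ)) * Complex.I_mul_I,
    show -π * I * z ^ 2 / (I * s) = -π * z ^ 2 / s by field_simp,
    show -1 / (I * s) = I * ((1 / s : ℝ) : ℂ) by
      push_cast; field_simp; rw [Complex.I_sq]] at h
  exact h

lemma jt4_modular {s : ℝ} (hs : 0 < s) (z : ℂ) : jt4 (I * s) z =
    modFactor s * exp (-π * z ^ 2 / s) * jt2 (I * ((1 / s : ℝ) : ℂ)) (z / (I * s)) := by
  have hs' : (s : ℂ) ≠ 0 := by exact_mod_cast hs.ne'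
  have h := jt3_modular hs (z + 1 / 2)
  rw [show (z + 1 / 2) / (I * s) = z / (I * s) - I * ((1 / s : ℝ) : ℂ) / 2 by
    push_cast; field_simp; rw [Complex.I_sq]; ring] at h
  have h2 := jt3_add_half_tau (I * ((1 / s : ℝ) : ℂ)) (-(z / (I * s)))
  rw [jt2_neg, ← jt3_neg, show -(-(z / (I * s)) + I * ((1 / s : ℝ) : ℂ) / 2) =
    z / (I * s) - I * ((1 / s : ℝ) : ℂ) / 2 by ring] at h2
  have e : exp (-π * (z + 1 / 2) ^ 2 / s) *
      exp (-(π * I * (I * ((1 / s : ℝ) : ℂ) / 4 + -(z / (I * s))))) = exp (-π * z ^ 2 / s) := by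
    rw [← exp_add]
    congr 1
    push_cast
    field_simp
    rw [Complex.I_sq]
    ring
  rw [jt4, h, h2, ← e]
  ring

/-- `ϑ₄(z | i s)` has no zero in the strip `0 < Re z < 1`. -/
lemma jt4_ne_zero_of_re {s : ℝ} (hs : 0 < s) {z : ℂ} (h0 : 0 < z.re) (h1 : z.re < 1) :
    jt4 (I * s) z ≠ 0 := by
  have hs' : (s : ℂ) ≠ 0 := by exact_mod_cast hs.ne'
  rw [← jt3_sub_half, jt3_modular hs]
  refine mul_ne_zero (mul_ne_zero (modFactor_ne_zero hs) (Complex.exp_ne_zero _))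
    (jt3_ne_zero (by rw [I_mul_im]; positivity) ?_)
  have : ((z - 1 / 2) / (I * s)).im = -(z.re - 1 / 2) / s := by
    rw [show (z - 1 / 2) / (I * s) = ((1 / s : ℝ) : ℂ) * (-I * (z - 1 / 2)) by
      push_cast; field_simp; rw [Complex.I_sq]; ring, Complex.im_ofReal_mul]
    simp
    ring
  rw [this, I_mul_im, abs_div, abs_of_pos hs, abs_neg, div_div,
    div_lt_iff₀ hs, show 1 / (s * 2) * s = 1 / 2 by field_simp, abs_lt]
  constructor <;> linarith

/-- The zeros of `ϑ₄(z | i s)` lie in `ℤ + i s (ℤ + 1/2)`. -/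
lemma exists_of_jt4_eq_zero {s : ℝ} (hs : 0 < s) {z : ℂ} (h : jt4 (I * s) z = 0) :
    ∃ m n : ℤ, z.re = m ∧ z.im = (n + 1 / 2) * s := by
  have p1 : Function.Periodic (fun z => jt4 (I * s) z = 0) 1 := fun w => by
    simp only [jt4_add_one]
  have p2 : Function.Periodic (fun z => jt4 (I * s) z = 0) (I * s) := fun w => by
    simp only [jt4_add_tau, mul_eq_zero, neg_eq_zero, Complex.exp_ne_zero, false_or]
  have hre : z.re = ⌊z.re⌋ := by
    by_contra hne
    have h1 := (p1.sub_int_mul_eq (x := z) ⌊z.re⌋).mpr h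
    refine jt4_ne_zero_of_re hs ?_ ?_ h1
    · have := lt_of_le_of_ne (Int.floor_le z.re) (Ne.symm hne)
      rw [mul_one, Complex.sub_re, Complex.intCast_re]
      linarith
    · have := Int.lt_floor_add_one z.re
      rw [mul_one, Complex.sub_re, Complex.intCast_re]
      linarith
  set n := round (z.im / s)
  have h1 := (p2.sub_int_mul_eq (x := z) n).mpr h
  have him : (z - n * (I * s)).im = z.im - n * s := by simp
  have hr := abs_sub_round (z.im / s)
  have hd : z.im / s - n = (z.im - n * s) / s := by field_simp
  rw [hd, abs_div, abs_of_pos hs, div_le_iff₀ hs] at hr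
  have heq : |z.im - n * s| = s / 2 := by
    refine le_antisymm (by linarith) ?_
    by_contra hlt
    exact jt4_ne_zero (by rw [I_mul_im]; exact hs) (by rw [him, I_mul_im]; linarith) h1
  rcases (abs_eq (by positivity)).mp heq with h2 | h2
  · exact ⟨⌊z.re⌋, n, hre, by linarith⟩
  · exact ⟨⌊z.re⌋, n - 1, hre, by push_cast; linarith⟩

lemma exists_of_jt1_eq_zero {s : ℝ} (hs : 0 < s) {z : ℂ} (h : jt1 (I * s) z = 0) :
    ∃ m n : ℤ, z.re = m ∧ z.im = n * s := by
  have h4 := jt4_add_half_tau (I * s) z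
  rw [h, mul_zero] at h4
  obtain ⟨m, n, hm, hn⟩ := exists_of_jt4_eq_zero hs h4
  refine ⟨m, n, by simpa using hm, ?_⟩
  have : (z + I * s / 2).im = z.im + s / 2 := by simp
  linarith

lemma exists_of_jt2_eq_zero {s : ℝ} (hs : 0 < s) {z : ℂ} (h : jt2 (I * s) z = 0) :
    ∃ m n : ℤ, z.re = m + 1 / 2 ∧ z.im = n * s := by
  rw [← jt1_add_half] at h
  obtain ⟨m, n, hm, hn⟩ := exists_of_jt1_eq_zero hs h
  refine ⟨m - 1, n, ?_, by simpa using hn⟩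
  have : (z + 1 / 2).re = z.re + 1 / 2 := by simp
  push_cast; linarith

/-! ### Derivatives of theta quotients -/

lemma differentiable_jt3 {τ : ℂ} (hτ : 0 < τ.im) : Differentiable ℂ (jt3 τ) :=
  fun z => differentiableAt_jacobiTheta₂_fst z hτ

lemma differentiable_jt4 {τ : ℂ} (hτ : 0 < τ.im) : Differentiable ℂ (jt4 τ) :=
  (differentiable_jt3 hτ).comp (differentiable_id.add_const _)

lemma differentiable_jt2 {τ : ℂ} (hτ : 0 < τ.im) : Differentiable ℂ (jt2 τ) :=
  Differentiable.mul (by fun_prop) ((differentiable_jt3 hτ).comp (differentiable_id.add_const _))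

lemma differentiable_jt1 {τ : ℂ} (hτ : 0 < τ.im) : Differentiable ℂ (jt1 τ) :=
  (differentiable_jt2 hτ).comp (differentiable_id.sub_const _)

lemma deriv_zero_of_even {f : ℂ → ℂ} (hf : ∀ z, f (-z) = f z) : deriv f 0 = 0 := by
  have h : deriv (fun z => f (-z)) 0 = -deriv f (-0) := deriv_comp_neg f 0
  rw [show (fun z => f (-z)) = f from funext hf, neg_zero] at h
  exact self_eq_neg.mp h

/-- `ϑ₁'(0)`. -/
noncomputable def jt1Deriv (τ : ℂ) : ℂ := deriv (jt1 τ) 0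

/-- The Wronskian of `ϑ₁` and `ϑ₄`, from the addition theorem for `ϑ₁(x+y) ϑ₄(x-y)` at `y = 0`. -/
lemma jt1_jt4_wronskian {τ : ℂ} (hτ : 0 < τ.im) (x : ℂ) :
    (deriv (jt1 τ) x * jt4 τ x - jt1 τ x * deriv (jt4 τ) x) * (jt2 τ 0 * jt3 τ 0) =
      jt2 τ x * jt3 τ x * (jt1Deriv τ * jt4 τ 0) := by
  have d (f : ℂ → ℂ) (hf : Differentiable ℂ f) (z : ℂ) : HasDerivAt f (deriv f z) z :=
    (hf z).hasDerivAt
  have hp : HasDerivAt (fun y : ℂ => x + y) 1 0 := (hasDerivAt_id 0).const_add x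
  have hm : HasDerivAt (fun y : ℂ => x - y) (-1) 0 := (hasDerivAt_id 0).const_sub x
  have h1 : HasDerivAt (fun y => jt1 τ (x + y)) (deriv (jt1 τ) x * 1) 0 :=
    HasDerivAt.comp (h₂ := jt1 τ) 0 (by simpa using d _ (differentiable_jt1 hτ) x) hp
  have h4 : HasDerivAt (fun y => jt4 τ (x - y)) (deriv (jt4 τ) x * -1) 0 :=
    HasDerivAt.comp (h₂ := jt4 τ) 0 (by simpa using d _ (differentiable_jt4 hτ) x) hm
  have hL := (h1.mul h4).mul_const (jt2 τ 0 * jt3 τ 0)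
  have h23 : HasDerivAt (fun y => jt2 τ y * jt3 τ y) 0 0 := by
    have := d _ ((differentiable_jt2 hτ).mul (differentiable_jt3 hτ)) 0
    rwa [deriv_zero_of_even (fun z => by simp [jt2_neg, jt3_neg])] at this
  have h14 := (d _ (differentiable_jt1 hτ) 0).mul (d _ (differentiable_jt4 hτ) 0)
  have hR := (h23.const_mul (jt1 τ x * jt4 τ x)).add (h14.const_mul (jt2 τ x * jt3 τ x))
  have := hL.unique (hR.congr_of_eventuallyEq
    (Filter.Eventually.of_forall fun y => jt1_jt4_addition hτ x y))
  simp only [add_zero, sub_zero, jt1_zero] at this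
  rw [jt1Deriv]
  linear_combination this

/-- The second logarithmic derivative of `ϑ₄`, from the second derivative at `y = 0` of the
addition theorem for `ϑ₄(x+y) ϑ₄(x-y)`. -/
lemma jt4_second_deriv {τ : ℂ} (hτ : 0 < τ.im) (x : ℂ) :
    (deriv (deriv (jt4 τ)) x * jt4 τ x - deriv (jt4 τ) x ^ 2) * jt4 τ 0 ^ 2 =
      jt4 τ x ^ 2 * (jt4 τ 0 * deriv (deriv (jt4 τ)) 0) - jt1 τ x ^ 2 * jt1Deriv τ ^ 2 := by
  have D4 := differentiable_jt4 hτ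
  have D1 := differentiable_jt1 hτ
  have D4' : Differentiable ℂ (deriv (jt4 τ)) := fun z => (D4.analyticAt z).deriv.differentiableAt
  have D1' : Differentiable ℂ (deriv (jt1 τ)) := fun z => (D1.analyticAt z).deriv.differentiableAt
  have hp (y : ℂ) : HasDerivAt (fun y : ℂ => x + y) 1 y := (hasDerivAt_id y).const_add x
  have hm (y : ℂ) : HasDerivAt (fun y : ℂ => x - y) (-1) y := (hasDerivAt_id y).const_sub x
  have cp (f : ℂ → ℂ) (hf : Differentiable ℂ f) (y : ℂ) :
      HasDerivAt (fun y => f (x + y)) (deriv f (x + y) * 1) y :=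
    HasDerivAt.comp (h₂ := f) y (hf (x + y)).hasDerivAt (hp y)
  have cm (f : ℂ → ℂ) (hf : Differentiable ℂ f) (y : ℂ) :
      HasDerivAt (fun y => f (x - y)) (deriv f (x - y) * -1) y :=
    HasDerivAt.comp (h₂ := f) y (hf (x - y)).hasDerivAt (hm y)
  have first (y : ℂ) : (deriv (jt4 τ) (x + y) * jt4 τ (x - y) -
      jt4 τ (x + y) * deriv (jt4 τ) (x - y)) * jt4 τ 0 ^ 2 =
      jt4 τ x ^ 2 * (2 * (jt4 τ y * deriv (jt4 τ) y)) -
        jt1 τ x ^ 2 * (2 * (jt1 τ y * deriv (jt1 τ) y)) := by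
    have hL := ((cp _ D4 y).mul (cm _ D4 y)).mul_const (jt4 τ 0 ^ 2)
    have hR := (((D4 y).hasDerivAt.pow 2).const_mul (jt4 τ x ^ 2)).sub
      (((D1 y).hasDerivAt.pow 2).const_mul (jt1 τ x ^ 2))
    have := hL.unique (hR.congr_of_eventuallyEq
      (Filter.Eventually.of_forall fun y => jt4_addition hτ x y))
    linear_combination this
  have hL := (((cp _ D4' 0).mul (cm _ D4 0)).sub ((cp _ D4 0).mul (cm _ D4' 0))).mul_const
    (jt4 τ 0 ^ 2)
  have hR := ((((D4 0).hasDerivAt.mul (D4' 0).hasDerivAt).const_mul 2).const_mul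
    (jt4 τ x ^ 2)).sub ((((D1 0).hasDerivAt.mul (D1' 0).hasDerivAt).const_mul 2).const_mul
    (jt1 τ x ^ 2))
  have := hL.unique (hR.congr_of_eventuallyEq (Filter.Eventually.of_forall first))
  simp only [add_zero, sub_zero, jt1_zero, deriv_zero_of_even (jt4_neg τ)] at this
  rw [jt1Deriv]
  linear_combination this / 2

/-- The theta quotient `sn`, with argument in units of `2K`. -/
noncomputable def tsn (τ z : ℂ) : ℂ := jt3 τ 0 * jt1 τ z / (jt2 τ 0 * jt4 τ z)

/-- The theta quotient `cn`, with argument in units of `2K`. -/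
noncomputable def tcn (τ z : ℂ) : ℂ := jt4 τ 0 * jt2 τ z / (jt2 τ 0 * jt4 τ z)

/-- The theta quotient `dn`, with argument in units of `2K`. -/
noncomputable def tdn (τ z : ℂ) : ℂ := jt4 τ 0 * jt3 τ z / (jt3 τ 0 * jt4 τ z)

/-- The constant `2K` expressed by theta constants: `tsn' = halfPeriod * tcn * tdn`. -/
noncomputable def halfPeriod (τ : ℂ) : ℂ := jt1Deriv τ * jt3 τ 0 / (jt2 τ 0 * jt4 τ 0)

lemma jt4_zero_ne {τ : ℂ} (hτ : 0 < τ.im) : jt4 τ 0 ≠ 0 :=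
  jt4_ne_zero hτ (by simpa using hτ)

lemma jt3_zero_ne {τ : ℂ} (hτ : 0 < τ.im) : jt3 τ 0 ≠ 0 :=
  jt3_ne_zero hτ (by simpa using hτ)

lemma jt2_zero_ne {s : ℝ} (hs : 0 < s) : jt2 (I * s) 0 ≠ 0 := by
  intro h
  obtain ⟨m, n, hm, -⟩ := exists_of_jt2_eq_zero hs h
  rw [Complex.zero_re] at hm
  have : (2 * m + 1 : ℝ) = 0 := by linarith
  norm_cast at this
  omega

lemma tsn_sq_add_tcn_sq {τ z : ℂ} (hτ : 0 < τ.im) (h2 : jt2 τ 0 ≠ 0) (hz : jt4 τ z ≠ 0) :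
    tsn τ z ^ 2 + tcn τ z ^ 2 = 1 := by
  have h := jt2_sq_mul hτ z
  rw [tsn, tcn]
  field_simp
  linear_combination h

lemma tdn_sq_add_tsn_sq {τ z : ℂ} (hτ : 0 < τ.im) (h2 : jt2 τ 0 ≠ 0) (hz : jt4 τ z ≠ 0) :
    tdn τ z ^ 2 + ((jt2 τ 0 / jt3 τ 0) ^ 2) ^ 2 * tsn τ z ^ 2 = 1 := by
  have h := jt3_sq_mul hτ z
  have h3 := jt3_zero_ne hτ
  rw [tsn, tdn]
  field_simp
  linear_combination h

lemma hasDerivAt_tsn {τ z : ℂ} (hτ : 0 < τ.im) (h2 : jt2 τ 0 ≠ 0) (hz : jt4 τ z ≠ 0) :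
    HasDerivAt (tsn τ) (halfPeriod τ * (tcn τ z * tdn τ z)) z := by
  have h3 := jt3_zero_ne hτ
  have h4 := jt4_zero_ne hτ
  have h := ((differentiable_jt1 hτ z).hasDerivAt.const_mul (jt3 τ 0)).div
    ((differentiable_jt4 hτ z).hasDerivAt.const_mul (jt2 τ 0)) (mul_ne_zero h2 hz)
  refine h.congr_deriv ?_
  have w := jt1_jt4_wronskian hτ z
  rw [halfPeriod, tcn, tdn]
  field_simp
  linear_combination w

/-- The logarithmic derivative of `ϑ₄`. -/
noncomputable def jt4Log (τ z : ℂ) : ℂ := deriv (jt4 τ) z / jt4 τ z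

lemma hasDerivAt_jt4Log {τ z : ℂ} (hτ : 0 < τ.im) (h2 : jt2 τ 0 ≠ 0) (hz : jt4 τ z ≠ 0) :
    HasDerivAt (jt4Log τ) (halfPeriod τ ^ 2 * tdn τ z ^ 2 +
      (deriv (deriv (jt4 τ)) 0 / jt4 τ 0 - halfPeriod τ ^ 2)) z := by
  have h3 := jt3_zero_ne hτ
  have h4 := jt4_zero_ne hτ
  have D4 := differentiable_jt4 hτ
  have h := (D4.analyticAt z).deriv.differentiableAt.hasDerivAt.div (D4 z).hasDerivAt hz
  refine h.congr_deriv ?_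
  have e := tdn_sq_add_tsn_sq hτ h2 hz
  have w := jt4_second_deriv hτ z
  have : deriv (deriv (jt4 τ)) 0 / jt4 τ 0 + halfPeriod τ ^ 2 * (tdn τ z ^ 2 - 1) =
    deriv (deriv (jt4 τ)) 0 / jt4 τ 0 - jt1Deriv τ ^ 2 * jt1 τ z ^ 2 / (jt4 τ 0 ^ 2 * jt4 τ z ^ 2)
      := by
    rw [show tdn τ z ^ 2 - 1 = -(((jt2 τ 0 / jt3 τ 0) ^ 2) ^ 2 * tsn τ z ^ 2) by
      linear_combination e, tsn, halfPeriod]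
    field_simp
    ring
  rw [show halfPeriod τ ^ 2 * tdn τ z ^ 2 + (deriv (deriv (jt4 τ)) 0 / jt4 τ 0 - halfPeriod τ ^ 2)
    = deriv (deriv (jt4 τ)) 0 / jt4 τ 0 + halfPeriod τ ^ 2 * (tdn τ z ^ 2 - 1) by ring, this]
  field_simp
  linear_combination w

/-! ### Jacobi inversion -/

section Real

lemma conj_I_mul (s : ℝ) : conj (I * (s : ℂ)) = -(I * s) := by simp

lemma I_mul_im_pos {s : ℝ} (hs : 0 < s) : 0 < (I * (s : ℂ)).im := by rwa [I_mul_im]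

lemma ofReal_re_of_conj {w : ℂ} (h : conj w = w) : ((w.re : ℝ) : ℂ) = w :=
  Complex.conj_eq_iff_re.mp h

lemma jt_re_real (s : ℝ) (x : ℝ) :
    (((jt2 (I * s) x).re : ℝ) : ℂ) = jt2 (I * s) x ∧
    (((jt3 (I * s) x).re : ℝ) : ℂ) = jt3 (I * s) x ∧
    (((jt4 (I * s) x).re : ℝ) : ℂ) = jt4 (I * s) x := by
  refine ⟨ofReal_re_of_conj ?_, ofReal_re_of_conj ?_, ofReal_re_of_conj ?_⟩
  · rw [jt2_conj _ (conj_I_mul s), Complex.conj_ofReal]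
  · rw [jt3_conj _ (conj_I_mul s), Complex.conj_ofReal]
  · rw [jt4_conj _ (conj_I_mul s), Complex.conj_ofReal]

lemma pos_of_ne_zero_of_pos_zero {f : ℝ → ℝ} (hf : Continuous f) {x : ℝ} (h0 : 0 < f 0)
    (hne : ∀ y ∈ Set.uIcc 0 x, f y ≠ 0) : 0 < f x := by
  by_contra hx
  push Not at hx
  obtain ⟨y, hy, hy0⟩ := intermediate_value_uIcc (a := 0) (b := x) hf.continuousOn
    (show (0 : ℝ) ∈ Set.uIcc (f 0) (f x) from Set.mem_uIcc.mpr (Or.inr ⟨hx, h0.le⟩))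
  exact hne y hy hy0

variable {s : ℝ}

lemma jt3_ofReal_re_ne (hs : 0 < s) (x : ℝ) : (jt3 (I * s) x).re ≠ 0 := by
  intro h
  have h' := (jt_re_real s x).2.1
  rw [h, Complex.ofReal_zero] at h'
  exact jt3_ne_zero (z := x) (I_mul_im_pos hs) (by simpa using hs) h'.symm

lemma continuous_jt_re {f : ℂ → ℂ} (hf : Differentiable ℂ f) :
    Continuous (fun x : ℝ => (f x).re) :=
  Complex.continuous_re.comp (hf.continuous.comp Complex.continuous_ofReal)

/-- A theta series with positive terms is positive. -/
lemma jt3_imag_re_pos (hs : 0 < s) (y : ℝ) : 0 < (jt3 (I * s) (I * y)).re := by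
  have h := hasSum_jt3 (I_mul_im_pos hs) (I * y)
  have e (n : ℤ) : jacobiTheta₂_term n (I * y) (I * s) =
      ((Real.exp (-(2 * π * n * y) - π * n ^ 2 * s) : ℝ) : ℂ) := by
    rw [jacobiTheta₂_term, Complex.ofReal_exp]
    congr 1
    push_cast
    linear_combination (2 * π * n * y + π * n ^ 2 * s : ℂ) * Complex.I_sq
  have h2 := Complex.hasSum_re h
  simp only [e, Complex.ofReal_re] at h2
  rw [← h2.tsum_eq]
  exact h2.summable.tsum_pos (fun n => (Real.exp_pos _).le) 0 (Real.exp_pos _)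

lemma jt3_re_pos (hs : 0 < s) (x : ℝ) : 0 < (jt3 (I * s) x).re := by
  refine pos_of_ne_zero_of_pos_zero (f := fun x : ℝ => (jt3 (I * s) x).re)
    (continuous_jt_re (differentiable_jt3 (I_mul_im_pos hs))) ?_
    fun y _ => jt3_ofReal_re_ne hs y
  simpa using jt3_imag_re_pos hs 0

lemma jt4_re_pos (hs : 0 < s) (x : ℝ) : 0 < (jt4 (I * s) x).re := by
  have := jt3_re_pos hs (x + 1 / 2)
  rw [jt4]
  simpa using this

lemma jt2_re_pos (hs : 0 < s) {x : ℝ} (hx : |x| < 1 / 2) : 0 < (jt2 (I * s) x).re := by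
  refine pos_of_ne_zero_of_pos_zero (f := fun x : ℝ => (jt2 (I * s) x).re)
    (continuous_jt_re (differentiable_jt2 (I_mul_im_pos hs))) ?_ ?_
  · have h := jt3_imag_re_pos hs (s / 2)
    have e : jt2 (I * s) (0 : ℝ) = ((Real.exp (-(π * s / 4)) : ℝ) : ℂ) *
        jt3 (I * s) (I * ((s / 2 : ℝ) : ℂ)) := by
      rw [jt2, Complex.ofReal_exp]
      congr 2
      · push_cast; linear_combination (π * s / 4 : ℂ) * Complex.I_sq
      · push_cast; ring
    rw [e, Complex.re_ofReal_mul]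
    exact mul_pos (Real.exp_pos _) h
  · intro y hy h0
    have h' := (jt_re_real s y).1
    rw [h0, Complex.ofReal_zero] at h'
    obtain ⟨m, n, hm, -⟩ := exists_of_jt2_eq_zero hs h'.symm
    rw [Complex.ofReal_re] at hm
    have hy' : |y| < 1 / 2 := by
      refine lt_of_le_of_lt ?_ hx
      simpa using Set.abs_sub_left_of_mem_uIcc hy
    rw [hm, abs_lt] at hy'
    have h1 : (-1 : ℝ) < m := by linarith
    have h2 : (m : ℝ) < 0 := by linarith
    norm_cast at h1 h2
    omega

end Real

section Inversion

variable {s : ℝ}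

/-- The modulus `ϑ₂² / ϑ₃²` belonging to the period ratio `i s`. -/
noncomputable def thetaModulus (s : ℝ) : ℝ := ((jt2 (I * s) 0).re / (jt3 (I * s) 0).re) ^ 2

lemma jt_zero_re (s : ℝ) : (((jt2 (I * s) 0).re : ℝ) : ℂ) = jt2 (I * s) 0 ∧
    (((jt3 (I * s) 0).re : ℝ) : ℂ) = jt3 (I * s) 0 ∧
    (((jt4 (I * s) 0).re : ℝ) : ℂ) = jt4 (I * s) 0 := by
  simpa using jt_re_real s 0

lemma thetaModulus_ofReal (s : ℝ) :
    (thetaModulus s : ℂ) = (jt2 (I * s) 0 / jt3 (I * s) 0) ^ 2 := by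
  obtain ⟨h2, h3, -⟩ := jt_zero_re s
  rw [thetaModulus]
  push_cast
  rw [h2, h3]

lemma jt_zero_pos (hs : 0 < s) :
    0 < (jt2 (I * s) 0).re ∧ 0 < (jt3 (I * s) 0).re ∧ 0 < (jt4 (I * s) 0).re :=
  ⟨by simpa using jt2_re_pos hs (x := 0) (by simp), by simpa using jt3_re_pos hs 0,
    by simpa using jt4_re_pos hs 0⟩

lemma thetaModulus_pos (hs : 0 < s) : 0 < thetaModulus s :=
  pow_pos (div_pos (jt_zero_pos hs).1 (jt_zero_pos hs).2.1) 2

lemma thetaModulus_sq_add (hs : 0 < s) :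
    thetaModulus s ^ 2 + (((jt4 (I * s) 0).re / (jt3 (I * s) 0).re) ^ 2) ^ 2 = 1 := by
  obtain ⟨-, p3, -⟩ := jt_zero_pos hs
  obtain ⟨h2, h3, h4⟩ := jt_zero_re s
  have h := jt_zero_pow_four (I_mul_im_pos hs)
  rw [← h2, ← h3, ← h4] at h
  norm_cast at h
  rw [thetaModulus]
  field_simp
  linear_combination h

lemma compl_thetaModulus (hs : 0 < s) :
    compl (thetaModulus s) = ((jt4 (I * s) 0).re / (jt3 (I * s) 0).re) ^ 2 := by
  rw [compl, show 1 - thetaModulus s ^ 2 = (((jt4 (I * s) 0).re / (jt3 (I * s) 0).re) ^ 2) ^ 2 by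
    linear_combination -thetaModulus_sq_add hs, Real.sqrt_sq (by positivity)]

lemma thetaModulus_lt_one (hs : 0 < s) : thetaModulus s < 1 := by
  have h := thetaModulus_sq_add hs
  have h4 : 0 < (((jt4 (I * s) 0).re / (jt3 (I * s) 0).re) ^ 2) ^ 2 :=
    pow_pos (pow_pos (div_pos (jt_zero_pos hs).2.2 (jt_zero_pos hs).2.1) 2) 2
  have := thetaModulus_pos hs
  nlinarith

lemma tquot_conj (s : ℝ) (z : ℂ) : conj (tsn (I * s) z) = tsn (I * s) (conj z) ∧
    conj (tcn (I * s) z) = tcn (I * s) (conj z) ∧ conj (tdn (I * s) z) = tdn (I * s) (conj z) := by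
  have c1 := fun z => jt1_conj z (conj_I_mul s)
  have c2 := fun z => jt2_conj z (conj_I_mul s)
  have c3 := fun z => jt3_conj z (conj_I_mul s)
  have c4 := fun z => jt4_conj z (conj_I_mul s)
  refine ⟨?_, ?_, ?_⟩ <;>
  simp only [tsn, tcn, tdn, map_div₀, map_mul, c1, c2, c3, c4, map_zero]

lemma tquot_re (s x : ℝ) : (((tsn (I * s) x).re : ℝ) : ℂ) = tsn (I * s) x ∧
    (((tcn (I * s) x).re : ℝ) : ℂ) = tcn (I * s) x ∧
    (((tdn (I * s) x).re : ℝ) : ℂ) = tdn (I * s) x := by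
  obtain ⟨h1, h2, h3⟩ := tquot_conj s x
  rw [Complex.conj_ofReal] at h1 h2 h3
  exact ⟨ofReal_re_of_conj h1, ofReal_re_of_conj h2, ofReal_re_of_conj h3⟩

lemma tdn_re_pos (hs : 0 < s) (x : ℝ) : 0 < (tdn (I * s) x).re := by
  obtain ⟨-, h3, h4⟩ := jt_zero_re s
  obtain ⟨-, k3, k4⟩ := jt_re_real s x
  rw [tdn, ← h3, ← h4, ← k3, ← k4]
  norm_cast
  exact div_pos (mul_pos (jt_zero_pos hs).2.2 (jt3_re_pos hs x))
    (mul_pos (jt_zero_pos hs).2.1 (jt4_re_pos hs x))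

lemma tcn_re_pos (hs : 0 < s) {x : ℝ} (hx : |x| < 1 / 2) : 0 < (tcn (I * s) x).re := by
  obtain ⟨h2, -, h4⟩ := jt_zero_re s
  obtain ⟨k2, -, k4⟩ := jt_re_real s x
  rw [tcn, ← h2, ← h4, ← k2, ← k4]
  norm_cast
  exact div_pos (mul_pos (jt_zero_pos hs).2.2 (jt2_re_pos hs hx))
    (mul_pos (jt_zero_pos hs).1 (jt4_re_pos hs x))

lemma jt4_ofReal_ne (hs : 0 < s) (x : ℝ) : jt4 (I * s) x ≠ 0 :=
  jt4_ne_zero (I_mul_im_pos hs) (by simpa using hs)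

lemma jt1Deriv_conj (s : ℝ) : conj (jt1Deriv (I * s)) = jt1Deriv (I * s) := by
  have h := congrFun (deriv_conj_conj (f := jt1 (I * s))) 0
  have e : (conj ∘ jt1 (I * s) ∘ conj) = jt1 (I * s) := by
    funext z
    simp only [Function.comp, jt1_conj _ (conj_I_mul s), Complex.conj_conj]
  rw [e] at h
  simpa [jt1Deriv] using h.symm

lemma halfPeriod_re (s : ℝ) : (((halfPeriod (I * s)).re : ℝ) : ℂ) = halfPeriod (I * s) := by
  apply ofReal_re_of_conj
  simp only [halfPeriod, map_div₀, map_mul, jt1Deriv_conj, jt2_conj _ (conj_I_mul s),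
    jt3_conj _ (conj_I_mul s), jt4_conj _ (conj_I_mul s), map_zero]

lemma hasDerivAt_tsn_re (hs : 0 < s) (x : ℝ) :
    HasDerivAt (fun x : ℝ => (tsn (I * s) x).re)
      ((halfPeriod (I * s)).re * ((tcn (I * s) x).re * (tdn (I * s) x).re)) x := by
  have h := (hasDerivAt_tsn (I_mul_im_pos hs) (jt2_zero_ne hs) (jt4_ofReal_ne hs x)).real_of_complex
  refine h.congr_deriv ?_
  rw [← halfPeriod_re, ← (tquot_re s x).2.1, ← (tquot_re s x).2.2]
  norm_cast

lemma tsn_re_sq (hs : 0 < s) (x : ℝ) :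
    (tsn (I * s) x).re ^ 2 + (tcn (I * s) x).re ^ 2 = 1 ∧
    (tdn (I * s) x).re ^ 2 + thetaModulus s ^ 2 * (tsn (I * s) x).re ^ 2 = 1 := by
  have h1 := tsn_sq_add_tcn_sq (I_mul_im_pos hs) (jt2_zero_ne hs) (jt4_ofReal_ne hs x)
  have h2 := tdn_sq_add_tsn_sq (I_mul_im_pos hs) (jt2_zero_ne hs) (jt4_ofReal_ne hs x)
  rw [← thetaModulus_ofReal] at h2
  obtain ⟨k1, k2, k3⟩ := tquot_re s x
  rw [← k1, ← k2] at h1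
  rw [← k1, ← k3] at h2
  exact ⟨by exact_mod_cast h1, by exact_mod_cast h2⟩

lemma tsn_half {s : ℝ} (hs : 0 < s) : tsn (I * s) (1 / 2) = 1 := by
  have h1 := jt1_add_half (I * s) 0
  have h4 := jt4_add_half (I * s) 0
  rw [zero_add] at h1 h4
  have := jt2_zero_ne hs
  have := jt3_zero_ne (I_mul_im_pos hs)
  rw [tsn, h1, h4]
  field_simp

lemma continuous_tdn_re (hs : 0 < s) : Continuous (fun x : ℝ => (tdn (I * s) x).re) := by
  have h3 := (differentiable_jt3 (I_mul_im_pos hs)).continuous.comp Complex.continuous_ofReal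
  have h4 := (differentiable_jt4 (I_mul_im_pos hs)).continuous.comp Complex.continuous_ofReal
  refine Complex.continuous_re.comp (Continuous.div (h3.const_mul _) (h4.const_mul _) fun x => ?_)
  exact mul_ne_zero (jt3_zero_ne (I_mul_im_pos hs)) (jt4_ofReal_ne hs x)

/-- The substitution `sin θ = sn`. -/
lemma integral_comp_sin_eq (hs : 0 < s) {g : ℝ → ℝ} (hg : Continuous g) :
    ∫ θ in (0 : ℝ)..(π / 2), g (Real.sin θ) = ∫ x in (0 : ℝ)..(1 / 2),
      g (tsn (I * s) x).re * ((halfPeriod (I * s)).re * (tdn (I * s) x).re) := by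
  have hc : Continuous (fun x : ℝ => (tsn (I * s) x).re) :=
    continuous_iff_continuousAt.mpr fun x => (hasDerivAt_tsn_re hs x).continuousAt
  have hbd (x : ℝ) : -1 ≤ (tsn (I * s) x).re ∧ (tsn (I * s) x).re ≤ 1 := by
    rw [← abs_le, ← sq_le_one_iff_abs_le_one]
    nlinarith [(tsn_re_sq hs x).1]
  have hd : ∀ x ∈ Set.Ioo (min (0 : ℝ) (1 / 2)) (max 0 (1 / 2)), HasDerivWithinAt
      (fun x : ℝ => Real.arcsin (tsn (I * s) x).re)
      ((halfPeriod (I * s)).re * (tdn (I * s) x).re) (Set.Ioi x) x := by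
    intro x hx
    rw [min_eq_left (by norm_num), max_eq_right (by norm_num)] at hx
    have hcn := tcn_re_pos hs (x := x) (by rw [abs_of_pos hx.1]; exact hx.2)
    have hsq := (tsn_re_sq hs x).1
    have hlt : (tsn (I * s) x).re ^ 2 < 1 := by nlinarith
    rw [sq_lt_one_iff_abs_lt_one, abs_lt] at hlt
    have h := (Real.hasDerivAt_arcsin hlt.1.ne' hlt.2.ne).comp x (hasDerivAt_tsn_re hs x)
    refine (h.congr_deriv ?_).hasDerivWithinAt
    rw [show 1 - (tsn (I * s) x).re ^ 2 = (tcn (I * s) x).re ^ 2 by linarith,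
      Real.sqrt_sq hcn.le]
    field_simp
  have h := intervalIntegral.integral_comp_mul_deriv'' (a := 0) (b := 1 / 2)
    (f := fun x : ℝ => Real.arcsin (tsn (I * s) x).re)
    (f' := fun x => (halfPeriod (I * s)).re * (tdn (I * s) x).re)
    (g := fun θ => g (Real.sin θ)) (Real.continuous_arcsin.comp hc).continuousOn hd
    ((continuous_tdn_re hs).const_mul _).continuousOn (hg.comp Real.continuous_sin).continuousOn
  have e0 : Real.arcsin (tsn (I * s) ((0 : ℝ) : ℂ)).re = 0 := by simp [tsn, jt1_zero]
  have e1 : Real.arcsin (tsn (I * s) ((1 / 2 : ℝ) : ℂ)).re = π / 2 := by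
    push_cast
    rw [tsn_half hs, Complex.one_re, Real.arcsin_one]
  simp only [e0, e1, Function.comp, Real.sin_arcsin (hbd _).1 (hbd _).2] at h
  exact h.symm

lemma sqrt_one_sub_tsn (hs : 0 < s) (x : ℝ) :
    Real.sqrt (1 - thetaModulus s ^ 2 * (tsn (I * s) x).re ^ 2) = (tdn (I * s) x).re := by
  rw [show 1 - thetaModulus s ^ 2 * (tsn (I * s) x).re ^ 2 = (tdn (I * s) x).re ^ 2 by
    linear_combination -(tsn_re_sq hs x).2, Real.sqrt_sq (tdn_re_pos hs x).le]

lemma ellipticE_thetaModulus (hs : 0 < s) : ellipticE (thetaModulus s) =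
    (halfPeriod (I * s)).re * ∫ x in (0 : ℝ)..(1 / 2), (tdn (I * s) x).re ^ 2 := by
  have h := integral_comp_sin_eq hs (g := fun y => Real.sqrt (1 - thetaModulus s ^ 2 * y ^ 2))
    (by fun_prop)
  rw [ellipticE, h, ← intervalIntegral.integral_const_mul]
  congr 1
  funext x
  rw [sqrt_one_sub_tsn hs]
  ring

lemma ellipticK_thetaModulus (hs : 0 < s) :
    ellipticK (thetaModulus s) = (halfPeriod (I * s)).re / 2 := by
  -- Outside `[-1, 1]`, where `sin` takes no value, the integrand is cut off to be continuous.
  set m := thetaModulus s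
  have hm0 : 0 < m := thetaModulus_pos hs
  have hm1 : m < 1 := thetaModulus_lt_one hs
  have hpos (y : ℝ) : 0 < 1 - m ^ 2 * min 1 (y ^ 2) := by
    have := min_le_left 1 (y ^ 2)
    nlinarith
  have h := integral_comp_sin_eq hs (g := fun y => 1 / Real.sqrt (1 - m ^ 2 * min 1 (y ^ 2)))
    (Continuous.div (by fun_prop) (by fun_prop) fun y => (Real.sqrt_pos.mpr (hpos y)).ne')
  have e1 (θ : ℝ) : min 1 (Real.sin θ ^ 2) = Real.sin θ ^ 2 := min_eq_right (Real.sin_sq_le_one θ)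
  have e2 (x : ℝ) : min 1 ((tsn (I * s) x).re ^ 2) = (tsn (I * s) x).re ^ 2 :=
    min_eq_right (by nlinarith [(tsn_re_sq hs x).1])
  simp only [e1, e2] at h
  rw [ellipticK, h]
  have : ∀ x : ℝ, 1 / Real.sqrt (1 - m ^ 2 * (tsn (I * s) x).re ^ 2) *
      ((halfPeriod (I * s)).re * (tdn (I * s) x).re) = (halfPeriod (I * s)).re := by
    intro x
    rw [sqrt_one_sub_tsn hs]
    have := (tdn_re_pos hs x).ne'
    field_simp
  simp only [this, intervalIntegral.integral_const, smul_eq_mul]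
  ring

lemma ellipticK_strictMono {a b : ℝ} (ha : 0 ≤ a) (hab : a < b) (hb : b < 1) :
    ellipticK a < ellipticK b := by
  have hpos (c : ℝ) (hc0 : 0 ≤ c) (hc : c < 1) (θ : ℝ) : 0 < 1 - c ^ 2 * Real.sin θ ^ 2 := by
    have := Real.sin_sq_le_one θ
    nlinarith [sq_nonneg (Real.sin θ)]
  have hcont (c : ℝ) (hc0 : 0 ≤ c) (hc : c < 1) :
      Continuous fun θ => 1 / Real.sqrt (1 - c ^ 2 * Real.sin θ ^ 2) :=
    Continuous.div (by fun_prop) (by fun_prop) fun θ => (Real.sqrt_pos.mpr (hpos c hc0 hc θ)).ne'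
  have hsq : a ^ 2 < b ^ 2 := by nlinarith
  refine intervalIntegral.integral_lt_integral_of_continuousOn_of_le_of_exists_lt
    (by positivity) (hcont a ha (hab.trans hb)).continuousOn
    (hcont b (ha.trans hab.le) hb).continuousOn (fun θ _ => ?_) ⟨π / 2, ⟨by positivity, le_rfl⟩, ?_⟩
  · refine one_div_le_one_div_of_le (Real.sqrt_pos.mpr (hpos b (ha.trans hab.le) hb θ))
      (Real.sqrt_le_sqrt ?_)
    nlinarith [sq_nonneg (Real.sin θ)]
  · refine one_div_lt_one_div_of_lt
      (Real.sqrt_pos.mpr (hpos b (ha.trans hab.le) hb _))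
      (Real.sqrt_lt_sqrt (hpos b (ha.trans hab.le) hb _).le ?_)
    rw [Real.sin_pi_div_two]
    linarith

lemma ellipticK_pos {k : ℝ} (hk0 : 0 ≤ k) (hk1 : k < 1) : 0 < ellipticK k := by
  have h0 : ellipticK 0 = π / 2 := by simp [ellipticK]
  rcases hk0.eq_or_lt with rfl | h
  · rw [h0]; positivity
  · exact lt_trans (by rw [h0]; positivity) (ellipticK_strictMono le_rfl h hk1)

lemma compl_pos {k : ℝ} (hk0 : 0 ≤ k) (hk1 : k < 1) : 0 < compl k :=
  Real.sqrt_pos.mpr (by nlinarith)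

lemma compl_lt_one {k : ℝ} (hk0 : 0 < k) : compl k < 1 := by
  rw [compl, Real.sqrt_lt' one_pos]
  nlinarith

lemma compl_strictAnti {a b : ℝ} (ha : 0 ≤ a) (hab : a < b) (hb : b < 1) : compl b < compl a :=
  Real.sqrt_lt_sqrt (by nlinarith) (by nlinarith)

/-- `ϑ₁` under `s ↦ 1/s`. -/
lemma jt1_modular (hs : 0 < s) (z : ℂ) : jt1 (I * s) z =
    I * modFactor s * exp (-π * z ^ 2 / s) * jt1 (I * ((1 / s : ℝ) : ℂ)) (z / (I * s)) := by
  have hs' : (s : ℂ) ≠ 0 := by exact_mod_cast hs.ne'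
  have h := jt4_modular hs (z + I * s / 2)
  rw [jt4_add_half_tau, show (z + I * s / 2) / (I * s) = z / (I * s) + 1 / 2 by field_simp,
    jt2_add_half] at h
  have e : exp (-π * (z + I * s / 2) ^ 2 / s) =
      exp (-(π * I * (I * s / 4 + z))) * exp (-π * z ^ 2 / s) := by
    rw [← exp_add]
    congr 1
    field_simp
    ring
  rw [e] at h
  refine mul_left_cancel₀ (mul_ne_zero Complex.I_ne_zero
    (Complex.exp_ne_zero (-(π * I * (I * s / 4 + z))))) ?_
  rw [h]
  linear_combination (-modFactor s * (exp (-(π * I * (I * s / 4 + z))) * exp (-π * z ^ 2 / s)) *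
    jt1 (I * ((1 / s : ℝ) : ℂ)) (z / (I * s))) * Complex.I_mul_I

lemma jt1Deriv_modular (hs : 0 < s) :
    jt1Deriv (I * s) = modFactor s * jt1Deriv (I * ((1 / s : ℝ) : ℂ)) / s := by
  have hs' : (s : ℂ) ≠ 0 := by exact_mod_cast hs.ne'
  have hσ : 0 < (I * ((1 / s : ℝ) : ℂ)).im := I_mul_im_pos (by positivity)
  have h1 : HasDerivAt (fun z => jt1 (I * ((1 / s : ℝ) : ℂ)) (z / (I * s)))
      (jt1Deriv (I * ((1 / s : ℝ) : ℂ)) * (1 / (I * s))) 0 :=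
    HasDerivAt.comp (h₂ := jt1 (I * ((1 / s : ℝ) : ℂ))) 0
      (by rw [zero_div]; exact (differentiable_jt1 hσ 0).hasDerivAt)
      ((hasDerivAt_id (0 : ℂ)).div_const (I * s))
  have h2 : DifferentiableAt ℂ (fun z : ℂ => I * modFactor s * exp (-π * z ^ 2 / s)) 0 := by
    fun_prop
  have h3 := h2.hasDerivAt.mul h1
  have h4 := (differentiable_jt1 (I_mul_im_pos hs) 0).hasDerivAt.unique
    (h3.congr_of_eventuallyEq (Filter.Eventually.of_forall (jt1_modular hs)))
  rw [jt1Deriv, h4, zero_div, jt1_zero]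
  simp only [ne_eq, OfNat.ofNat_ne_zero, not_false_eq_true, zero_pow, mul_zero, zero_div,
    Complex.exp_zero, mul_one, zero_add]
  have hI := Complex.I_ne_zero
  field_simp

/-- The half period at `s` and `1/s`: `2K'/2K = s`. -/
lemma halfPeriod_modular (hs : 0 < s) :
    halfPeriod (I * ((1 / s : ℝ) : ℂ)) = s * halfPeriod (I * s) := by
  have hs' : (s : ℂ) ≠ 0 := by exact_mod_cast hs.ne'
  have hi : 0 < 1 / s := by positivity
  have a3 := jt3_modular hs 0
  have a4 := jt4_modular hs 0
  have b3 := jt3_modular hi 0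
  have b4 := jt4_modular hi 0
  rw [one_div_one_div] at b3 b4
  simp only [ne_eq, OfNat.ofNat_ne_zero, not_false_eq_true, zero_pow, mul_zero, zero_div,
    Complex.exp_zero, mul_one] at a3 a4 b3 b4
  have hM : modFactor s * modFactor (1 / s) = 1 := by
    rw [b3] at a3
    refine mul_right_cancel₀ (jt3_zero_ne (I_mul_im_pos hs)) ?_
    linear_combination -a3
  have n2 := jt2_zero_ne hs
  have n2' := jt2_zero_ne hi
  have n4 := jt4_zero_ne (I_mul_im_pos hi)
  have n := modFactor_ne_zero hs
  have a2 : jt2 (I * s) 0 = modFactor s * jt4 (I * ((1 / s : ℝ) : ℂ)) 0 := by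
    rw [b4, ← mul_assoc, hM, one_mul]
  rw [halfPeriod, halfPeriod, jt1Deriv_modular hs, a2, a3, a4]
  field_simp

lemma compl_thetaModulus_modular (hs : 0 < s) :
    compl (thetaModulus s) = thetaModulus (1 / s) := by
  have a3 := jt3_modular hs 0
  have a4 := jt4_modular hs 0
  simp only [ne_eq, OfNat.ofNat_ne_zero, not_false_eq_true, zero_pow, mul_zero, zero_div,
    Complex.exp_zero, mul_one] at a3 a4
  have n := modFactor_ne_zero hs
  obtain ⟨-, h3, h4⟩ := jt_zero_re s
  have : ((compl (thetaModulus s) : ℝ) : ℂ) = (thetaModulus (1 / s) : ℝ) := by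
    rw [compl_thetaModulus hs, thetaModulus_ofReal]
    push_cast
    rw [h3, h4, a3, a4, mul_div_mul_left _ _ n]
    push_cast
    rfl
  exact_mod_cast this

/-- The period ratio of a modulus. -/
noncomputable def periodRatio (k : ℝ) : ℝ := ellipticK' k / ellipticK k

lemma ellipticK'_pos {k : ℝ} (hk0 : 0 < k) (hk1 : k < 1) : 0 < ellipticK' k :=
  ellipticK_pos (compl_pos hk0.le hk1).le (compl_lt_one hk0)

lemma periodRatio_pos {k : ℝ} (hk0 : 0 < k) (hk1 : k < 1) : 0 < periodRatio k :=
  div_pos (ellipticK'_pos hk0 hk1) (ellipticK_pos hk0.le hk1)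

lemma periodRatio_strictAnti {a b : ℝ} (ha : 0 < a) (hab : a < b) (hb : b < 1) :
    periodRatio b < periodRatio a :=
  div_lt_div₀
    (ellipticK_strictMono (compl_pos (ha.trans hab).le hb).le (compl_strictAnti ha.le hab hb)
      (compl_lt_one ha))
    (ellipticK_strictMono ha.le hab hb).le
    (ellipticK'_pos ha (hab.trans hb)).le (ellipticK_pos ha.le (hab.trans hb))

lemma periodRatio_thetaModulus (hs : 0 < s) : periodRatio (thetaModulus s) = s := by
  have hK := ellipticK_thetaModulus hs
  have hpos := ellipticK_pos (thetaModulus_pos hs).le (thetaModulus_lt_one hs)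
  rw [periodRatio, ellipticK', compl_thetaModulus_modular hs,
    ellipticK_thetaModulus (s := 1 / s) (by positivity), halfPeriod_modular hs,
    Complex.re_ofReal_mul, hK]
  rw [hK] at hpos
  have : (halfPeriod (I * s)).re ≠ 0 := by linarith
  field_simp

/-- Jacobi inversion: the theta functions with period ratio `i K'(k)/K(k)` have modulus `k`. -/
lemma thetaModulus_periodRatio {k : ℝ} (hk0 : 0 < k) (hk1 : k < 1) :
    thetaModulus (periodRatio k) = k := by
  have hs := periodRatio_pos hk0 hk1
  have h := periodRatio_thetaModulus hs
  rcases lt_trichotomy (thetaModulus (periodRatio k)) k with hlt | heq | hgt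
  · have := periodRatio_strictAnti (thetaModulus_pos hs) hlt hk1
    linarith
  · exact heq
  · have := periodRatio_strictAnti hk0 hgt (thetaModulus_lt_one hs)
    linarith

end Inversion

/-! ### Theta functions and the zeta function of modulus `k` -/

section LogDeriv

variable {τ z : ℂ}

lemma jt4Log_zero (τ : ℂ) : jt4Log τ 0 = 0 := by
  rw [jt4Log, deriv_zero_of_even (jt4_neg τ), zero_div]

lemma jt4Log_neg (τ z : ℂ) : jt4Log τ (-z) = -jt4Log τ z := by
  have h : deriv (fun z => jt4 τ (-z)) z = -deriv (jt4 τ) (-z) := deriv_comp_neg _ z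
  rw [show (fun z => jt4 τ (-z)) = jt4 τ from funext (jt4_neg τ)] at h
  rw [jt4Log, jt4Log, jt4_neg, h]
  ring

lemma jt4Log_add_one (τ z : ℂ) : jt4Log τ (z + 1) = jt4Log τ z := by
  have h : deriv (fun z => jt4 τ (z + 1)) z = deriv (jt4 τ) (z + 1) := deriv_comp_add_const _ _ z
  rw [show (fun z => jt4 τ (z + 1)) = jt4 τ from funext (jt4_add_one τ)] at h
  rw [jt4Log, jt4Log, jt4_add_one, h]

lemma jt4Log_half (τ : ℂ) : jt4Log τ (1 / 2) = 0 := by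
  have h := jt4Log_add_one τ (-(1 / 2))
  rw [jt4Log_neg, show (-(1 / 2) + 1 : ℂ) = 1 / 2 by norm_num] at h
  exact self_eq_neg.mp h

lemma jt4Log_add_tau (hτ : 0 < τ.im) (hz : jt4 τ z ≠ 0) :
    jt4Log τ (z + τ) = jt4Log τ z - 2 * π * I := by
  have h : deriv (fun z => jt4 τ (z + τ)) z = deriv (jt4 τ) (z + τ) := deriv_comp_add_const _ _ z
  have hE : HasDerivAt (fun z => -exp (-π * I * (τ + 2 * z)))
      (-(exp (-π * I * (τ + 2 * z)) * (-π * I * 2))) z := by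
    have := (((hasDerivAt_id z).const_mul (2 : ℂ)).const_add τ).const_mul (-π * I)
    exact this.cexp.neg.congr_deriv (by simp)
  have hd := hE.mul (differentiable_jt4 hτ z).hasDerivAt
  rw [show (fun z => jt4 τ (z + τ)) = (fun z => -exp (-π * I * (τ + 2 * z))) * jt4 τ from
    funext (jt4_add_tau τ), hd.deriv] at h
  have hexp := Complex.exp_ne_zero (-π * I * (τ + 2 * z))
  rw [jt4Log, jt4Log, jt4_add_tau, ← h]
  field_simp
  ring

lemma jt4Log_conj (hτ : conj τ = -τ) (z : ℂ) : conj (jt4Log τ z) = jt4Log τ (conj z) := by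
  have h := congrFun (deriv_conj_conj (f := jt4 τ)) (conj z)
  rw [show (conj ∘ jt4 τ ∘ conj) = jt4 τ by
    funext z; simp only [Function.comp, jt4_conj _ hτ, Complex.conj_conj]] at h
  rw [jt4Log, jt4Log, map_div₀, jt4_conj _ hτ, h]
  simp

end LogDeriv

section Identify

lemma theta2_eq (k : ℝ) (z : ℂ) : theta2 k z = jt2 (tau k) z := by
  rw [theta2, jt2, jt3, jacobiTheta₂, ← tsum_mul_left, ← (Equiv.addRight (1 : ℤ)).tsum_eq]
  refine tsum_congr fun n => ?_
  simp only [nomePow, jacobiTheta₂_term, Equiv.coe_addRight, ← exp_add]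
  congr 1; push_cast; ring

lemma theta3_eq (k : ℝ) (z : ℂ) : theta3 k z = jt3 (tau k) z := by
  rw [theta3, jt3, jacobiTheta₂]
  refine tsum_congr fun n => ?_
  simp only [nomePow, jacobiTheta₂_term, ← exp_add]
  congr 1; ring

lemma neg_one_zpow_eq_exp (n : ℤ) : (-1 : ℂ) ^ n = exp (n * (π * I)) := by
  rw [Complex.exp_int_mul, Complex.exp_pi_mul_I]

lemma theta4_eq (k : ℝ) (z : ℂ) : theta4 k z = jt4 (tau k) z := by
  rw [theta4, jt4, jt3, jacobiTheta₂]
  refine tsum_congr fun n => ?_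
  simp only [nomePow, jacobiTheta₂_term, neg_one_zpow_eq_exp, ← exp_add]
  congr 1; ring

lemma theta1_eq (k : ℝ) (z : ℂ) : theta1 k z = jt1 (tau k) z := by
  rw [theta1, jt1, ← theta2_eq, theta2, ← tsum_mul_left]
  refine tsum_congr fun n => ?_
  have e : exp ((2 * n - 1) * I * π * (z - 1 / 2)) =
      exp ((2 * n - 1) * I * π * z) * exp (n * (π * I)) * I := by
    rw [show (2 * n - 1) * I * π * (z - 1 / 2) = (2 * n - 1) * I * π * z + n * (π * I) +
      π * I * (1 / 2) + ((-n : ℤ) : ℂ) * (2 * π * I) by push_cast; ring, exp_add, exp_add, exp_add,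
      Complex.exp_int_mul_two_pi_mul_I, exp_pi_I_half, mul_one]
  rw [e, neg_one_zpow_eq_exp]
  ring

lemma tau_eq (k : ℝ) : tau k = I * (periodRatio k : ℂ) := by
  rw [tau, periodRatio]; push_cast; ring

lemma sn_eq (k : ℝ) (u : ℂ) : sn k u = tsn (tau k) (sc k u) := by
  simp only [sn, tsn, theta1_eq, theta2_eq, theta3_eq, theta4_eq]

lemma cn_eq (k : ℝ) (u : ℂ) : cn k u = tcn (tau k) (sc k u) := by
  simp only [cn, tcn, theta2_eq, theta4_eq]

lemma dn_eq (k : ℝ) (u : ℂ) : dn k u = tdn (tau k) (sc k u) := by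
  simp only [dn, tdn, theta3_eq, theta4_eq]

end Identify

section Zeta

variable {k : ℝ}

lemma tau_im_pos (hk0 : 0 < k) (hk1 : k < 1) : 0 < (tau k).im := by
  rw [tau_eq]; exact I_mul_im_pos (periodRatio_pos hk0 hk1)

lemma tau_conj (k : ℝ) : conj (tau k) = -tau k := by
  rw [tau_eq]; exact conj_I_mul _

lemma ellipticK_ofReal_ne (hk0 : 0 < k) (hk1 : k < 1) : (ellipticK k : ℂ) ≠ 0 := by
  exact_mod_cast (ellipticK_pos hk0.le hk1).ne'

lemma halfPeriod_tau (hk0 : 0 < k) (hk1 : k < 1) : halfPeriod (tau k) = 2 * ellipticK k := by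
  have h := ellipticK_thetaModulus (periodRatio_pos hk0 hk1)
  rw [thetaModulus_periodRatio hk0 hk1] at h
  rw [tau_eq, ← halfPeriod_re, h]
  push_cast; ring

lemma jt2_tau_ne (hk0 : 0 < k) (hk1 : k < 1) : jt2 (tau k) 0 ≠ 0 := by
  rw [tau_eq]; exact jt2_zero_ne (periodRatio_pos hk0 hk1)

/-- The constant of integration in `dn² = (log ϑ₄)'' + E/K`, found by integrating over a quarter
period. -/
lemma jt4Log_const (hk0 : 0 < k) (hk1 : k < 1) :
    deriv (deriv (jt4 (tau k))) 0 / jt4 (tau k) 0 - halfPeriod (tau k) ^ 2 =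
      -(4 * ellipticK k * ellipticE k) := by
  set C := deriv (deriv (jt4 (tau k))) 0 / jt4 (tau k) 0 - halfPeriod (tau k) ^ 2 with hC
  have hs := periodRatio_pos hk0 hk1
  have hE := ellipticE_thetaModulus hs
  have hK := ellipticK_thetaModulus hs
  rw [thetaModulus_periodRatio hk0 hk1] at hE hK
  have hd (x : ℝ) : HasDerivAt (fun x : ℝ => jt4Log (tau k) x)
      (halfPeriod (tau k) ^ 2 * ((((tdn (tau k) x).re ^ 2 : ℝ) : ℂ)) + C) x := by
    have h := (hasDerivAt_jt4Log (tau_im_pos hk0 hk1) (jt2_tau_ne hk0 hk1) (z := x)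
      (by rw [tau_eq]; exact jt4_ofReal_ne hs x)).comp_ofReal
    refine h.congr_deriv ?_
    have := (tquot_re (periodRatio k) x).2.2
    rw [← tau_eq] at this
    push_cast
    rw [this]
  have hcont : Continuous fun x : ℝ => ((((tdn (tau k) x).re ^ 2 : ℝ) : ℂ)) := by
    refine Complex.continuous_ofReal.comp (Continuous.pow ?_ 2)
    rw [tau_eq]
    exact continuous_tdn_re hs
  have hi : IntervalIntegrable (fun x : ℝ => halfPeriod (tau k) ^ 2 *
      ((((tdn (tau k) x).re ^ 2 : ℝ) : ℂ))) MeasureTheory.volume 0 (1 / 2) :=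
    (continuous_const.mul hcont).intervalIntegrable _ _
  have hi' : IntervalIntegrable (fun _ : ℝ => C) MeasureTheory.volume 0 (1 / 2) :=
    continuous_const.intervalIntegrable _ _
  have h := intervalIntegral.integral_eq_sub_of_hasDerivAt (fun x _ => hd x) (hi.add hi')
  rw [intervalIntegral.integral_add hi hi', intervalIntegral.integral_const_mul,
    intervalIntegral.integral_ofReal, intervalIntegral.integral_const] at h
  push_cast at h
  rw [jt4Log_zero, jt4Log_half, halfPeriod_tau hk0 hk1] at h
  rw [← tau_eq] at hE hK
  have hE' : ((ellipticE k : ℝ) : ℂ) = 2 * ellipticK k *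
      ((∫ x in (0 : ℝ)..(1 / 2), (tdn (tau k) x).re ^ 2 : ℝ) : ℂ) := by
    rw [hE, show (halfPeriod (tau k)).re = 2 * ellipticK k by linarith]
    push_cast; ring
  rw [hE']
  simp only [sub_zero, Complex.real_smul] at h
  push_cast at h
  linear_combination 2 * h

/-- The logarithmic derivative `Θ'/Θ`, which the Jacobi zeta function is. -/
noncomputable def zetaLog (k : ℝ) (u : ℂ) : ℂ := jt4Log (tau k) (sc k u) / (2 * ellipticK k)

lemma hasDerivAt_sc (k : ℝ) (u : ℂ) : HasDerivAt (sc k) (1 / (2 * ellipticK k)) u :=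
  (hasDerivAt_id u).div_const _

lemma hasDerivAt_zetaLog (hk0 : 0 < k) (hk1 : k < 1) {u : ℂ} (hu : jt4 (tau k) (sc k u) ≠ 0) :
    HasDerivAt (zetaLog k) (dn k u ^ 2 - ellipticE k / ellipticK k) u := by
  have hK := ellipticK_ofReal_ne hk0 hk1
  have h := ((hasDerivAt_jt4Log (tau_im_pos hk0 hk1) (jt2_tau_ne hk0 hk1) hu).comp u
    (hasDerivAt_sc k u)).div_const (2 * (ellipticK k : ℂ))
  refine h.congr_deriv ?_
  rw [jt4Log_const hk0 hk1, halfPeriod_tau hk0 hk1, dn_eq]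
  field_simp
  ring

lemma sc_mul (k : ℝ) (r u : ℂ) : sc k (r * u) = r * sc k u := mul_div_assoc _ _ _

/-- The Jacobi zeta function is `Θ'/Θ` when the segment of integration avoids the poles. -/
lemma jacobiZeta_eq (hk0 : 0 < k) (hk1 : k < 1) {u : ℂ}
    (hu : ∀ r : ℝ, 0 ≤ r → r ≤ 1 → jt4 (tau k) (r * sc k u) ≠ 0) :
    jacobiZeta k u = zetaLog k u := by
  have hu' : ∀ r ∈ Set.uIcc (0 : ℝ) 1, jt4 (tau k) (sc k ((r : ℂ) * u)) ≠ 0 := by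
    intro r hr
    rw [Set.uIcc_of_le zero_le_one] at hr
    rw [sc_mul]
    exact hu r hr.1 hr.2
  have hd : ∀ r ∈ Set.uIcc (0 : ℝ) 1, HasDerivAt (fun r : ℝ => zetaLog k ((r : ℂ) * u))
      (u * (dn k ((r : ℂ) * u) ^ 2 - ellipticE k / ellipticK k)) r := by
    intro r hr
    have h1 : HasDerivAt (fun r : ℂ => r * u) u (r : ℂ) := by
      simpa using (hasDerivAt_id (r : ℂ)).mul_const u
    have h2 : HasDerivAt (fun r : ℂ => zetaLog k (r * u))
        ((dn k ((r : ℂ) * u) ^ 2 - ellipticE k / ellipticK k) * u) (r : ℂ) :=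
      HasDerivAt.comp (h₂ := zetaLog k) (h := fun r : ℂ => r * u) (r : ℂ)
        (hasDerivAt_zetaLog hk0 hk1 (hu' r hr)) h1
    rw [mul_comm u]
    exact h2.comp_ofReal
  have hcont : ContinuousOn
      (fun r : ℝ => u * (dn k ((r : ℂ) * u) ^ 2 - ellipticE k / ellipticK k))
      (Set.uIcc (0 : ℝ) 1) := by
    have hm : Continuous (fun r : ℝ => sc k ((r : ℂ) * u)) := by
      simp only [sc]; fun_prop
    have h3 := (differentiable_jt3 (tau_im_pos hk0 hk1)).continuous.comp hm
    have h4 := (differentiable_jt4 (tau_im_pos hk0 hk1)).continuous.comp hm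
    simp only [dn_eq, tdn]
    refine continuousOn_const.mul (ContinuousOn.sub (ContinuousOn.pow (ContinuousOn.div
      (h3.const_mul _).continuousOn (h4.const_mul _).continuousOn fun r hr => ?_) 2)
      continuousOn_const)
    exact mul_ne_zero (jt3_zero_ne (tau_im_pos hk0 hk1)) (hu' r hr)
  rw [jacobiZeta, intervalIntegral.integral_eq_sub_of_hasDerivAt hd hcont.intervalIntegrable]
  simp [zetaLog, sc, jt4Log_zero]

end Zeta

/-! ### Sesquilinear theta forms -/

/-- The data of one Darboux parameter: the scaled argument `v = i (z - l) / (2K)` and the two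
exponential factors of the columns of the fundamental solution. -/
@[ext] structure LaxDatum where
  /-- the scaled uniformizing parameter -/
  v : ℂ
  /-- the exponential factor of the first column -/
  P : ℂ
  /-- the exponential factor of the second column -/
  Q : ℂ

namespace LaxDatum

/-- Complex conjugation of a datum. -/
def cconj (d : LaxDatum) : LaxDatum :=
  ⟨starRingEnd ℂ d.v, starRingEnd ℂ d.P, starRingEnd ℂ d.Q⟩

/-- The datum at the reflected point `(-x, -t)`. -/
noncomputable def inv (d : LaxDatum) : LaxDatum := ⟨d.v, d.P⁻¹, d.Q⁻¹⟩

/-- The datum moved by the period `τ`, at the scaled position `y`. -/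
noncomputable def shift (τ y : ℂ) (d : LaxDatum) : LaxDatum :=
  ⟨d.v + τ, exp (-(2 * π * I * y)) * d.P, exp (2 * π * I * y) * d.Q⟩

/-- The datum reflected about `h / 2`, with the two columns exchanged. -/
def flip (h : ℂ) (d : LaxDatum) : LaxDatum := ⟨h - d.v, d.Q, d.P⟩

@[simp] lemma cconj_cconj (d : LaxDatum) : d.cconj.cconj = d := by
  simp [cconj]

end LaxDatum

/-- The common shape of the entries of the numerator and denominator matrices: a sesquilinear
expression in the data `l` (already conjugated) and `r`, at the scaled position `y`. -/
noncomputable def thetaForm (τ : ℂ) (N₁ N₂ B R : ℂ → ℂ) (e₁ e₂ y : ℂ) (l r : LaxDatum) : ℂ :=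
  l.P * (R l.v)⁻¹ * (N₁ (r.v + l.v - y) / jt1 τ (r.v + l.v)) * (R r.v) * r.P +
    e₁ * (l.P * (R l.v)⁻¹ * (N₂ (r.v - l.v + y) / B (r.v - l.v)) * (R r.v)⁻¹ * r.Q) +
    e₂ * (l.Q * R l.v * (N₂ (r.v - l.v - y) / B (r.v - l.v)) * R r.v * r.P) +
    l.Q * R l.v * (N₁ (r.v + l.v + y) / jt1 τ (r.v + l.v)) * (R r.v)⁻¹ * r.Q

section Form

variable {τ : ℂ} {N₁ N₂ B R : ℂ → ℂ} {e₁ e₂ y : ℂ}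

/-- Exchanging the two data transposes the coefficient matrix of the form and inverts `R`. -/
lemma thetaForm_swap (h2 : ∀ z, N₂ (-z) = N₂ z) (hB : ∀ z, B (-z) = B z) (l r : LaxDatum) :
    thetaForm τ N₁ N₂ B R e₁ e₂ y l r =
      thetaForm τ N₁ N₂ B (fun z => (R z)⁻¹) e₂ e₁ y r l := by
  have a (w : ℂ) : N₂ (l.v - r.v + w) = N₂ (r.v - l.v - w) := by rw [← h2]; congr 1; ring
  have a' (w : ℂ) : N₂ (l.v - r.v - w) = N₂ (r.v - l.v + w) := by rw [← h2]; congr 1; ring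
  have b : B (l.v - r.v) = B (r.v - l.v) := by rw [← hB]; congr 1; ring
  simp only [thetaForm, a, a', b, inv_inv, add_comm l.v r.v]
  ring

lemma thetaForm_conj (hτ : conj τ = -τ) (h1 : ∀ z, conj (N₁ z) = N₁ (conj z))
    (h2 : ∀ z, conj (N₂ z) = N₂ (conj z)) (hB : ∀ z, conj (B z) = B (conj z))
    (hR : ∀ z, conj (R z) = R (conj z)) (he₁ : conj e₁ = e₁) (he₂ : conj e₂ = e₂)
    (hy : conj y = y) (l r : LaxDatum) :
    conj (thetaForm τ N₁ N₂ B R e₁ e₂ y l r) = thetaForm τ N₁ N₂ B R e₁ e₂ y l.cconj r.cconj := by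
  simp only [thetaForm, LaxDatum.cconj, map_add, map_mul, map_div₀, map_inv₀, map_sub, h1, h2, hB,
    hR, he₁, he₂, hy, jt1_conj _ hτ]

lemma thetaForm_neg {l r : LaxDatum} (hlP : l.P ≠ 0)
    (hlQ : l.Q ≠ 0) (hrP : r.P ≠ 0) (hrQ : r.Q ≠ 0) :
    thetaForm τ N₁ N₂ B R e₁ e₂ (-y) l.inv r.inv =
      (l.P * l.Q)⁻¹ * thetaForm τ N₁ N₂ B (fun z => (R z)⁻¹) e₂ e₁ y l r * (r.P * r.Q)⁻¹ := by
  simp only [thetaForm, LaxDatum.inv, sub_neg_eq_add, ← sub_eq_add_neg, inv_inv]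
  generalize N₁ (r.v + l.v - y) / jt1 τ (r.v + l.v) = A₁
  generalize N₁ (r.v + l.v + y) / jt1 τ (r.v + l.v) = A₂
  generalize N₂ (r.v - l.v - y) / B (r.v - l.v) = A₃
  generalize N₂ (r.v - l.v + y) / B (r.v - l.v) = A₄
  generalize (R l.v)⁻¹ = R₁
  generalize (R r.v)⁻¹ = R₂
  generalize R l.v = R₃
  generalize R r.v = R₄
  field_simp
  ring

lemma exp_quasi_sub (τ w y : ℂ) : exp (-π * I * (τ + 2 * (w - y))) =
    exp (2 * π * I * y) * exp (-π * I * (τ + 2 * w)) := by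
  rw [← exp_add]; congr 1; ring

lemma exp_quasi_add (τ w y : ℂ) : exp (-π * I * (τ + 2 * (w + y))) =
    exp (-(2 * π * I * y)) * exp (-π * I * (τ + 2 * w)) := by
  rw [← exp_add]; congr 1; ring

lemma exp_mul_exp_neg' (w : ℂ) : exp w * exp (-w) = 1 := by
  rw [← exp_add, add_neg_cancel, Complex.exp_zero]

/-- Quotients of theta functions with shifted arguments are quasi-periodic. -/
lemma quasi_div {f g : ℂ → ℂ} {σ ρ : ℂ} (hρ : ρ ^ 2 = 1)
    (hf : ∀ z, f (z + τ) = σ * exp (-π * I * (τ + 2 * z)) * f z)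
    (hg : ∀ z, g (z + τ) = ρ * exp (-π * I * (τ + 2 * z)) * g z) (w y : ℂ) :
    f (w + τ - y) / g (w + τ) = σ * ρ * exp (2 * π * I * y) * (f (w - y) / g w) ∧
    f (w + τ + y) / g (w + τ) = σ * ρ * exp (-(2 * π * I * y)) * (f (w + y) / g w) := by
  have hρ0 : ρ ≠ 0 := by rintro rfl; norm_num at hρ
  have hρ' : ρ⁻¹ = ρ := by field_simp; exact hρ.symm
  have hE := Complex.exp_ne_zero (-π * I * (τ + 2 * w))
  constructor
  · rw [show w + τ - y = w - y + τ by ring, hf, hg, exp_quasi_sub, mul_div_mul_comm,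
      show σ * ρ = σ * ρ⁻¹ by rw [hρ']]
    congr 1
    field_simp
  · rw [show w + τ + y = w + y + τ by ring, hf, hg, exp_quasi_add, mul_div_mul_comm,
      show σ * ρ = σ * ρ⁻¹ by rw [hρ']]
    congr 1
    field_simp

/-- The form does not change when one argument moves by the period `τ`: the multipliers of the theta
quotients are absorbed by the exponential factors of the datum. -/
lemma thetaForm_shift {σ₁ σ₂ ρ : ℂ} (hρ : ρ ^ 2 = 1)
    (h1 : ∀ z, N₁ (z + τ) = σ₁ * exp (-π * I * (τ + 2 * z)) * N₁ z)
    (h2 : ∀ z, N₂ (z + τ) = σ₂ * exp (-π * I * (τ + 2 * z)) * N₂ z)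
    (hB : ∀ z, B (z + τ) = 1 * exp (-π * I * (τ + 2 * z)) * B z)
    (hR : ∀ z, R (z + τ) = ρ * R z) (hσ₁ : σ₁ = -ρ) (hσ₂ : σ₂ = ρ) (l r : LaxDatum) :
    thetaForm τ N₁ N₂ B R e₁ e₂ y l (r.shift τ y) = thetaForm τ N₁ N₂ B R e₁ e₂ y l r := by
  subst hσ₁ hσ₂
  have hρ0 : σ₂ ≠ 0 := by rintro rfl; norm_num at hρ
  have hρ' : σ₂⁻¹ = σ₂ := by field_simp; exact hρ.symm
  obtain ⟨a1, a2⟩ := quasi_div (g := jt1 τ) (ρ := -1) (by norm_num) h1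
    (fun z => by rw [jt1_add_tau]; ring) (r.v + l.v) y
  obtain ⟨b1, b2⟩ := quasi_div (by norm_num) h2 hB (r.v - l.v) y
  have e := exp_mul_exp_neg' (2 * π * I * y)
  simp only [thetaForm, LaxDatum.shift, show r.v + τ + l.v = r.v + l.v + τ by ring,
    show r.v + τ - l.v = r.v - l.v + τ by ring, a1, a2, b1, b2, hR, mul_inv, hρ']
  have e' := congrArg₂ (· * ·) hρ e
  simp only [mul_one] at e'
  linear_combination (l.P * (R l.v)⁻¹ * (N₁ (r.v + l.v - y) / jt1 τ (r.v + l.v)) * (R r.v) * r.P +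
    e₁ * (l.P * (R l.v)⁻¹ * (N₂ (r.v - l.v + y) / B (r.v - l.v)) * (R r.v)⁻¹ * r.Q) +
    e₂ * (l.Q * R l.v * (N₂ (r.v - l.v - y) / B (r.v - l.v)) * R r.v * r.P) +
    l.Q * R l.v * (N₁ (r.v + l.v + y) / jt1 τ (r.v + l.v)) * (R r.v)⁻¹ * r.Q) * e'

/-- Under a reflection that exchanges the theta functions pairwise and the two columns, the four
terms of the form are permuted. -/
lemma thetaForm_flip {h η : ℂ} (hη : η ^ 2 = 1) (h12 : ∀ z, N₁ (h - z) = N₂ z)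
    (h21 : ∀ z, N₂ (h - z) = N₁ z) (h1B : ∀ z, jt1 τ (h - z) = η * B z)
    (hB1 : ∀ z, B (h - z) = η * jt1 τ z) (hR : ∀ z, R (h - z) = (R z)⁻¹) (l r : LaxDatum) :
    thetaForm τ N₁ N₂ B R 1 1 y l (r.flip h) = η * thetaForm τ N₁ N₂ B R 1 1 y l r := by
  have hη0 : η ≠ 0 := by rintro rfl; norm_num at hη
  have hη' : η⁻¹ = η := by field_simp; exact hη.symm
  have n1 (w : ℂ) : N₁ (h - (r.v - l.v) + w) = N₂ (r.v - l.v - w) := by rw [← h12]; congr 1; ring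
  have n1' (w : ℂ) : N₁ (h - (r.v - l.v) - w) = N₂ (r.v - l.v + w) := by rw [← h12]; congr 1; ring
  have n2 (w : ℂ) : N₂ (h - (r.v + l.v) + w) = N₁ (r.v + l.v - w) := by rw [← h21]; congr 1; ring
  have n2' (w : ℂ) : N₂ (h - (r.v + l.v) - w) = N₁ (r.v + l.v + w) := by rw [← h21]; congr 1; ring
  simp only [thetaForm, LaxDatum.flip, n1, n1', n2, n2', hR, inv_inv,
    show h - r.v + l.v = h - (r.v - l.v) by ring, show h - r.v - l.v = h - (r.v + l.v) by ring,
    h1B, hB1, div_eq_mul_inv, mul_inv, hη']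
  ring

end Form

/-! ### The forms and the seed of the two backgrounds -/

/-- `ϑ₂` on the `cn` background, `ϑ₃` on the `dn` background. -/
noncomputable def thA (b : Background) (τ z : ℂ) : ℂ :=
  match b with
  | .cnType => jt2 τ z
  | .dnType => jt3 τ z

/-- `ϑ₃` on the `cn` background, `ϑ₂` on the `dn` background. -/
noncomputable def thB (b : Background) (τ z : ℂ) : ℂ :=
  match b with
  | .cnType => jt3 τ z
  | .dnType => jt2 τ z

/-- The sign of the upper right entry of the numerator form. -/
def bgSign : Background → ℂ
  | .cnType => -1
  | .dnType => 1

section Background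

variable (b : Background) (τ : ℂ)

lemma thA_neg (z : ℂ) : thA b τ (-z) = thA b τ z := by
  cases b <;> simp [thA, jt2_neg, jt3_neg]

lemma thB_neg (z : ℂ) : thB b τ (-z) = thB b τ z := by
  cases b <;> simp [thB, jt2_neg, jt3_neg]

lemma thA_add_tau (z : ℂ) : thA b τ (z + τ) = 1 * exp (-π * I * (τ + 2 * z)) * thA b τ z := by
  cases b <;> simp only [thA, jt2_add_tau, jt3_add_tau, one_mul]

lemma thB_add_tau (z : ℂ) : thB b τ (z + τ) = 1 * exp (-π * I * (τ + 2 * z)) * thB b τ z := by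
  cases b <;> simp only [thB, jt2_add_tau, jt3_add_tau, one_mul]

variable {τ} in
lemma thA_conj (hτ : conj τ = -τ) (z : ℂ) : conj (thA b τ z) = thA b τ (conj z) := by
  cases b <;> simp only [thA, jt2_conj _ hτ, jt3_conj _ hτ]

variable {τ} in
lemma thB_conj (hτ : conj τ = -τ) (z : ℂ) : conj (thB b τ z) = thB b τ (conj z) := by
  cases b <;> simp only [thB, jt2_conj _ hτ, jt3_conj _ hτ]

lemma bgSign_conj : conj (bgSign b) = bgSign b := by
  cases b <;> simp [bgSign]

/-- The quotient `ϑ₂ / ϑ₄` or `ϑ₃ / ϑ₄`, up to an exponential the function `r(z)`. -/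
noncomputable def thR (z : ℂ) : ℂ := thA b τ z / jt4 τ z

/-- The form giving the numerator matrix. -/
noncomputable def numForm (y : ℂ) (l r : LaxDatum) : ℂ :=
  thetaForm τ (thA b τ) (jt4 τ) (thB b τ) (thR b τ) (bgSign b) 1 y l r

/-- The form giving the denominator matrix. -/
noncomputable def denForm (y : ℂ) (l r : LaxDatum) : ℂ :=
  thetaForm τ (jt4 τ) (thA b τ) (thB b τ) (fun _ => 1) 1 1 y l r

/-- The Darboux seed up to a scalar factor. -/
noncomputable def seedVec (y : ℂ) (d : LaxDatum) : Fin 2 → ℂ :=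
  ![jt1 τ (d.v - y) / jt4 τ d.v * d.P + thB b τ (d.v + y) / thA b τ d.v * d.Q,
    -(thB b τ (d.v - y) / thA b τ d.v * d.P + jt1 τ (d.v + y) / jt4 τ d.v * d.Q)]

lemma jt4_add_tau' (z : ℂ) : jt4 τ (z + τ) = -1 * exp (-π * I * (τ + 2 * z)) * jt4 τ z := by
  rw [jt4_add_tau]; ring

lemma jt1_add_tau' (z : ℂ) : jt1 τ (z + τ) = -1 * exp (-π * I * (τ + 2 * z)) * jt1 τ z := by
  rw [jt1_add_tau]; ring

lemma thR_add_tau (z : ℂ) : thR b τ (z + τ) = -1 * thR b τ z := by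
  have h := (quasi_div (by norm_num) (thA_add_tau b τ) (jt4_add_tau' τ) z 0).1
  simpa [thR] using h

/-- Two data are equivalent at position `y` with sign `η` if exchanging one for the other
multiplies the seed and the entries of the numerator form by `η`. -/
structure LaxDatum.Equivalent (y η : ℂ) (d d' : LaxDatum) : Prop where
  seed : ∀ i, seedVec b τ y d' i = η * seedVec b τ y d i
  right : ∀ l, numForm b τ y l d' = η * numForm b τ y l d
  left : ∀ r, numForm b τ y d' r = η * numForm b τ y d r

variable {b τ} {y η : ℂ} {d d' : LaxDatum}

lemma LaxDatum.Equivalent.refl (d : LaxDatum) : d.Equivalent b τ y 1 d :=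
  ⟨fun _ => (one_mul _).symm, fun _ => (one_mul _).symm, fun _ => (one_mul _).symm⟩

lemma LaxDatum.Equivalent.symm (hη : η ^ 2 = 1) (h : d.Equivalent b τ y η d') :
    d'.Equivalent b τ y η d := by
  refine ⟨fun i => ?_, fun l => ?_, fun r => ?_⟩
  · rw [h.seed, ← mul_assoc, ← sq, hη, one_mul]
  · rw [h.right, ← mul_assoc, ← sq, hη, one_mul]
  · rw [h.left, ← mul_assoc, ← sq, hη, one_mul]

lemma numForm_swap (l r : LaxDatum) : numForm b τ y l r = thetaForm τ (thA b τ) (jt4 τ) (thB b τ)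
    (fun z => (thR b τ z)⁻¹) 1 (bgSign b) y r l :=
  thetaForm_swap (jt4_neg τ) (thB_neg b τ) l r

lemma LaxDatum.Equivalent.shift (d : LaxDatum) : d.Equivalent b τ y 1 (d.shift τ y) := by
  refine ⟨fun i => ?_, fun l => ?_, fun r => ?_⟩
  · have e := exp_mul_exp_neg' (2 * π * I * y)
    obtain ⟨a1, a2⟩ := quasi_div (by norm_num) (jt1_add_tau' τ) (jt4_add_tau' τ) d.v y
    obtain ⟨b1, b2⟩ := quasi_div (by norm_num) (thB_add_tau b τ) (thA_add_tau b τ) d.v y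
    fin_cases i
    · simp only [seedVec, LaxDatum.shift, a1, b2, Fin.zero_eta, Matrix.cons_val_zero]
      linear_combination (jt1 τ (d.v - y) / jt4 τ d.v * d.P +
        thB b τ (d.v + y) / thA b τ d.v * d.Q) * e
    · simp only [seedVec, LaxDatum.shift, b1, a2, Fin.mk_one, Matrix.cons_val_one, Matrix.cons_val_fin_one]
      linear_combination (-(thB b τ (d.v - y) / thA b τ d.v * d.P +
        jt1 τ (d.v + y) / jt4 τ d.v * d.Q)) * e
  · rw [one_mul]
    exact thetaForm_shift (by norm_num) (thA_add_tau b τ) (jt4_add_tau' τ) (thB_add_tau b τ)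
      (thR_add_tau b τ) (by norm_num) rfl l d
  · rw [one_mul, numForm_swap, numForm_swap]
    exact thetaForm_shift (by norm_num) (thA_add_tau b τ) (jt4_add_tau' τ) (thB_add_tau b τ)
      (fun z => by rw [thR_add_tau, mul_inv]; norm_num) (by norm_num) rfl r d

lemma LaxDatum.Equivalent.flip {h : ℂ} (hη : η ^ 2 = 1) (h34 : ∀ z, jt3 τ (h - z) = jt4 τ z)
    (h43 : ∀ z, jt4 τ (h - z) = jt3 τ z) (h12 : ∀ z, jt1 τ (h - z) = η * jt2 τ z)
    (h21 : ∀ z, jt2 τ (h - z) = η * jt1 τ z) (d : LaxDatum) :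
    d.Equivalent .dnType τ y η (d.flip h) := by
  have hη0 : η ≠ 0 := by rintro rfl; norm_num at hη
  have hR (z : ℂ) : thR .dnType τ (h - z) = (thR .dnType τ z)⁻¹ := by
    simp only [thR, thA, h34, h43, inv_div]
  refine ⟨fun i => ?_, fun l => ?_, fun r => ?_⟩
  · have p (w : ℂ) : h - d.v + w = h - (d.v - w) := by ring
    have m (w : ℂ) : h - d.v - w = h - (d.v + w) := by ring
    fin_cases i
    · simp only [seedVec, LaxDatum.flip, Fin.zero_eta, Matrix.cons_val_zero, thA, thB, p, m, h34,
        h43, h12, h21]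
      ring
    · simp only [seedVec, LaxDatum.flip, Fin.mk_one, Matrix.cons_val_one, Matrix.cons_val_fin_one, thA, thB, p, m, h34,
        h43, h12, h21]
      ring
  · exact thetaForm_flip hη h34 h43 h12 h21 hR l d
  · rw [numForm_swap, numForm_swap]
    exact thetaForm_flip hη h34 h43 h12 h21 (fun z => by simp only [hR]) r d

lemma numForm_conj (hτ : conj τ = -τ) (hy : conj y = y) (l r : LaxDatum) :
    conj (numForm b τ y l r) = numForm b τ y l.cconj r.cconj :=
  thetaForm_conj hτ (thA_conj b hτ) (fun z => jt4_conj z hτ) (thB_conj b hτ)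
    (fun z => by simp only [thR, map_div₀, thA_conj b hτ, jt4_conj _ hτ]) (bgSign_conj b)
    (map_one _) hy l r

lemma seedVec_conj (hτ : conj τ = -τ) (hy : conj y = y) (d : LaxDatum) (i : Fin 2) :
    conj (seedVec b τ y d i) = seedVec b τ y d.cconj i := by
  fin_cases i <;>
  simp [seedVec, LaxDatum.cconj, jt1_conj _ hτ, jt4_conj _ hτ, thA_conj b hτ, thB_conj b hτ, hy]

/-- Reflection `(x, t) ↦ (-x, -t)` turns the numerator form into its adjoint. -/
lemma numForm_inv {l r : LaxDatum} (hlP : l.P ≠ 0) (hlQ : l.Q ≠ 0) (hrP : r.P ≠ 0)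
    (hrQ : r.Q ≠ 0) : numForm b τ (-y) l.inv r.inv =
      (l.P * l.Q)⁻¹ * numForm b τ y r l * (r.P * r.Q)⁻¹ := by
  rw [numForm_swap r l]
  exact thetaForm_neg hlP hlQ hrP hrQ

lemma denForm_inv {l r : LaxDatum} (hlP : l.P ≠ 0) (hlQ : l.Q ≠ 0) (hrP : r.P ≠ 0)
    (hrQ : r.Q ≠ 0) : denForm b τ (-y) l.inv r.inv =
      (l.P * l.Q)⁻¹ * denForm b τ y l r * (r.P * r.Q)⁻¹ := by
  have h := thetaForm_neg (τ := τ) (N₁ := jt4 τ) (N₂ := thA b τ) (B := thB b τ) (R := fun _ => 1)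
    (e₁ := 1) (e₂ := 1) (y := y) hlP hlQ hrP hrQ
  simp only [inv_one] at h
  exact h

/-- Reflection `(x, t) ↦ (-x, -t)` exchanges the two components of the seed. -/
lemma seedVec_inv (hP : d.P ≠ 0) (hQ : d.Q ≠ 0) :
    seedVec b τ (-y) d.inv 0 = -((d.P * d.Q)⁻¹ * seedVec b τ y d 1) ∧
    seedVec b τ (-y) d.inv 1 = -((d.P * d.Q)⁻¹ * seedVec b τ y d 0) := by
  simp only [seedVec, LaxDatum.inv, sub_neg_eq_add, ← sub_eq_add_neg, Matrix.cons_val_zero,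
    Matrix.cons_val_one]
  generalize jt1 τ (d.v - y) / jt4 τ d.v = A₁
  generalize jt1 τ (d.v + y) / jt4 τ d.v = A₂
  generalize thB b τ (d.v + y) / thA b τ d.v = A₃
  generalize thB b τ (d.v - y) / thA b τ d.v = A₄
  constructor
  · field_simp
    ring
  · field_simp
    ring

end Background

/-! ### Reality and periodicity of the spectral data -/

/-- The scaled shift `2 i l / (2K)`. -/
noncomputable def bgShift (k : ℝ) : Background → ℂ
  | .cnType => 0
  | .dnType => tau k / 2

/-- The spectral parameter as a function of the scaled argument. -/
noncomputable def specV (k α : ℝ) (b : Background) (v : ℂ) : ℂ :=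
  match b with
  | .cnType => I * α / 2 * (tdn (tau k) v * tsn (tau k) v / tcn (tau k) v)
  | .dnType => I * α * (k : ℂ) ^ 2 / 2 * (tsn (tau k) v * tcn (tau k) v / tdn (tau k) v)

/-- The frequency as a function of the scaled argument. -/
noncomputable def omegaV (k α : ℝ) (b : Background) (v : ℂ) : ℂ :=
  (α : ℂ) ^ 3 * ((k : ℂ) ^ 2 * tdn (tau k) v * tsn (tau k) v * tcn (tau k) v +
    (compl k : ℂ) ^ 2 * (tdn (tau k) (v + bgShift k b) * tsn (tau k) (v + bgShift k b) /
      tcn (tau k) (v + bgShift k b) ^ 3))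

/-- The exponent rate of the first column: the Jacobi zeta function. -/
noncomputable def zetaV (k : ℝ) (v : ℂ) : ℂ := jt4Log (tau k) v / (2 * ellipticK k)

/-- The exponent rate of the second column: the logarithmic derivative of `ϑ₂` or `ϑ₃`. -/
noncomputable def coZetaV (k : ℝ) (b : Background) (v : ℂ) : ℂ :=
  match b with
  | .cnType => I * π / (2 * ellipticK k) + zetaV k (v + 1 / 2 + tau k / 2)
  | .dnType => zetaV k (v + 1 / 2)

/-- The datum of the parameter with scaled argument `v`. -/
noncomputable def laxDatum (k α : ℝ) (b : Background) (x t : ℝ) (v : ℂ) : LaxDatum where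
  v := v
  P := exp ((α * zetaV k v + I * specV k α b v) * xi k α b x t + omegaV k α b v / 2 * t)
  Q := exp ((-(α * coZetaV k b v) + I * specV k α b v) * xi k α b x t - omegaV k α b v / 2 * t)

section Conj

variable (k α : ℝ) (b : Background)

lemma tquot_tau_conj (v : ℂ) : conj (tsn (tau k) v) = tsn (tau k) (conj v) ∧
    conj (tcn (tau k) v) = tcn (tau k) (conj v) ∧ conj (tdn (tau k) v) = tdn (tau k) (conj v) := by
  rw [tau_eq]
  exact tquot_conj _ v

lemma specV_conj (v : ℂ) : conj (specV k α b v) = -specV k α b (conj v) := by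
  obtain ⟨h1, h2, h3⟩ := tquot_tau_conj k v
  cases b <;> simp only [specV, map_mul, map_div₀, h1, h2, h3, Complex.conj_I, map_pow,
    Complex.conj_ofReal, map_ofNat] <;> ring

lemma tquot_add_tau (τ v : ℂ) : tsn τ (v + τ) = tsn τ v ∧ tcn τ (v + τ) = -tcn τ v ∧
    tdn τ (v + τ) = -tdn τ v := by
  have h := Complex.exp_ne_zero (-π * I * (τ + 2 * v))
  have key (a b c w : ℂ) : a * (exp (-π * I * (τ + 2 * v)) * b) /
      (c * (-exp (-π * I * (τ + 2 * v)) * w)) = -(a * b / (c * w)) := by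
    rw [show a * (exp (-π * I * (τ + 2 * v)) * b) = exp (-π * I * (τ + 2 * v)) * (a * b) by ring,
      show c * (-exp (-π * I * (τ + 2 * v)) * w) = exp (-π * I * (τ + 2 * v)) * -(c * w) by ring,
      mul_div_mul_left _ _ h, div_neg]
  have key' (a b c w : ℂ) : a * (-exp (-π * I * (τ + 2 * v)) * b) /
      (c * (-exp (-π * I * (τ + 2 * v)) * w)) = a * b / (c * w) := by
    rw [show a * (-exp (-π * I * (τ + 2 * v)) * b) = a * (exp (-π * I * (τ + 2 * v)) * -b) by ring,
      key, mul_neg, neg_div, neg_neg]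
  simp only [tsn, tcn, tdn, jt1_add_tau, jt2_add_tau, jt3_add_tau, jt4_add_tau, key, key', and_self]

lemma bgShift_conj : conj (bgShift k b) = -bgShift k b := by
  cases b <;> simp [bgShift, tau_conj, map_ofNat, neg_div]

lemma bgShift_cases : bgShift k b = -bgShift k b ∨ bgShift k b = -bgShift k b + tau k := by
  cases b
  · left; simp [bgShift]
  · right; simp only [bgShift]; ring

lemma omegaV_conj (v : ℂ) : conj (omegaV k α b v) = omegaV k α b (conj v) := by
  obtain ⟨h1, h2, h3⟩ := tquot_tau_conj k v
  obtain ⟨g1, g2, g3⟩ := tquot_tau_conj k (v + bgShift k b)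
  simp only [omegaV, map_add, map_mul, map_pow, map_div₀, h1, h2, h3, g1, g2, g3,
    Complex.conj_ofReal, bgShift_conj]
  rcases bgShift_cases k b with h | h
  · rw [← h]
  · conv_rhs => rw [h]
    rw [← add_assoc]
    obtain ⟨p1, p2, p3⟩ := tquot_add_tau (tau k) (conj v + -bgShift k b)
    rw [p1, p2, p3]
    ring

lemma specV_add_tau (v : ℂ) : specV k α b (v + tau k) = specV k α b v := by
  obtain ⟨h1, h2, h3⟩ := tquot_add_tau (tau k) v
  cases b <;> simp only [specV, h1, h2, h3, neg_mul, mul_neg, neg_div_neg_eq]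

lemma omegaV_add_tau (v : ℂ) : omegaV k α b (v + tau k) = omegaV k α b v := by
  obtain ⟨h1, h2, h3⟩ := tquot_add_tau (tau k) v
  obtain ⟨g1, g2, g3⟩ := tquot_add_tau (tau k) (v + bgShift k b)
  simp only [omegaV, show v + tau k + bgShift k b = v + bgShift k b + tau k by ring, h1, h2, h3,
    g1, g2, g3]
  ring

end Conj

section Datum

variable {k : ℝ} (α : ℝ) (b : Background) (x t : ℝ)

lemma zetaV_conj (k : ℝ) (v : ℂ) : conj (zetaV k v) = zetaV k (conj v) := by
  simp only [zetaV, map_div₀, map_mul, jt4Log_conj (tau_conj k), Complex.conj_ofReal, map_ofNat]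

lemma zetaV_add_tau (hk0 : 0 < k) (hk1 : k < 1) {v : ℂ} (hv : jt4 (tau k) v ≠ 0) :
    zetaV k (v + tau k) = zetaV k v - 2 * π * I / (2 * ellipticK k) := by
  rw [zetaV, zetaV, jt4Log_add_tau (tau_im_pos hk0 hk1) hv, sub_div]

lemma zetaV_neg (k : ℝ) (v : ℂ) : zetaV k (-v) = -zetaV k v := by
  rw [zetaV, zetaV, jt4Log_neg, neg_div]

lemma zetaV_add_one (k : ℝ) (v : ℂ) : zetaV k (v + 1) = zetaV k v := by
  rw [zetaV, zetaV, jt4Log_add_one]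

lemma tau_re (k : ℝ) : (tau k).re = 0 := by rw [tau_eq]; simp

lemma tau_im (k : ℝ) : (tau k).im = periodRatio k := by rw [tau_eq]; simp

lemma jt4_tau_ne_of_re (hk0 : 0 < k) (hk1 : k < 1) {v : ℂ} (h0 : 0 < v.re) (h1 : v.re < 1) :
    jt4 (tau k) v ≠ 0 := by
  rw [tau_eq]
  exact jt4_ne_zero_of_re (periodRatio_pos hk0 hk1) h0 h1

lemma half_shift_re (v w : ℂ) (hw : w.re = 0) (hv : |v.re| ≤ 1 / 4) :
    0 < (v + 1 / 2 + w).re ∧ (v + 1 / 2 + w).re < 1 := by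
  have : (v + 1 / 2 + w).re = v.re + 1 / 2 := by simp [hw]
  rw [this]
  rw [abs_le] at hv
  constructor <;> linarith

lemma coZetaV_conj (hk0 : 0 < k) (hk1 : k < 1) {v : ℂ} (hv : |v.re| ≤ 1 / 4) :
    conj (coZetaV k b v) = coZetaV k b (conj v) := by
  cases b
  · have hne : jt4 (tau k) (conj v + 1 / 2 + -tau k / 2) ≠ 0 := by
      obtain ⟨h0, h1⟩ := half_shift_re (conj v) (-tau k / 2)
        (by simp [tau_re]) (by simpa using hv)
      exact jt4_tau_ne_of_re hk0 hk1 h0 h1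
    have h := zetaV_add_tau hk0 hk1 hne
    rw [show conj v + 1 / 2 + -tau k / 2 + tau k = conj v + 1 / 2 + tau k / 2 by ring] at h
    simp only [coZetaV, map_add, map_div₀, map_mul, zetaV_conj, tau_conj, Complex.conj_I,
      Complex.conj_ofReal, map_ofNat, map_one, h]
    ring
  · simp [coZetaV, zetaV_conj, map_ofNat]

lemma laxDatum_conj (hk0 : 0 < k) (hk1 : k < 1) {v : ℂ} (hv : |v.re| ≤ 1 / 4) :
    laxDatum k α b x t (conj v) = (laxDatum k α b x t v).cconj := by
  have hs := specV_conj k α b v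
  have ho := omegaV_conj k α b v
  ext
  · rfl
  · simp only [laxDatum, LaxDatum.cconj, ← Complex.exp_conj, map_add, map_mul, map_div₀, hs, ho,
      zetaV_conj, Complex.conj_I, Complex.conj_ofReal, map_ofNat, neg_mul_neg]
  · simp only [laxDatum, LaxDatum.cconj, ← Complex.exp_conj, map_add, map_sub, map_mul, map_div₀,
      map_neg, hs, ho, coZetaV_conj b hk0 hk1 hv, Complex.conj_I, Complex.conj_ofReal, map_ofNat,
      neg_mul_neg]

lemma coZetaV_add_tau (hk0 : 0 < k) (hk1 : k < 1) {v : ℂ} (hv : |v.re| ≤ 1 / 4) :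
    coZetaV k b (v + tau k) = coZetaV k b v - 2 * π * I / (2 * ellipticK k) := by
  cases b
  · obtain ⟨h0, h1⟩ := half_shift_re v (tau k / 2) (by simp [tau_re]) hv
    have h := zetaV_add_tau hk0 hk1 (jt4_tau_ne_of_re hk0 hk1 h0 h1)
    simp only [coZetaV,
      show v + tau k + 1 / 2 + tau k / 2 = v + 1 / 2 + tau k / 2 + tau k by ring, h]
    ring
  · obtain ⟨h0, h1⟩ := half_shift_re v 0 rfl hv
    rw [add_zero] at h0 h1
    have h := zetaV_add_tau hk0 hk1 (jt4_tau_ne_of_re hk0 hk1 h0 h1)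
    simp only [coZetaV, show v + tau k + 1 / 2 = v + 1 / 2 + tau k by ring, h]

/-- The scaled position `α ξ / (2K)`. -/
noncomputable def scaledPos (k α : ℝ) (b : Background) (x t : ℝ) : ℂ :=
  sc k ((α : ℂ) * (xi k α b x t : ℂ))

lemma laxDatum_shift (hk0 : 0 < k) (hk1 : k < 1) {v : ℂ} (hv : |v.re| ≤ 1 / 4)
    (h4 : jt4 (tau k) v ≠ 0) : laxDatum k α b x t (v + tau k) =
      (laxDatum k α b x t v).shift (tau k) (scaledPos k α b x t) := by
  have hz := zetaV_add_tau hk0 hk1 h4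
  have hc := coZetaV_add_tau b hk0 hk1 hv
  ext
  · rfl
  · simp only [laxDatum, LaxDatum.shift, specV_add_tau, omegaV_add_tau, hz, ← exp_add, scaledPos,
      sc]
    congr 1; ring
  · simp only [laxDatum, LaxDatum.shift, specV_add_tau, omegaV_add_tau, hc, ← exp_add, scaledPos,
      sc]
    congr 1; ring

lemma compl_ofReal (hk0 : 0 < k) (hk1 : k < 1) :
    (compl k : ℂ) = (jt4 (tau k) 0 / jt3 (tau k) 0) ^ 2 := by
  have h := compl_thetaModulus (periodRatio_pos hk0 hk1)
  obtain ⟨-, h3, h4⟩ := jt_zero_re (periodRatio k)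
  rw [thetaModulus_periodRatio hk0 hk1] at h
  rw [h, tau_eq]
  push_cast
  rw [h3, h4]

lemma modulus_ofReal (hk0 : 0 < k) (hk1 : k < 1) :
    (k : ℂ) = (jt2 (tau k) 0 / jt3 (tau k) 0) ^ 2 := by
  have h := thetaModulus_ofReal (periodRatio k)
  rwa [thetaModulus_periodRatio hk0 hk1, ← tau_eq] at h

lemma tquot_cube_add_half_tau {τ v : ℂ} (hτ : 0 < τ.im) (n2 : jt2 τ 0 ≠ 0) (h3 : jt3 τ v ≠ 0) :
    tdn τ (v + τ / 2) * tsn τ (v + τ / 2) / tcn τ (v + τ / 2) ^ 3 =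
      -(jt2 τ 0 ^ 2 * jt1 τ v * jt2 τ v * jt4 τ v / (jt4 τ 0 ^ 2 * jt3 τ v ^ 3)) := by
  have n3 := jt3_zero_ne hτ
  have n4 := jt4_zero_ne hτ
  simp only [tsn, tcn, tdn, jt1_add_half_tau, jt2_add_half_tau, jt3_add_half_tau, jt4_add_half_tau]
  have he := Complex.exp_ne_zero (-(π * I * (τ / 4 + v)))
  have hI := Complex.I_ne_zero
  by_cases h1 : jt1 τ v = 0
  · simp [h1]
  · field_simp
    rw [Complex.I_sq]
    ring

lemma omegaV_dn (hk0 : 0 < k) (hk1 : k < 1) (α : ℝ) {v : ℂ} (h3 : jt3 (tau k) v ≠ 0)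
    (h4 : jt4 (tau k) v ≠ 0) : omegaV k α .dnType v =
      (α : ℂ) ^ 3 * (jt2 (tau k) 0 ^ 2 * jt4 (tau k) 0 ^ 2 / jt3 (tau k) 0 ^ 4) *
        (jt1 (tau k) v * jt2 (tau k) v * (jt3 (tau k) v / jt4 (tau k) v ^ 3 -
          jt4 (tau k) v / jt3 (tau k) v ^ 3)) := by
  have hτ := tau_im_pos hk0 hk1
  have n2 := jt2_tau_ne hk0 hk1
  have n3 := jt3_zero_ne hτ
  have n4 := jt4_zero_ne hτ
  simp only [omegaV, bgShift, tquot_cube_add_half_tau hτ n2 h3, compl_ofReal hk0 hk1]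
  rw [show (k : ℂ) ^ 2 = ((jt2 (tau k) 0 / jt3 (tau k) 0) ^ 2) ^ 2 by
    rw [← modulus_ofReal hk0 hk1]]
  simp only [tsn, tcn, tdn]
  field_simp
  ring

/-- On the `dn` background the reflections `v ↦ ±1/2 - v` exchange the two columns of the
fundamental solution. -/
lemma laxDatum_flip (hk0 : 0 < k) (hk1 : k < 1) {h η : ℂ} (hη : η ^ 2 = 1)
    (h34 : ∀ z, jt3 (tau k) (h - z) = jt4 (tau k) z)
    (h43 : ∀ z, jt4 (tau k) (h - z) = jt3 (tau k) z)
    (h12 : ∀ z, jt1 (tau k) (h - z) = η * jt2 (tau k) z)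
    (h21 : ∀ z, jt2 (tau k) (h - z) = η * jt1 (tau k) z) {v : ℂ}
    (hh : zetaV k (h - v) = -zetaV k (v + 1 / 2)) (hh' : zetaV k (h - v + 1 / 2) = -zetaV k v)
    (n3 : jt3 (tau k) v ≠ 0) (n4 : jt4 (tau k) v ≠ 0)
    (hs : specV k α .dnType (h - v) = specV k α .dnType v) :
    laxDatum k α .dnType x t (h - v) = (laxDatum k α .dnType x t v).flip h := by
  have ho : omegaV k α .dnType (h - v) = -omegaV k α .dnType v := by
    rw [omegaV_dn hk0 hk1 α n3 n4,
      omegaV_dn hk0 hk1 α (by rw [h34]; exact n4) (by rw [h43]; exact n3), h34, h43, h12, h21]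
    linear_combination ((α : ℂ) ^ 3 * (jt2 (tau k) 0 ^ 2 * jt4 (tau k) 0 ^ 2 / jt3 (tau k) 0 ^ 4) *
      (jt1 (tau k) v * jt2 (tau k) v * (jt4 (tau k) v / jt3 (tau k) v ^ 3 -
        jt3 (tau k) v / jt4 (tau k) v ^ 3))) * hη
  ext
  · rfl
  · simp only [laxDatum, LaxDatum.flip, ho, hs, hh, coZetaV]
    congr 1; ring
  · simp only [laxDatum, LaxDatum.flip, ho, hs, hh', coZetaV]
    congr 1; ring

end Datum

/-! ### Parameters with imaginary spectral parameter -/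

section Classify

variable {k : ℝ}

/-- `λ(z) ∈ iℝ` forces `v` onto the symmetry lines of the period rectangle, by the addition
theorems that factor `λ(v) - λ(w)`. -/
lemma conj_cases_of_specV (hk0 : 0 < k) (hk1 : k < 1) {α : ℝ} (hα : α ≠ 0) {b : Background}
    {v : ℂ} (hre : |v.re| ≤ 1 / 4) (him : |v.im| ≤ periodRatio k / 2)
    (hne : specV k α b v ≠ 0) (h0 : (specV k α b v).re = 0) :
    conj v = v ∨ v = conj v + tau k ∨ conj v = v + tau k ∨
      (b = .dnType ∧ (conj v = 1 / 2 - v ∨ conj v = -(1 / 2) - v)) := by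
  have hs := periodRatio_pos hk0 hk1
  have hτ := tau_im_pos hk0 hk1
  have n2 := jt2_tau_ne hk0 hk1
  have n3 := jt3_zero_ne hτ
  have n4 := jt4_zero_ne hτ
  have hconj : specV k α b (conj v) = specV k α b v := by
    have h := specV_conj k α b v
    have h' : conj (specV k α b v) = -specV k α b v := by
      apply Complex.ext <;> simp [h0]
    rw [h'] at h
    exact (neg_inj.mp h).symm
  have hα' : (α : ℂ) ≠ 0 := by exact_mod_cast hα
  have hk' : (k : ℂ) ≠ 0 := by exact_mod_cast hk0.ne'
  have hI := Complex.I_ne_zero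
  have hsub : v - conj v = I * ((2 * v.im : ℝ) : ℂ) := by
    rw [Complex.sub_conj]; push_cast; ring
  have hadd : v + conj v = ((2 * v.re : ℝ) : ℂ) := Complex.add_conj v
  have hcj (w : ℂ) (f : ℂ → ℂ) (hf : ∀ z, conj (f z) = f (conj z)) (h : f w ≠ 0) :
      f (conj w) ≠ 0 := by
    rw [← hf]; exact (map_ne_zero _).mpr h
  have c2 := fun z => jt2_conj z (tau_conj k)
  have c3 := fun z => jt3_conj z (tau_conj k)
  have c4 := fun z => jt4_conj z (tau_conj k)
  have lines : jt1 (tau k) (v - conj v) = 0 →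
      conj v = v ∨ v = conj v + tau k ∨ conj v = v + tau k := by
    intro h
    rw [tau_eq] at h
    obtain ⟨-, n, -, hn⟩ := exists_of_jt1_eq_zero hs h
    rw [hsub, I_mul_im] at hn
    have hn1 : |(n : ℝ)| ≤ 1 := by
      have : |(n : ℝ) * periodRatio k| ≤ periodRatio k := by
        rw [← hn, abs_mul, abs_two]; linarith
      rw [abs_mul, abs_of_pos hs] at this
      nlinarith
    have hn2 : |n| ≤ 1 := by exact_mod_cast hn1
    rw [hn] at hsub
    rw [abs_le] at hn2
    obtain ⟨hl, hu⟩ := hn2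
    interval_cases n
    · right; right
      rw [tau_eq]; push_cast at hsub; linear_combination -hsub
    · left
      push_cast at hsub; linear_combination -hsub
    · right; left
      rw [tau_eq]; push_cast at hsub; linear_combination hsub
  cases b
  · have h4 : jt4 (tau k) v ≠ 0 := by
      intro h; apply hne; simp [specV, tsn, h]
    have h2 : jt2 (tau k) v ≠ 0 := by
      intro h; apply hne; simp [specV, tcn, h]
    have h4' := hcj v _ c4 h4
    have h2' := hcj v _ c2 h2
    have hadd3 := jt1_jt3_addition hτ v (-conj v)
    rw [jt1_neg, jt2_neg, jt3_neg, jt4_neg, ← sub_eq_add_neg, sub_neg_eq_add] at hadd3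
    simp only [specV, tsn, tcn, tdn] at hconj
    field_simp at hconj
    have hz : jt1 (tau k) (v - conj v) * jt3 (tau k) (v + conj v) = 0 := by
      refine (mul_eq_zero.mp (?_ : _ * (jt2 (tau k) 0 * jt4 (tau k) 0) = 0)).resolve_right
        (mul_ne_zero n2 n4)
      rw [hadd3]
      linear_combination -hconj
    have hj3 : jt3 (tau k) (v + conj v) ≠ 0 := by
      rw [hadd]
      exact jt3_ne_zero hτ (by simpa using hτ)
    rcases lines ((mul_eq_zero.mp hz).resolve_right hj3) with h | h | h
    · exact Or.inl h
    · exact Or.inr (Or.inl h)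
    · exact Or.inr (Or.inr (Or.inl h))
  · have h4 : jt4 (tau k) v ≠ 0 := by
      intro h; apply hne; simp [specV, tsn, h]
    have h3 : jt3 (tau k) v ≠ 0 := by
      intro h; apply hne; simp [specV, tdn, h]
    have h4' := hcj v _ c4 h4
    have h3' := hcj v _ c3 h3
    have hadd2 := jt1_jt2_addition hτ v (-conj v)
    rw [jt1_neg, jt2_neg, jt3_neg, jt4_neg, ← sub_eq_add_neg, sub_neg_eq_add] at hadd2
    simp only [specV, tsn, tcn, tdn] at hconj
    field_simp at hconj
    have hz : jt1 (tau k) (v - conj v) * jt2 (tau k) (v + conj v) = 0 := by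
      refine (mul_eq_zero.mp (?_ : _ * (jt3 (tau k) 0 * jt4 (tau k) 0) = 0)).resolve_right
        (mul_ne_zero n3 n4)
      rw [hadd2]
      linear_combination -hconj
    rcases mul_eq_zero.mp hz with h | h
    · rcases lines h with h | h | h
      · exact Or.inl h
      · exact Or.inr (Or.inl h)
      · exact Or.inr (Or.inr (Or.inl h))
    · refine Or.inr (Or.inr (Or.inr ⟨rfl, ?_⟩))
      rw [tau_eq] at h
      obtain ⟨m, -, hm, -⟩ := exists_of_jt2_eq_zero hs h
      rw [hadd, Complex.ofReal_re] at hm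
      rw [hm] at hadd
      rw [abs_le] at hre
      have hl : (-2 : ℝ) < m := by linarith
      have hu : (m : ℝ) < 1 := by linarith
      have hl' : -2 < m := by exact_mod_cast hl
      have hu' : m < 1 := by exact_mod_cast hu
      interval_cases m
      · right; push_cast at hadd; linear_combination hadd
      · left; push_cast at hadd; linear_combination hadd

/-- The datum of a parameter with `λ(z) ∈ iℝ` is equivalent to its conjugate: on each of the lines
of `conj_cases_of_specV` the conjugate argument differs by a translation or a reflection that the
seed and the numerator form see at most up to sign. -/
lemma laxDatum_cconj_equivalent (hk0 : 0 < k) (hk1 : k < 1) {α : ℝ} (hα : α ≠ 0) {b : Background}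
    (x t : ℝ) {v : ℂ} (hre : |v.re| ≤ 1 / 4) (him : |v.im| ≤ periodRatio k / 2)
    (hne : specV k α b v ≠ 0) (h0 : (specV k α b v).re = 0) :
    ∃ η : ℂ, (η = 1 ∨ η = -1) ∧ (laxDatum k α b x t v).cconj.Equivalent b (tau k)
      (scaledPos k α b x t) η (laxDatum k α b x t v) := by
  have h4 : jt4 (tau k) v ≠ 0 := by
    intro h; apply hne; cases b <;> simp [specV, tsn, h]
  have h4' : jt4 (tau k) (conj v) ≠ 0 := by
    rw [← jt4_conj _ (tau_conj k)]; exact (map_ne_zero _).mpr h4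
  have hre' : |(conj v).re| ≤ 1 / 4 := by simpa using hre
  have hspec : specV k α b (conj v) = specV k α b v := by
    have h := specV_conj k α b v
    have h' : conj (specV k α b v) = -specV k α b v := by
      apply Complex.ext <;> simp [h0]
    rw [h'] at h
    exact (neg_inj.mp h).symm
  rw [← laxDatum_conj α b x t hk0 hk1 hre]
  rcases conj_cases_of_specV hk0 hk1 hα hre him hne h0 with h | h | h | ⟨rfl, h | h⟩
  · rw [h]
    exact ⟨1, Or.inl rfl, LaxDatum.Equivalent.refl _⟩
  · refine ⟨1, Or.inl rfl, ?_⟩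
    have hd := laxDatum_shift α b x t hk0 hk1 hre' h4'
    rw [← h] at hd
    rw [hd]
    exact LaxDatum.Equivalent.shift _
  · refine ⟨1, Or.inl rfl, ?_⟩
    have hd := laxDatum_shift α b x t hk0 hk1 hre h4
    rw [← h] at hd
    rw [hd]
    exact (LaxDatum.Equivalent.shift _).symm (by norm_num)
  · have n3 : jt3 (tau k) v ≠ 0 := by rw [← jt4_half_sub, ← h]; exact h4'
    refine ⟨1, Or.inl rfl, LaxDatum.Equivalent.symm (by norm_num) ?_⟩
    have hd := laxDatum_flip α x t hk0 hk1 (h := 1 / 2) (η := 1) (by norm_num) (jt3_half_sub _)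
      (jt4_half_sub _) (fun z => by rw [jt1_half_sub, one_mul])
      (fun z => by rw [jt2_half_sub, one_mul]) (v := v)
      (by rw [← zetaV_neg, ← zetaV_add_one k (-(v + 1 / 2))]; congr 1; ring)
      (by rw [← zetaV_neg, ← zetaV_add_one k (-v)]; congr 1; ring) n3 h4 (by rw [← h, hspec])
    rw [h, hd]
    exact LaxDatum.Equivalent.flip (by norm_num) (jt3_half_sub _) (jt4_half_sub _)
      (fun z => by rw [jt1_half_sub, one_mul]) (fun z => by rw [jt2_half_sub, one_mul]) _
  · have e (z : ℂ) : -(1 / 2) - z = -(z + 1 / 2) := by ring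
    have f3 (z : ℂ) : jt3 (tau k) (-(1 / 2) - z) = jt4 (tau k) z := by
      rw [e, jt3_neg, jt3_add_half]
    have f4 (z : ℂ) : jt4 (tau k) (-(1 / 2) - z) = jt3 (tau k) z := by
      rw [e, jt4_neg, jt4_add_half]
    have f1 (z : ℂ) : jt1 (tau k) (-(1 / 2) - z) = -1 * jt2 (tau k) z := by
      rw [e, jt1_neg, jt1_add_half, neg_one_mul]
    have f2 (z : ℂ) : jt2 (tau k) (-(1 / 2) - z) = -1 * jt1 (tau k) z := by
      rw [e, jt2_neg, jt2_add_half, neg_one_mul]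
    have n3 : jt3 (tau k) v ≠ 0 := by rw [← f4, ← h]; exact h4'
    refine ⟨-1, Or.inr rfl, LaxDatum.Equivalent.symm (by norm_num) ?_⟩
    have hd := laxDatum_flip α x t hk0 hk1 (h := -(1 / 2)) (η := -1) (by norm_num) f3 f4 f1 f2
      (v := v) (by rw [e, zetaV_neg]) (by rw [← zetaV_neg]; congr 1; ring) n3 h4
      (by rw [← h, hspec])
    rw [h, hd]
    exact LaxDatum.Equivalent.flip (by norm_num) f3 f4 f1 f2 _

end Classify

/-! ### Translation to scaled arguments -/

/-- The scaled argument `i (z - l) / (2K)` of the uniformizing parameter `z`. -/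
noncomputable def scaledArg (k : ℝ) (b : Background) (z : ℂ) : ℂ := sc k (argMinus k b z)

section Translate

variable {k : ℝ} {b : Background}

lemma sc_add (k : ℝ) (u w : ℂ) : sc k (u + w) = sc k u + sc k w := add_div _ _ _

lemma sc_sub (k : ℝ) (u w : ℂ) : sc k (u - w) = sc k u - sc k w := sub_div _ _ _

lemma sc_neg (k : ℝ) (u : ℂ) : sc k (-u) = -sc k u := neg_div _ _

lemma sc_I_mul_K' (k : ℝ) : sc k (I * ellipticK' k) = tau k / 2 := by
  rw [sc, tau]; ring

lemma sc_K (hk0 : 0 < k) (hk1 : k < 1) : sc k (ellipticK k) = 1 / 2 := by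
  have := ellipticK_ofReal_ne hk0 hk1
  rw [sc]; field_simp

lemma sc_two_shift (k : ℝ) (b : Background) : sc k (2 * I * shift k b) = bgShift k b := by
  cases b
  · simp [shift, bgShift, sc]
  · rw [bgShift, ← sc_I_mul_K', shift]; congr 1; push_cast; ring

lemma sc_argPlus (k : ℝ) (b : Background) (z : ℂ) :
    sc k (argPlus k b z) = scaledArg k b z + bgShift k b := by
  rw [← sc_two_shift, scaledArg, ← sc_add, argPlus, argMinus]; congr 1; ring

lemma sc_conj (k : ℝ) (u : ℂ) : conj (sc k u) = sc k (conj u) := by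
  simp [sc, map_ofNat]

lemma scaledArg_conj (k : ℝ) (b : Background) (z : ℂ) :
    scaledArg k b (conj z) = -conj (scaledArg k b z) := by
  rw [scaledArg, scaledArg, sc_conj, ← sc_neg, argMinus, argMinus]; congr 1; simp

lemma scaledArg_reflect (k : ℝ) (b : Background) (z : ℂ) :
    scaledArg k b (2 * shift k b - conj z) = conj (scaledArg k b z) := by
  rw [scaledArg, scaledArg, sc_conj, argMinus, argMinus]; congr 1; simp; ring

lemma spec_eq (k α : ℝ) (b : Background) (z : ℂ) :
    spec k α b z = specV k α b (scaledArg k b z) := by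
  cases b <;> simp only [spec, specV, sn_eq, cn_eq, dn_eq, scaledArg]

lemma Omega_eq (k α : ℝ) (b : Background) (z : ℂ) :
    Omega k α b z = omegaV k α b (scaledArg k b z) := by
  simp only [Omega, omegaV, sn_eq, cn_eq, dn_eq, sc_argPlus, scaledArg]

lemma scaledArg_bounds (hk0 : 0 < k) (hk1 : k < 1) {z : ℂ} (hz : z ∈ rectS k b) :
    |(scaledArg k b z).re| ≤ 1 / 4 ∧ |(scaledArg k b z).im| ≤ periodRatio k / 2 := by
  obtain ⟨h1, h2, h3, h4⟩ := hz
  have hK := ellipticK_pos hk0.le hk1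
  have e : scaledArg k b z = ((-z.im / (2 * ellipticK k) : ℝ) : ℂ) +
      (((z.re - shift k b) / (2 * ellipticK k) : ℝ) : ℂ) * I := by
    rw [scaledArg, sc, argMinus]
    conv_lhs => rw [← Complex.re_add_im z]
    push_cast
    linear_combination (z.im / (2 * (ellipticK k : ℂ))) * Complex.I_mul_I
  have er : (scaledArg k b z).re = -z.im / (2 * ellipticK k) := by
    rw [e, Complex.add_re, Complex.ofReal_re, Complex.re_ofReal_mul, Complex.I_re, mul_zero, add_zero]
  have ei : (scaledArg k b z).im = (z.re - shift k b) / (2 * ellipticK k) := by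
    rw [e, Complex.add_im, Complex.ofReal_im, Complex.im_ofReal_mul, Complex.I_im, mul_one, zero_add]
  rw [er, ei, periodRatio, abs_div, abs_div, abs_of_pos (show (0 : ℝ) < 2 * ellipticK k by linarith),
    abs_neg, div_le_iff₀ (by linarith), div_div, div_le_div_iff₀ (by linarith) (by linarith)]
  constructor
  · rw [abs_le]; constructor <;> linarith
  · rw [mul_comm (ellipticK k) 2]
    refine mul_le_mul_of_nonneg_right ?_ (by linarith)
    rw [abs_le]; constructor <;> linarith

/-- In the strip `|Im u| ≤ K'` the segment from `0` to `u` meets no pole before its endpoint. -/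
lemma jacobiZeta_of_im (hk0 : 0 < k) (hk1 : k < 1) {u : ℂ} (hi : |(sc k u).im| ≤ periodRatio k / 2)
    (h4 : jt4 (tau k) (sc k u) ≠ 0) : jacobiZeta k u = zetaV k (sc k u) := by
  refine jacobiZeta_eq hk0 hk1 fun r hr0 hr1 => ?_
  rcases hr1.eq_or_lt with rfl | hr
  · rwa [Complex.ofReal_one, one_mul]
  · refine jt4_ne_zero (tau_im_pos hk0 hk1) ?_
    have hp := periodRatio_pos hk0 hk1
    rw [Complex.im_ofReal_mul, abs_mul, abs_of_nonneg hr0, tau_im]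
    nlinarith [abs_nonneg (sc k u).im]

/-- For `0 < Re u < 2K` the segment from `0` to `u` meets no pole. -/
lemma jacobiZeta_of_re (hk0 : 0 < k) (hk1 : k < 1) {u : ℂ} (h0 : 0 < (sc k u).re)
    (h1 : (sc k u).re < 1) : jacobiZeta k u = zetaV k (sc k u) := by
  refine jacobiZeta_eq hk0 hk1 fun r hr0 hr1 => ?_
  rcases hr0.eq_or_lt with rfl | hr
  · rw [Complex.ofReal_zero, zero_mul]
    exact jt4_zero_ne (tau_im_pos hk0 hk1)
  · refine jt4_tau_ne_of_re hk0 hk1 ?_ ?_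
    · rw [Complex.re_ofReal_mul]; positivity
    · rw [Complex.re_ofReal_mul]; nlinarith

lemma zetaV_half_add_half_tau (hk0 : 0 < k) (hk1 : k < 1) :
    zetaV k (tau k / 2 + 1 / 2) = -(π * I / (2 * ellipticK k)) := by
  have h4 : jt4 (tau k) (-(tau k / 2 + 1 / 2) + 1) ≠ 0 :=
    jt4_tau_ne_of_re hk0 hk1 (by norm_num [tau_re]) (by norm_num [tau_re])
  have h := zetaV_add_tau hk0 hk1 h4
  rw [zetaV_add_one, zetaV_neg, show -(tau k / 2 + 1 / 2) + 1 + tau k = tau k / 2 + 1 / 2 by ring] at h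
  linear_combination h / 2

/-- The factor `exp (α ξ Z(2il + K))`: `1` or `exp (-π i y)`. -/
noncomputable def bgPhase (b : Background) (y : ℂ) : ℂ :=
  match b with
  | .cnType => 1
  | .dnType => exp (-(π * I * y))

lemma exp_zetaShift (hk0 : 0 < k) (hk1 : k < 1) (α : ℝ) (b : Background) (x t : ℝ) :
    exp ((α : ℂ) * (xi k α b x t : ℂ) * zetaShift k b) = bgPhase b (scaledPos k α b x t) := by
  have e : sc k (2 * I * shift k b + ellipticK k) = bgShift k b + 1 / 2 := by
    rw [sc_add, sc_two_shift, sc_K hk0 hk1]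
  rw [zetaShift, jacobiZeta_of_re hk0 hk1 (by rw [e]; cases b <;> simp [bgShift, tau_re])
    (by rw [e]; cases b <;> norm_num [bgShift, tau_re]), e]
  cases b
  · rw [bgShift, zero_add, zetaV, jt4Log_half, zero_div, mul_zero, Complex.exp_zero, bgPhase]
  · rw [bgShift, zetaV_half_add_half_tau hk0 hk1, bgPhase, scaledPos, sc]
    congr 1; ring

lemma E1_eq (hk0 : 0 < k) (hk1 : k < 1) (α : ℝ) (x t : ℝ) {z : ℂ} (hz : z ∈ rectS k b)
    (h4 : jt4 (tau k) (scaledArg k b z) ≠ 0) :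
    E1 k α b x t z = (laxDatum k α b x t (scaledArg k b z)).P := by
  rw [E1, jacobiZeta_of_im hk0 hk1 (scaledArg_bounds hk0 hk1 hz).2 h4, spec_eq, Omega_eq]
  rfl

lemma E2_eq (hk0 : 0 < k) (hk1 : k < 1) (α : ℝ) (x t : ℝ) {z : ℂ} (hz : z ∈ rectS k b) :
    bgPhase b (scaledPos k α b x t) * E2 k α b x t z =
      (laxDatum k α b x t (scaledArg k b z)).Q := by
  have hv := (scaledArg_bounds hk0 hk1 hz).1
  set v := scaledArg k b z with hvdef
  have e : sc k (argPlus k b z + ellipticK k + I * ellipticK' k) =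
      v + 1 / 2 + (bgShift k b + tau k / 2) := by
    rw [sc_add, sc_add, sc_argPlus, sc_K hk0 hk1, sc_I_mul_K', ← hvdef]; ring
  obtain ⟨h0, h1⟩ := half_shift_re v (bgShift k b + tau k / 2)
    (by cases b <;> simp [bgShift, tau_re]) hv
  rw [E2, jacobiZeta_of_re hk0 hk1 (by rwa [e]) (by rwa [e]), e, spec_eq, Omega_eq, ← hvdef,
    laxDatum]
  cases b
  · simp only [bgPhase, bgShift, one_mul, zero_add, coZetaV]
    congr 1; ring
  · obtain ⟨h0, h1⟩ := half_shift_re v 0 rfl hv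
    rw [add_zero] at h0 h1
    have h := zetaV_add_tau hk0 hk1 (jt4_tau_ne_of_re hk0 hk1 h0 h1)
    simp only [bgPhase, bgShift, add_halves, coZetaV, h, ← exp_add, scaledPos, sc]
    congr 1; ring

end Translate

/-! ### The theta forms in the solution -/

section Entries

variable {k : ℝ} {b : Background}

lemma bgPhase_mul_neg (b : Background) (y : ℂ) : bgPhase b y * bgPhase b (-y) = 1 := by
  cases b
  · simp [bgPhase]
  · rw [bgPhase, bgPhase, mul_neg, neg_neg, mul_comm, exp_mul_exp_neg']

lemma bgPhase_conj {y : ℂ} (hy : conj y = y) : conj (bgPhase b y) = bgPhase b (-y) := by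
  cases b <;> simp [bgPhase, ← Complex.exp_conj, hy]

lemma scaledPos_conj (k α : ℝ) (b : Background) (x t : ℝ) :
    conj (scaledPos k α b x t) = scaledPos k α b x t := by
  rw [scaledPos, sc_conj]; simp

/-- A common exponential factor cancels from theta quotients with arguments moved by `bgShift`. -/
lemma jt_add_bgShift (k : ℝ) (b : Background) (w y : ℂ) :
    jt3 (tau k) (w + bgShift k b + y) / jt2 (tau k) (w + bgShift k b) =
        bgPhase b y * (thB b (tau k) (w + y) / thA b (tau k) w) ∧
      jt2 (tau k) (w + bgShift k b + y) / jt3 (tau k) (w + bgShift k b) =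
        bgPhase b y * (thA b (tau k) (w + y) / thB b (tau k) w) := by
  cases b
  · simp [bgShift, bgPhase, thA, thB]
  · have h := Complex.exp_ne_zero (-(π * I * (tau k / 4 + w)))
    have e : exp (-(π * I * (tau k / 4 + (w + y)))) =
        exp (-(π * I * (tau k / 4 + w))) * exp (-(π * I * y)) := by rw [← exp_add]; congr 1; ring
    simp only [bgShift, bgPhase, thA, thB, show w + tau k / 2 + y = w + y + tau k / 2 by ring,
      jt2_add_half_tau, jt3_add_half_tau, e, mul_div_mul_comm, mul_div_cancel_left₀ _ h, and_self]

lemma sc_argMinus_eq (k : ℝ) (b : Background) (z : ℂ) : sc k (argMinus k b z) = scaledArg k b z :=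
  rfl

lemma sc_pos_eq (k α : ℝ) (b : Background) (x t : ℝ) :
    sc k ((α : ℂ) * (xi k α b x t : ℂ)) = scaledPos k α b x t := rfl

/-- The Darboux seed with constant `1` is a scalar multiple of `seedVec`. -/
lemma seed_eq (hk0 : 0 < k) (hk1 : k < 1) (α : ℝ) (x t : ℝ) {z : ℂ} (hz : z ∈ rectS k b)
    (h4 : jt4 (tau k) (scaledArg k b z) ≠ 0) (i : Fin 2) :
    seed k α b x t z 1 i =
      α * jt2 (tau k) 0 * jt4 (tau k) 0 / (jt3 (tau k) 0 * jt4 (tau k) (scaledPos k α b x t)) *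
        seedVec b (tau k) (scaledPos k α b x t) (laxDatum k α b x t (scaledArg k b z)) i := by
  have h1 := E1_eq hk0 hk1 α x t hz h4
  have h2 := E2_eq hk0 hk1 α x t hz
  have hp := bgPhase_mul_neg b (scaledPos k α b x t)
  have q1 := (jt_add_bgShift k b (scaledArg k b z) (scaledPos k α b x t)).1
  have q2 := (jt_add_bgShift k b (scaledArg k b z) (-scaledPos k α b x t)).1
  simp only [seed, Phi, theta1_eq, theta2_eq, theta3_eq, theta4_eq, sc_add, sc_sub, sc_argPlus,
    sc_argMinus_eq, sc_pos_eq, exp_zetaShift hk0 hk1, Matrix.smul_mulVec, Pi.smul_apply, smul_eq_mul]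
  congr 1
  have hv : (laxDatum k α b x t (scaledArg k b z)).v = scaledArg k b z := rfl
  fin_cases i
  · simp only [seedVec, Matrix.mulVec, dotProduct, Fin.sum_univ_two, Fin.zero_eta, Matrix.cons_val_zero,
      Matrix.cons_val_one, Matrix.of_apply, q1, ← h1, ← h2, hv]
    ring
  · simp only [seedVec, Matrix.mulVec, dotProduct, Fin.sum_univ_two, Fin.mk_one, Matrix.cons_val_zero,
      Matrix.cons_val_one, Matrix.of_apply, sub_eq_add_neg, q2, ← h1, ← h2, hv]
    linear_combination (-(thB b (tau k) (scaledArg k b z + -scaledPos k α b x t) /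
      thA b (tau k) (scaledArg k b z) * E1 k α b x t z)) * hp

variable {ι : Type} {z : ι → ℂ}

lemma E2_eq' (hk0 : 0 < k) (hk1 : k < 1) (α : ℝ) (x t : ℝ) {z : ℂ} (hz : z ∈ rectS k b) :
    E2 k α b x t z = bgPhase b (-scaledPos k α b x t) *
      (laxDatum k α b x t (scaledArg k b z)).Q := by
  rw [← E2_eq hk0 hk1 α x t hz, ← mul_assoc, mul_comm (bgPhase b _), bgPhase_mul_neg, one_mul]

lemma sc_pair (k : ℝ) (b : Background) (z w : ℂ) :
    sc k (I * (w - conj z)) = scaledArg k b w + conj (scaledArg k b z) ∧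
    sc k (I * (conj z + w)) = scaledArg k b w - conj (scaledArg k b z) + bgShift k b := by
  have h := scaledArg_conj k b z
  rw [eq_comm, neg_eq_iff_eq_neg] at h
  rw [h, ← sc_two_shift, scaledArg, scaledArg, sub_neg_eq_add, ← sub_eq_add_neg, ← sc_sub, ← sc_add, ← sc_add,
    argMinus, argMinus]
  constructor <;> congr 1 <;> ring

lemma matD_eq (hk0 : 0 < k) (hk1 : k < 1) (α : ℝ) (x t : ℝ) (hz : ∀ i, z i ∈ rectS k b)
    (h4 : ∀ i, jt4 (tau k) (scaledArg k b (z i)) ≠ 0) (i j : ι) :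
    matD k α b z (fun _ => 1) x t i j = denForm b (tau k) (scaledPos k α b x t)
      (laxDatum k α b x t (scaledArg k b (z i))).cconj
      (laxDatum k α b x t (scaledArg k b (z j))) := by
  obtain ⟨s1, s2⟩ := sc_pair k b (z i) (z j)
  have s3 : sc k (I * (conj (z i) - z j)) =
      -(scaledArg k b (z j) + conj (scaledArg k b (z i))) := by
    rw [← s1, ← sc_neg]; congr 1; ring
  have hp := bgPhase_mul_neg b (scaledPos k α b x t)
  have hc := bgPhase_conj (b := b) (scaledPos_conj k α b x t)
  have hc' := congrArg conj hc
  rw [Complex.conj_conj] at hc'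
  have q1 := (jt_add_bgShift k b (scaledArg k b (z j) - conj (scaledArg k b (z i)))
    (scaledPos k α b x t)).2
  have q2 := (jt_add_bgShift k b (scaledArg k b (z j) - conj (scaledArg k b (z i)))
    (-scaledPos k α b x t)).2
  rw [← sub_eq_add_neg, ← sub_eq_add_neg] at q2
  simp only [matD, Matrix.of_apply, theta1_eq, theta2_eq, theta3_eq, theta4_eq, sc_add, sc_sub, s1,
    s2, s3, sc_pos_eq, E1_eq hk0 hk1 α x t (hz _) (h4 _), E2_eq' hk0 hk1 α x t (hz _), map_one,
    map_mul, ← hc', Matrix.mulVec, dotProduct, Fin.sum_univ_two, Matrix.cons_val_zero,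
    Matrix.cons_val_one, q1, q2, denForm, thetaForm, inv_one, LaxDatum.cconj, mul_one, one_mul]
  have n1 (w y : ℂ) : jt4 (tau k) (-w + y) = jt4 (tau k) (w - y) := by
    rw [← jt4_neg]; congr 1; ring
  have n2 (w y : ℂ) : jt4 (tau k) (-w - y) = jt4 (tau k) (w + y) := by
    rw [← jt4_neg]; congr 1; ring
  have hv (j : ι) : (laxDatum k α b x t (scaledArg k b (z j))).v = scaledArg k b (z j) := rfl
  simp only [hv, n1, n2]
  generalize jt4 (tau k) _ / jt1 (tau k) _ = A₁
  generalize jt4 (tau k) _ / jt1 (tau k) _ = A₂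
  generalize thA b (tau k) _ / thB b (tau k) _ = A₃
  generalize thA b (tau k) _ / thB b (tau k) _ = A₄
  generalize (laxDatum k α b x t (scaledArg k b (z j))).Q = rQ
  generalize (laxDatum k α b x t (scaledArg k b (z j))).P = rP
  generalize (conj (laxDatum k α b x t (scaledArg k b (z i))).Q) = lQ
  generalize (conj (laxDatum k α b x t (scaledArg k b (z i))).P) = lP
  linear_combination (lP * A₃ * rQ + lQ * A₄ * rP + lQ * A₂ * rQ) * hp

/-- The exponential factor by which the entries of the numerator matrix exceed `numForm`. -/
noncomputable def numPhase (k : ℝ) (b : Background) (y : ℂ) : ℂ :=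
  match b with
  | .cnType => 1
  | .dnType => exp (-(π * I * (tau k / 4 + y)))

lemma matM_eq (hk0 : 0 < k) (hk1 : k < 1) (α : ℝ) (x t : ℝ) (hz : ∀ i, z i ∈ rectS k b)
    (h4 : ∀ i, jt4 (tau k) (scaledArg k b (z i)) ≠ 0) (i j : ι) :
    matM k α b z (fun _ => 1) x t i j = numPhase k b (scaledPos k α b x t) *
      numForm b (tau k) (scaledPos k α b x t)
        (laxDatum k α b x t (scaledArg k b (z i))).cconj
        (laxDatum k α b x t (scaledArg k b (z j))) := by
  obtain ⟨s1, s2⟩ := sc_pair k b (z i) (z j)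
  set y := scaledPos k α b x t with hy
  set v := scaledArg k b (z j) with hv
  set w := conj (scaledArg k b (z i)) with hw
  have s3 : sc k (I * (z j - conj (z i) - 2 * shift k b)) = v + w - bgShift k b := by
    rw [← s1, ← sc_two_shift, ← sc_sub]; congr 1; ring
  have s4 : sc k (I * (z j - conj (z i) + 2 * shift k b)) = v + w + bgShift k b := by
    rw [← s1, ← sc_two_shift, ← sc_add]; congr 1; ring
  have s5 : sc k (I * (conj (z i) + z j - 2 * shift k b)) = v - w := by
    rw [← sub_eq_iff_eq_add.mpr s2, ← sc_two_shift, ← sc_sub]; congr 1; ring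
  have s6 : sc k (I * (conj (z i) + z j + 2 * shift k b)) =
      v - w + bgShift k b + bgShift k b := by
    rw [← s2, ← sc_two_shift, ← sc_add]; congr 1; ring
  have hc : conj (bgPhase b (-y)) = bgPhase b y := by
    rw [← bgPhase_conj (scaledPos_conj k α b x t), Complex.conj_conj]
  have hvd (u : ℂ) : (laxDatum k α b x t u).v = u := rfl
  simp only [matM, rFun, Matrix.of_apply, theta1_eq, theta2_eq, theta3_eq, theta4_eq, sc_add,
    sc_sub, s1, s2, s3, s4, s5, s6, sc_pos_eq, sc_argPlus, sc_argMinus_eq, scaledArg_conj,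
    E1_eq hk0 hk1 α x t (hz _) (h4 _), E2_eq' hk0 hk1 α x t (hz _), map_one,
    map_mul, Matrix.mulVec, dotProduct, Fin.sum_univ_two, Matrix.cons_val_zero,
    Matrix.cons_val_one, numForm, thetaForm, LaxDatum.cconj, mul_one, one_mul, hvd, ← hy, ← hv,
    ← hw, hc]
  generalize (laxDatum k α b x t v).Q = rQ
  generalize (laxDatum k α b x t v).P = rP
  generalize (conj (laxDatum k α b x t (scaledArg k b (z i))).Q) = lQ
  generalize (conj (laxDatum k α b x t (scaledArg k b (z i))).P) = lP
  cases b
  · simp only [bgShift, bgPhase, numPhase, thA, thB, thR, bgSign, add_zero, sub_zero, jt2_neg,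
      jt4_neg, one_mul]
    ring
  · set q := exp (π * I * (tau k / 4)) with hq
    set ev := exp (π * I * v) with hev
    set ew := exp (π * I * w) with hew
    set ey := exp (π * I * y) with hey
    have hq0 : q ≠ 0 := Complex.exp_ne_zero _
    have hv0 : ev ≠ 0 := Complex.exp_ne_zero _
    have hw0 : ew ≠ 0 := Complex.exp_ne_zero _
    have hy0 : ey ≠ 0 := Complex.exp_ne_zero _
    have a1 : jt2 (tau k) (v + w - tau k / 2 - y) = ev * ew / (q * ey) * jt3 (tau k) (v + w - y) := by
      rw [← jt2_neg, show -(v + w - tau k / 2 - y) = -(v + w - y) + tau k / 2 by ring,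
        jt2_add_half_tau, jt3_neg, hq, hev, hew, hey, ← exp_add, ← exp_add, ← Complex.exp_sub]
      congr 2; ring
    have a2 : jt2 (tau k) (v + w + tau k / 2 + y) = (q * ev * ew * ey)⁻¹ * jt3 (tau k) (v + w + y) := by
      rw [show v + w + tau k / 2 + y = v + w + y + tau k / 2 by ring, jt2_add_half_tau, hq, hev,
        hew, hey, ← exp_add, ← exp_add, ← exp_add, ← exp_neg]
      congr 2; ring
    have a3 : jt4 (tau k) (v - w + tau k / 2 + tau k / 2 + y) =
        -(ew ^ 2 / (q ^ 4 * ev ^ 2 * ey ^ 2)) * jt4 (tau k) (v - w + y) := by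
      rw [show v - w + tau k / 2 + tau k / 2 + y = v - w + y + tau k by ring, jt4_add_tau, hq, hev,
        hew, hey, ← Complex.exp_nat_mul, ← Complex.exp_nat_mul, ← Complex.exp_nat_mul,
        ← Complex.exp_nat_mul, ← exp_add, ← exp_add, ← Complex.exp_sub]
      congr 3; push_cast; ring
    have a4 : jt3 (tau k) (v - w + tau k / 2) = ew / (q * ev) * jt2 (tau k) (v - w) := by
      rw [jt3_add_half_tau, hq, hev, hew, ← exp_add, ← Complex.exp_sub]
      congr 2; ring
    have a5 : jt2 (tau k) (v + tau k / 2) = (q * ev)⁻¹ * jt3 (tau k) v := by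
      rw [jt2_add_half_tau, hq, hev, ← exp_add, ← exp_neg]
      congr 2; ring
    have a6 : jt2 (tau k) (-w + tau k / 2) = ew / q * jt3 (tau k) w := by
      rw [jt2_add_half_tau, jt3_neg, hq, hew, ← Complex.exp_sub]
      congr 2; ring
    have a7 : exp (-(π * I * (tau k / 4 + y))) = (q * ey)⁻¹ := by
      rw [hq, hey, ← exp_add, ← exp_neg]; congr 1; ring
    have a8 : exp (-(π * I * y)) = ey⁻¹ := by rw [exp_neg]
    have a9 : exp (-(π * I * -y)) = ey := by rw [hey]; congr 1; ring
    simp only [bgShift, bgPhase, numPhase, thA, thB, thR, bgSign, jt4_neg, a1, a2, a3, a4, a5, a6,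
      a7, a8, a9, one_mul]
    simp only [div_eq_mul_inv, mul_inv, inv_inv]
    generalize (jt1 (tau k) (v + w))⁻¹ = J₁
    generalize (jt2 (tau k) (v - w))⁻¹ = J₂
    generalize (jt3 (tau k) v)⁻¹ = J₃
    generalize (jt3 (tau k) w)⁻¹ = J₄
    generalize (jt4 (tau k) v)⁻¹ = J₅
    generalize (jt4 (tau k) w)⁻¹ = J₆
    field_simp
    ring

end Entries

/-! ### Determinants and inverses under conjugation and scaling -/

section LinearAlgebra

variable {ι : Type} [Fintype ι] [DecidableEq ι]

lemma eq_diagonal_mul_mul {A B : Matrix ι ι ℂ} {p q : ι → ℂ}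
    (h : ∀ i j, B i j = p i * A i j * q j) :
    B = Matrix.diagonal p * A * Matrix.diagonal q := by
  ext i j
  rw [Matrix.mul_diagonal, Matrix.diagonal_mul, h]

lemma det_scaling {A B : Matrix ι ι ℂ} {p q : ι → ℂ} (h : ∀ i j, B i j = p i * A i j * q j) :
    B.det = (∏ i, p i) * A.det * ∏ i, q i := by
  rw [eq_diagonal_mul_mul h, Matrix.det_mul, Matrix.det_mul, Matrix.det_diagonal,
    Matrix.det_diagonal]

lemma inv_diagonal_of_ne {p : ι → ℂ} (hp : ∀ i, p i ≠ 0) :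
    (Matrix.diagonal p)⁻¹ = Matrix.diagonal fun i => (p i)⁻¹ := by
  refine Matrix.inv_eq_left_inv ?_
  rw [Matrix.diagonal_mul_diagonal, ← Matrix.diagonal_one]
  congr 1
  funext i
  exact inv_mul_cancel₀ (hp i)

lemma inv_scaling {A B : Matrix ι ι ℂ} {p q : ι → ℂ} (hp : ∀ i, p i ≠ 0) (hq : ∀ i, q i ≠ 0)
    (h : ∀ i j, B i j = p i * A i j * q j) (i j : ι) :
    B⁻¹ i j = (q i)⁻¹ * A⁻¹ i j * (p j)⁻¹ := by
  rw [eq_diagonal_mul_mul h, Matrix.mul_inv_rev, Matrix.mul_inv_rev, inv_diagonal_of_ne hp,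
    inv_diagonal_of_ne hq, ← mul_assoc, Matrix.mul_diagonal, Matrix.diagonal_mul]

lemma inv_map_conj (A : Matrix ι ι ℂ) (i j : ι) : (A.map conj)⁻¹ i j = conj (A⁻¹ i j) := by
  have h : A.map conj = Aᴴᵀ := rfl
  rw [h, ← Matrix.transpose_nonsing_inv, ← Matrix.conjTranspose_nonsing_inv]
  rfl

/-- A determinant is real if conjugation permutes the entries up to signs. -/
lemma conj_det_of_perm {A : Matrix ι ι ℂ} (σ : Equiv.Perm ι) {η : ι → ℂ}
    (hη : ∀ i, η i * η i = 1) (h : ∀ i j, A (σ i) (σ j) = η i * conj (A i j) * η j) :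
    conj A.det = A.det := by
  have hs : A.submatrix σ σ = Matrix.of fun i j => A (σ i) (σ j) := rfl
  rw [← Matrix.det_submatrix_equiv_self σ A]
  conv_rhs => rw [det_scaling (A := A.map conj) (B := A.submatrix σ σ) (p := η) (q := η)
    (fun i j => h i j), mul_right_comm, ← Finset.prod_mul_distrib]
  rw [Finset.prod_congr rfl fun i _ => hη i, Finset.prod_const_one, one_mul,
    Matrix.det_submatrix_equiv_self]
  exact RingHom.map_det _ A

/-- The Darboux term `X₁ M⁻¹ X₂†` keeps its value when the two rows `X₁`, `X₂` are exchanged and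
the columns rescaled, provided that the seeds are permuted up to sign by conjugation: both
`X₁ M⁻¹ X₂†` and the exchanged term have the conjugate `-X₁ M⁻¹ X₂†`, the one by the permutation,
the other because `M` is skew-Hermitian. No invertibility is needed, since the convention `M⁻¹ = 0`
for singular `M` is compatible with permutation, conjugation and scaling. -/
lemma darboux_term_swap {S S' : ι → Fin 2 → ℂ} {ev : ι → ℂ} {M M' : Matrix ι ι ℂ}
    (hM : ∀ i j, M i j = dotProduct (star (S i)) (S j) / (ev j - conj (ev i)))
    (hM' : ∀ i j, M' i j = dotProduct (star (S' i)) (S' j) / (ev j - conj (ev i)))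
    {p : ι → ℂ} (hp : ∀ i, p i ≠ 0) (h0 : ∀ i, S' i 0 = p i * S i 1)
    (h1 : ∀ i, S' i 1 = p i * S i 0) (σ : Equiv.Perm ι) {η : ι → ℂ}
    (hη : ∀ i, η i = 1 ∨ η i = -1) (hS : ∀ i a, S (σ i) a = η i * conj (S i a))
    (hev : ∀ i, ev (σ i) = -conj (ev i)) :
    dotProduct (fun i => S' i 0) (M'⁻¹.mulVec fun j => conj (S' j 1)) =
      dotProduct (fun i => S i 0) (M⁻¹.mulVec fun j => conj (S j 1)) := by
  have hη2 (i : ι) : η i * η i = 1 := by rcases hη i with h | h <;> rw [h] <;> norm_num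
  have hηc (i : ι) : conj (η i) = η i := by rcases hη i with h | h <;> rw [h] <;> simp
  have hη0 (i : ι) : η i ≠ 0 := left_ne_zero_of_mul_eq_one (hη2 i)
  have hηi (i : ι) : (η i)⁻¹ = η i := (eq_inv_of_mul_eq_one_left (hη2 i)).symm
  simp only [dotProduct, Fin.sum_univ_two, Pi.star_apply, ← starRingEnd_apply] at hM hM'
  have a1 : ∀ i j, M' i j = conj (p i) * M i j * p j := by
    intro i j
    rw [hM, hM', h0, h1, h0, h1, map_mul, map_mul]
    ring
  have a2 : ∀ i j, Mᴴ i j = -1 * M i j * 1 := by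
    intro i j
    rw [Matrix.conjTranspose_apply, ← starRingEnd_apply, hM, hM, map_div₀, map_add, map_mul,
      map_mul, map_sub, Complex.conj_conj, Complex.conj_conj, Complex.conj_conj, ← neg_sub,
      div_neg]
    ring
  have a3 : ∀ i j, M.submatrix σ σ i j = -η i * M.map conj i j * η j := by
    intro i j
    rw [Matrix.submatrix_apply, Matrix.map_apply, hM, hM, hS, hS, hS, hS, hev, hev, map_div₀,
      map_add, map_mul, map_mul, map_sub, map_mul, map_mul, Complex.conj_conj, Complex.conj_conj,
      Complex.conj_conj, hηc, map_neg, Complex.conj_conj,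
      show -conj (ev j) - -ev i = -(conj (ev j) - ev i) by ring, div_neg]
    ring
  have b1 := inv_scaling (fun i => (map_ne_zero _).mpr (hp i)) hp a1
  have b2 := inv_scaling (fun _ => neg_ne_zero.mpr one_ne_zero) (fun _ => one_ne_zero) a2
  have b3 := inv_scaling (fun i => neg_ne_zero.mpr (hη0 i)) hη0 a3
  have b2' : ∀ i j, conj (M⁻¹ j i) = -M⁻¹ i j := by
    intro i j
    have := b2 i j
    rw [← Matrix.conjTranspose_nonsing_inv, Matrix.conjTranspose_apply, ← starRingEnd_apply] at this
    rw [this]; norm_num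
  have b3' : ∀ i j, M⁻¹ (σ i) (σ j) = -(η i * conj (M⁻¹ i j) * η j) := by
    intro i j
    have := b3 i j
    rw [Matrix.inv_submatrix_equiv, Matrix.submatrix_apply, inv_map_conj, inv_neg, hηi, hηi] at this
    rw [this]; ring
  apply (starRingEnd ℂ).injective
  simp only [dotProduct, Matrix.mulVec, Finset.mul_sum, map_sum, map_mul, Complex.conj_conj]
  calc ∑ i, ∑ j, conj (S' i 0) * (conj (M'⁻¹ i j) * S' j 1)
      = ∑ i, ∑ j, -(S j 0 * (M⁻¹ j i * conj (S i 1))) := by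
        refine Finset.sum_congr rfl fun i _ => Finset.sum_congr rfl fun j _ => ?_
        have e1 := (map_ne_zero conj).mpr (hp i)
        have e2 := hp j
        rw [b1, h0, h1, map_mul, map_mul, map_mul, map_inv₀, map_inv₀, Complex.conj_conj, b2']
        field_simp
    _ = ∑ j, ∑ i, -(S j 0 * (M⁻¹ j i * conj (S i 1))) := Finset.sum_comm
    _ = ∑ j, ∑ i, -(S (σ j) 0 * (M⁻¹ (σ j) (σ i) * conj (S (σ i) 1))) := by
        rw [← Equiv.sum_comp σ]
        refine Finset.sum_congr rfl fun j _ => ?_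
        rw [← Equiv.sum_comp σ]
    _ = ∑ i, ∑ j, conj (S i 0) * (conj (M⁻¹ i j) * S j 1) := by
        refine Finset.sum_congr rfl fun i _ => Finset.sum_congr rfl fun j _ => ?_
        rw [b3', hS, hS, map_mul, hηc, Complex.conj_conj]
        linear_combination (η j * η j * conj (S i 0) * (conj (M⁻¹ i j) * S j 1)) * hη2 i +
          conj (S i 0) * (conj (M⁻¹ i j) * S j 1) * hη2 j

end LinearAlgebra

/-! ### Reflection symmetry of the solution -/

section Symmetry

variable {k : ℝ} {b : Background}

lemma xi_neg (k α : ℝ) (b : Background) (x t : ℝ) : xi k α b (-x) (-t) = -xi k α b x t := by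
  simp only [xi]; ring

lemma scaledPos_neg (k α : ℝ) (b : Background) (x t : ℝ) :
    scaledPos k α b (-x) (-t) = -scaledPos k α b x t := by
  rw [scaledPos, scaledPos, xi_neg, ← sc_neg]; congr 1; push_cast; ring

lemma laxDatum_neg (k α : ℝ) (b : Background) (x t : ℝ) (v : ℂ) :
    laxDatum k α b (-x) (-t) v = (laxDatum k α b x t v).inv := by
  ext
  · rfl
  · simp only [laxDatum, LaxDatum.inv, xi_neg, ← exp_neg]; congr 1; push_cast; ring
  · simp only [laxDatum, LaxDatum.inv, xi_neg, ← exp_neg]; congr 1; push_cast; ring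

lemma background_neg (k α : ℝ) (b : Background) (x t : ℝ) :
    background k α b (-x) (-t) = background k α b x t := by
  have h := scaledPos_neg k α b x t
  simp only [scaledPos] at h
  cases b <;> simp only [background, cn_eq, dn_eq, tcn, tdn, h, jt2_neg, jt3_neg, jt4_neg]

lemma numPhase_spec (k : ℝ) (b : Background) (y : ℂ) : numPhase k b y ≠ 0 ∧
    jt2 (tau k) (y + bgShift k b) = numPhase k b y * thA b (tau k) y ∧
    numPhase k b y = numPhase k b 0 * bgPhase b y := by
  cases b
  · simp [numPhase, bgShift, thA, bgPhase]
  · refine ⟨Complex.exp_ne_zero _, jt2_add_half_tau _ _, ?_⟩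
    rw [numPhase, numPhase, bgPhase, ← exp_add]; congr 1; ring

variable {ι : Type} [Fintype ι] [DecidableEq ι] {z : ι → ℂ}

/-- The numerator form of all pairs of parameters. -/
noncomputable def numMatrix (k α : ℝ) (b : Background) (z : ι → ℂ) (x t : ℝ) : Matrix ι ι ℂ :=
  Matrix.of fun i j => numForm b (tau k) (scaledPos k α b x t)
    (laxDatum k α b x t (scaledArg k b (z i))).cconj (laxDatum k α b x t (scaledArg k b (z j)))

/-- The denominator form of all pairs of parameters. -/
noncomputable def denMatrix (k α : ℝ) (b : Background) (z : ι → ℂ) (x t : ℝ) : Matrix ι ι ℂ :=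
  Matrix.of fun i j => denForm b (tau k) (scaledPos k α b x t)
    (laxDatum k α b x t (scaledArg k b (z i))).cconj (laxDatum k α b x t (scaledArg k b (z j)))

/-- On the `dn` background the exponential factors of the entries, of the prefactor and of
`ϑ₂(y + 2il/(2K))` cancel up to a constant. -/
lemma breatherTheta_eq (hk0 : 0 < k) (hk1 : k < 1) (α : ℝ) (x t : ℝ) (hz : ∀ i, z i ∈ rectS k b)
    (h4 : ∀ i, jt4 (tau k) (scaledArg k b (z i)) ≠ 0) :
    breatherTheta k α b z (fun _ => 1) x t =
      α * jt2 (tau k) 0 * jt4 (tau k) 0 / (jt3 (tau k) 0 * jt3 (tau k) (bgShift k b)) *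
        numPhase k b 0 *
        (jt4 (tau k) (scaledPos k α b x t) / thA b (tau k) (scaledPos k α b x t)) ^
          ((Fintype.card ι : ℤ) - 1) *
        ((numMatrix k α b z x t).det / (denMatrix k α b z x t).det) := by
  have hM : matM k α b z (fun _ => 1) x t =
      numPhase k b (scaledPos k α b x t) • numMatrix k α b z x t := by
    ext i j; exact matM_eq hk0 hk1 α x t hz h4 i j
  have hD : matD k α b z (fun _ => 1) x t = denMatrix k α b z x t := by
    ext i j; exact matD_eq hk0 hk1 α x t hz h4 i j
  obtain ⟨n0, n2, n1⟩ := numPhase_spec k b (scaledPos k α b x t)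
  have hb : bgPhase b (scaledPos k α b x t) ≠ 0 :=
    left_ne_zero_of_mul_eq_one (bgPhase_mul_neg b _)
  simp only [breatherTheta, theta2_eq, theta3_eq, theta4_eq, sc_add, sc_two_shift, sc_pos_eq, hM,
    hD, Matrix.det_smul, n2, exp_neg, exp_zetaShift hk0 hk1]
  have hquot : jt4 (tau k) (scaledPos k α b x t) / (numPhase k b (scaledPos k α b x t) *
      thA b (tau k) (scaledPos k α b x t)) = jt4 (tau k) (scaledPos k α b x t) /
      thA b (tau k) (scaledPos k α b x t) / numPhase k b (scaledPos k α b x t) := by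
    rw [div_div, mul_comm]
  rw [hquot, div_zpow _ (numPhase _ _ _), zpow_sub_one₀ n0, zpow_natCast]
  have e : numPhase k b (scaledPos k α b x t) ^ Fintype.card ι ≠ 0 := pow_ne_zero _ n0
  have e' : numPhase k b 0 = numPhase k b (scaledPos k α b x t) *
      (bgPhase b (scaledPos k α b x t))⁻¹ := by rw [n1]; field_simp
  rw [e']
  generalize α * jt2 (tau k) 0 * jt4 (tau k) 0 /
    (jt3 (tau k) 0 * jt3 (tau k) (bgShift k b)) = A
  generalize (jt4 (tau k) (scaledPos k α b x t) / thA b (tau k) (scaledPos k α b x t)) ^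
    ((Fintype.card ι : ℤ) - 1) = B
  generalize numPhase k b (scaledPos k α b x t) ^ Fintype.card ι = C at *
  rw [mul_div_assoc]
  generalize (numMatrix k α b z x t).det / (denMatrix k α b z x t).det = D
  field_simp

lemma laxDatum_ne (k α : ℝ) (b : Background) (x t : ℝ) (v : ℂ) :
    (laxDatum k α b x t v).P ≠ 0 ∧ (laxDatum k α b x t v).Q ≠ 0 :=
  ⟨Complex.exp_ne_zero _, Complex.exp_ne_zero _⟩

lemma LaxDatum.cconj_inv (d : LaxDatum) : d.inv.cconj = d.cconj.inv := by
  simp [LaxDatum.inv, LaxDatum.cconj]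

/-- Reflection replaces the numerator matrix by its adjoint and keeps the denominator matrix, up to
invertible diagonal factors that cancel in the quotient of the determinants. -/
lemma det_ratio_neg (α x t : ℝ) (z : ι → ℂ)
    (hreal : conj (numMatrix k α b z x t).det = (numMatrix k α b z x t).det) :
    (numMatrix k α b z (-x) (-t)).det / (denMatrix k α b z (-x) (-t)).det =
      (numMatrix k α b z x t).det / (denMatrix k α b z x t).det := by
  set d : ι → LaxDatum := fun i => laxDatum k α b x t (scaledArg k b (z i)) with hd
  have hP (i : ι) : (d i).P ≠ 0 := (laxDatum_ne _ _ _ _ _ _).1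
  have hQ (i : ι) : (d i).Q ≠ 0 := (laxDatum_ne _ _ _ _ _ _).2
  have hcP (i : ι) : (d i).cconj.P ≠ 0 := (map_ne_zero _).mpr (hP i)
  have hcQ (i : ι) : (d i).cconj.Q ≠ 0 := (map_ne_zero _).mpr (hQ i)
  have hN (i j : ι) : numMatrix k α b z (-x) (-t) i j = ((d i).cconj.P * (d i).cconj.Q)⁻¹ *
      (numMatrix k α b z x t)ᴴ i j * ((d j).P * (d j).Q)⁻¹ := by
    rw [Matrix.conjTranspose_apply, ← starRingEnd_apply]
    simp only [numMatrix, Matrix.of_apply, scaledPos_neg, laxDatum_neg, LaxDatum.cconj_inv]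
    rw [numForm_inv (hcP i) (hcQ i) (hP j) (hQ j),
      numForm_conj (tau_conj k) (scaledPos_conj k α b x t), LaxDatum.cconj_cconj]
  have hD (i j : ι) : denMatrix k α b z (-x) (-t) i j = ((d i).cconj.P * (d i).cconj.Q)⁻¹ *
      denMatrix k α b z x t i j * ((d j).P * (d j).Q)⁻¹ := by
    simp only [denMatrix, Matrix.of_apply, scaledPos_neg, laxDatum_neg, LaxDatum.cconj_inv]
    exact denForm_inv (hcP i) (hcQ i) (hP j) (hQ j)
  have p1 : ∏ i, ((d i).cconj.P * (d i).cconj.Q)⁻¹ ≠ 0 :=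
    Finset.prod_ne_zero_iff.mpr fun i _ => inv_ne_zero (mul_ne_zero (hcP i) (hcQ i))
  have p2 : ∏ i, ((d i).P * (d i).Q)⁻¹ ≠ 0 :=
    Finset.prod_ne_zero_iff.mpr fun i _ => inv_ne_zero (mul_ne_zero (hP i) (hQ i))
  rw [det_scaling hN, det_scaling hD, Matrix.det_conjTranspose, ← starRingEnd_apply, hreal,
    mul_div_mul_right _ _ p2, mul_div_mul_left _ _ p1]

/-- Complex conjugation permutes the data of the parameters, up to the indeterminacy that neither
the seeds nor the numerator form see. -/
def ConjSymmetric (k α : ℝ) (b : Background) (z : ι → ℂ) (x t : ℝ) (σ : Equiv.Perm ι)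
    (η : ι → ℂ) : Prop :=
  ∀ i, (η i = 1 ∨ η i = -1) ∧ (laxDatum k α b x t (scaledArg k b (z i))).cconj.Equivalent b (tau k)
    (scaledPos k α b x t) (η i) (laxDatum k α b x t (scaledArg k b (z (σ i))))

/-- The numerator determinant is real. -/
lemma ConjSymmetric.det_real {α x t : ℝ} {σ : Equiv.Perm ι} {η : ι → ℂ}
    (h : ConjSymmetric k α b z x t σ η) :
    conj (numMatrix k α b z x t).det = (numMatrix k α b z x t).det := by
  refine conj_det_of_perm σ (η := η) (fun i => ?_) fun i j => ?_
  · rcases (h i).1 with e | e <;> rw [e] <;> norm_num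
  · have hηc : conj (η i) = η i := by rcases (h i).1 with e | e <;> rw [e] <;> simp
    have hc := numForm_conj (b := b) (tau_conj k) (scaledPos_conj k α b x t)
    have hl := congrArg conj ((h i).2.left (laxDatum k α b x t (scaledArg k b (z j))))
    rw [map_mul, hc, hc, hηc, LaxDatum.cconj_cconj] at hl
    simp only [numMatrix, Matrix.of_apply]
    rw [hc, LaxDatum.cconj_cconj, (h j).2.right, hl]
    ring

lemma breatherTheta_neg (hk0 : 0 < k) (hk1 : k < 1) {α x t : ℝ} (hz : ∀ i, z i ∈ rectS k b)
    (h4 : ∀ i, jt4 (tau k) (scaledArg k b (z i)) ≠ 0) {σ : Equiv.Perm ι} {η : ι → ℂ}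
    (h : ConjSymmetric k α b z x t σ η) :
    breatherTheta k α b z (fun _ => 1) x t = breatherTheta k α b z (fun _ => 1) (-x) (-t) := by
  rw [breatherTheta_eq hk0 hk1 α x t hz h4, breatherTheta_eq hk0 hk1 α (-x) (-t) hz h4,
    det_ratio_neg α x t z h.det_real, scaledPos_neg, jt4_neg, thA_neg]

lemma breatherDarboux_neg (hk0 : 0 < k) (hk1 : k < 1) {α x t : ℝ} (hz : ∀ i, z i ∈ rectS k b)
    (h4 : ∀ i, jt4 (tau k) (scaledArg k b (z i)) ≠ 0) {σ : Equiv.Perm ι} {η : ι → ℂ}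
    (h : ConjSymmetric k α b z x t σ η)
    (hev : ∀ i, spec k α b (z (σ i)) = -conj (spec k α b (z i))) :
    breatherDarboux k α b z (fun _ => 1) x t = breatherDarboux k α b z (fun _ => 1) (-x) (-t) := by
  have hs := fun i a => seed_eq hk0 hk1 α x t (hz i) (h4 i) a
  have hs' := fun i a => seed_eq hk0 hk1 α (-x) (-t) (hz i) (h4 i) a
  have hy := scaledPos_conj k α b x t
  have hinv := fun i => seedVec_inv (b := b) (τ := tau k) (y := scaledPos k α b x t)
    (laxDatum_ne k α b x t (scaledArg k b (z i))).1 (laxDatum_ne k α b x t (scaledArg k b (z i))).2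
  have hg : conj (α * jt2 (tau k) 0 * jt4 (tau k) 0 /
      (jt3 (tau k) 0 * jt4 (tau k) (scaledPos k α b x t))) = α * jt2 (tau k) 0 * jt4 (tau k) 0 /
      (jt3 (tau k) 0 * jt4 (tau k) (scaledPos k α b x t)) := by
    simp only [map_div₀, map_mul, jt2_conj _ (tau_conj k), jt3_conj _ (tau_conj k),
      jt4_conj _ (tau_conj k), map_zero, Complex.conj_ofReal, hy]
  have hM (x t : ℝ) (i j : ι) : darbouxM k α b z (fun _ => 1) x t i j =
      dotProduct (star (seed k α b x t (z i) 1)) (seed k α b x t (z j) 1) /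
        (spec k α b (z j) - conj (spec k α b (z i))) := rfl
  set p : ι → ℂ := fun i => -((laxDatum k α b x t (scaledArg k b (z i))).P *
    (laxDatum k α b x t (scaledArg k b (z i))).Q)⁻¹ with hp
  have hp0 (i : ι) : p i ≠ 0 := neg_ne_zero.mpr (inv_ne_zero
    (mul_ne_zero (laxDatum_ne _ _ _ _ _ _).1 (laxDatum_ne _ _ _ _ _ _).2))
  have h0 (i : ι) : seed k α b (-x) (-t) (z i) 1 0 = p i * seed k α b x t (z i) 1 1 := by
    rw [hs, hs', scaledPos_neg, laxDatum_neg, jt4_neg, (hinv i).1, hp]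
    ring
  have h1 (i : ι) : seed k α b (-x) (-t) (z i) 1 1 = p i * seed k α b x t (z i) 1 0 := by
    rw [hs, hs', scaledPos_neg, laxDatum_neg, jt4_neg, (hinv i).2, hp]
    ring
  have hS (i : ι) (a : Fin 2) : seed k α b x t (z (σ i)) 1 a =
      η i * conj (seed k α b x t (z i) 1 a) := by
    rw [hs, hs, map_mul, hg, seedVec_conj (tau_conj k) hy, (h i).2.seed]
    ring
  have key := darboux_term_swap (S := fun i => seed k α b x t (z i) 1)
    (S' := fun i => seed k α b (-x) (-t) (z i) 1) (hM x t) (hM (-x) (-t)) hp0 h0 h1 σ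
    (fun i => (h i).1) hS hev
  rw [breatherDarboux, breatherDarboux, background_neg, key]

end Symmetry

section Parameters

variable {k : ℝ} {b : Background}

lemma reflect_mem_rectS {z : ℂ} (hz : z ∈ rectS k b) : 2 * (shift k b : ℂ) - conj z ∈ rectS k b := by
  obtain ⟨h1, h2, h3, h4⟩ := hz
  have hre : (2 * (shift k b : ℂ) - conj z).re = 2 * shift k b - z.re := by simp
  have him : (2 * (shift k b : ℂ) - conj z).im = z.im := by simp
  simp only [rectS, Set.mem_ofPred_eq, hre, him]
  refine ⟨?_, ?_, h3, h4⟩ <;> linarith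

/-- The permutation of the parameters induced by complex conjugation: it exchanges `z` and
`2l - z*`. -/
def conjPerm (n₁ n₂ : ℕ) : Equiv.Perm (Idx n₁ n₂) :=
  Equiv.sumCongr (Equiv.refl _) (Equiv.sumComm _ _)

end Parameters

end MKdV

theorem theorem2 (k α : ℝ) (hk0 : 0 < k) (hk1 : k < 1) (hα : α ≠ 0) (b : MKdV.Background)
    (n₁ n₂ : ℕ) (zP cP : Fin n₁ → ℂ) (zC cC : Fin n₂ → ℂ)
    (hzP : ∀ i, zP i ∈ MKdV.rectS k b) (hzC : ∀ i, zC i ∈ MKdV.rectS k b)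
    (hP : ∀ i, (MKdV.spec k α b (zP i)).re = 0)
    (hC : ∀ i, (MKdV.spec k α b (zC i)).re ≠ 0)
    (hne : ∀ i j, MKdV.spec k α b (MKdV.fullZ k b zP zC j) ≠
      conj (MKdV.spec k α b (MKdV.fullZ k b zP zC i)))
    (hc : ∀ i, MKdV.fullC cP cC i = 1) :
    (∀ x t : ℝ,
      MKdV.breatherTheta k α b (MKdV.fullZ k b zP zC) (MKdV.fullC cP cC) x t =
        MKdV.breatherTheta k α b (MKdV.fullZ k b zP zC) (MKdV.fullC cP cC) (-x) (-t)) ∧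
    (∀ x t : ℝ,
      MKdV.breatherDarboux k α b (MKdV.fullZ k b zP zC) (MKdV.fullC cP cC) x t =
        MKdV.breatherDarboux k α b (MKdV.fullZ k b zP zC) (MKdV.fullC cP cC) (-x) (-t)) := by
  open MKdV in
  rw [show fullC cP cC = fun _ => 1 from funext hc]
  have hz : ∀ i, fullZ k b zP zC i ∈ rectS k b := by
    rintro (i | i | i)
    exacts [hzP i, hzC i, reflect_mem_rectS (hzC i)]
  -- For `i = j` the hypothesis on denominators excludes `λ = 0`, and with it the zeros of `ϑ₄`,
  -- where the quotients defining `λ` take the value `0`.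
  have hs0 : ∀ i, specV k α b (scaledArg k b (fullZ k b zP zC i)) ≠ 0 := by
    intro i h
    rw [← spec_eq] at h
    exact hne i i (by rw [h, map_zero])
  have h4 : ∀ i, jt4 (tau k) (scaledArg k b (fullZ k b zP zC i)) ≠ 0 := by
    intro i h
    exact hs0 i (by cases b <;> simp [specV, tsn, h])
  have hre := fun i => (scaledArg_bounds hk0 hk1 (hz i)).1
  have hev : ∀ i, spec k α b (fullZ k b zP zC (conjPerm n₁ n₂ i)) =
      -conj (spec k α b (fullZ k b zP zC i)) := by
    rintro (i | i | i)
    · change spec k α b (zP i) = -conj (spec k α b (zP i))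
      apply Complex.ext <;> simp [hP i]
    · change spec k α b (2 * shift k b - conj (zC i)) = -conj (spec k α b (zC i))
      rw [spec_eq, spec_eq, scaledArg_reflect, specV_conj, neg_neg]
    · change spec k α b (zC i) = -conj (spec k α b (2 * shift k b - conj (zC i)))
      rw [spec_eq, spec_eq, scaledArg_reflect, specV_conj, neg_neg, Complex.conj_conj]
  have hsym : ∀ x t, ∃ η, ConjSymmetric k α b (fullZ k b zP zC) x t (conjPerm n₁ n₂) η := by
    intro x t
    have hP' : ∀ i, ∃ η : ℂ, (η = 1 ∨ η = -1) ∧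
        (laxDatum k α b x t (scaledArg k b (zP i))).cconj.Equivalent b (tau k)
          (scaledPos k α b x t) η (laxDatum k α b x t (scaledArg k b (zP i))) := fun i =>
      laxDatum_cconj_equivalent hk0 hk1 hα x t (hre (.inl i))
        (scaledArg_bounds hk0 hk1 (hzP i)).2 (hs0 (.inl i)) (by rw [← spec_eq]; exact hP i)
    choose η hη using hP'
    refine ⟨Sum.elim η fun _ => 1, ?_⟩
    rintro (i | i | i)
    · exact hη i
    · refine ⟨Or.inl rfl, ?_⟩
      change (laxDatum k α b x t (scaledArg k b (zC i))).cconj.Equivalent b (tau k)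
        (scaledPos k α b x t) 1
        (laxDatum k α b x t (scaledArg k b (2 * shift k b - conj (zC i))))
      rw [scaledArg_reflect, laxDatum_conj α b x t hk0 hk1 (scaledArg_bounds hk0 hk1 (hzC i)).1]
      exact LaxDatum.Equivalent.refl _
    · refine ⟨Or.inl rfl, ?_⟩
      change (laxDatum k α b x t (scaledArg k b (2 * shift k b - conj (zC i)))).cconj.Equivalent b
        (tau k) (scaledPos k α b x t) 1 (laxDatum k α b x t (scaledArg k b (zC i)))
      rw [scaledArg_reflect, laxDatum_conj α b x t hk0 hk1 (scaledArg_bounds hk0 hk1 (hzC i)).1,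
        LaxDatum.cconj_cconj]
      exact LaxDatum.Equivalent.refl _
  constructor
  · intro x t
    obtain ⟨η, h⟩ := hsym x t
    exact breatherTheta_neg hk0 hk1 hz h4 h
  · intro x t
    obtain ⟨η, h⟩ := hsym x t
    exact breatherDarboux_neg hk0 hk1 hz h4 h hev
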